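/- Consider general relativity with a minimally coupled massless canonical scalar field, with action $\int d^4x\sqrt{-g}\,[R/2-\tfrac12\partial_\mu\psi\,\partial^\mu\psi]$, and its static spherically symmetric solutions $ds^2=-A\,dt^2+H\,d\rho^2+r^2(d\theta^2+\sin^2\theta\,d\varphi^2)$, $\psi=\psi(\rho)$, where $A,H,r>0$ are functions of an arbitrary radial coordinate $\rho$. Let $\hat f=H^{-1/2}\,df/d\rho$, let $\phi=2\hat r/r$ be the sheet expansion, $\mathcal A=\hat A/(2A)$ the acceleration of the static observers and $K=1/r^2$ the Gaussian curvature of the spheres, and put $$x_2=\frac{\phi}{2\sqrt K},\qquad x_3=\frac{\mathcal A}{\sqrt K},\qquad y_1=\frac{\hat\psi}{\sqrt{2K}},\qquad f'=\frac{\hat f}{\sqrt K}.$$ **Reduction.** The field equations imply $y_1^2=x_2^2+2x_2x_3-1$ and $$x_2'=1-x_2(x_2+x_3),\qquad x_3'=-x_3(x_2+x_3)\qquad\text{on the region } x_2^2+2x_2x_3\ge 1 .$$ Through each point of the region there is a maximal solution that stays in the region. Conversely, each maximal solution $\xi\mapsto(x_2,x_3)$ in the region describes a metric $-A(r)\,dt^2+dr^2/B(r)+r^2d\Omega^2$,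 where the area radius satisfies $r'=x_2r$ and takes each value in its range once, $B=x_2^2$ and $d\ln A/d\ln r=2x_3/x_2$; with a suitable $\psi(r)$ every such metric solves the field equations. **Finite fixed points.** The fixed points in the region are exactly $P_M=(1,0)$ and $\bar P_M=(-1,0)$. The linearization has the eigenvalues $-2,-1$ at $P_M$ and $2,1$ at $\bar P_M$; $P_M$ is a sink (asymptotically stable) and $\bar P_M$ is a source (asymptotically stable for the reversed flow). The metric described by either fixed point is Minkowski: $B=1$, $A$ constant, $0<r<\infty$. **Points at infinity.** The Poincaré map $X_i=x_i/\sqrt{1+x_2^2+x_3^2}$ is a bijection from the region onto the part with $X_2^2+X_3^2<1$ of $\{2X_2^2+2X_2X_3+X_3^2\ge1,\ X_2^2+X_3^2\le 1\}$, and with $\tilde f=\sqrt{1-X_2^2-X_3^2}\,f'$ it carries the system to $$\tilde X_2=[1-X_2(2X_2+X_3)](1-X_2^2-X_3^2),\qquad \tilde X_3=-X_3(2X_2+X_3)(1-X_2^2-X_3^2).$$ The points at infinity, $X_2^2+X_3^2=1$, are all critical. They form two disjoint arcs of the unit circle: the right arc $X_2\ge 0$, $X_3\ge-1/\sqrt5$,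 with end points $P_H=(0,1)$ and $P_S=(2/\sqrt5,-1/\sqrt5)$, and the opposite, left arc, with end points $\bar P_H=-P_H$ and $\bar P_S=-P_S$. These four end points are exactly the points at infinity with $2X_2^2+2X_2X_3+X_3^2=1$. For the flow on the compactified region, $P_H$ and $P_S$ are (Lyapunov) unstable and $\bar P_H$ and $\bar P_S$ are (Lyapunov) stable. **Solutions.** Every maximal solution in the region is one of the following: the constant solution $P_M$ or $\bar P_M$; a solution with $x_2>0$ on an interval $(a,\infty)$, $a\in\mathbb R$, that comes from a point $Q$ of the right arc as $\xi\to a$ and tends to $P_M$ as $\xi\to\infty$; or a solution with $x_2<0$ on an interval $(-\infty,b)$, $b\in\mathbb R$, that comes from $\bar P_M$ as $\xi\to-\infty$ and tends to a point $Q$ of the left arc as $\xi\to b$. For each point $Q$ of the two arcs there is exactly one such orbit. Moreover: * (Horizons.) Exactly one orbit joins $P_H$ to $P_M$, and exactly one joins $\bar P_M$ to $\bar P_H$. On each of them the scalar field is constant ($y_1=0$) and the metric is the exterior Schwarzschild metric of some mass $M>0$: $B=1-2M/r$ and $A=c\,(1-2M/r)$ with a constant $c>0$, for $r>2M$. It is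 asymptotically flat, and $Q$ corresponds to the horizon $r=2M>0$, where $A$ and $B$ tend to $0$ while the Kretschmann scalar stays bounded. * (Singularities.) Every other non-constant solution, that is, every one with $Q\neq P_H,\bar P_H$, is a naked singularity: $r$ runs through $(0,\infty)$; $A,B>0$ throughout, so there is no horizon; the Kretschmann scalar tends to $+\infty$ as $r\to0$; $\int_0^R dr/\sqrt{AB}<\infty$ for every $R>0$, so that radial light rays from $r=0$ reach every radius in finite static time; and the metric is asymptotically flat, i.e. $A=c+O(1/r)$ for a constant $c>0$ and $B=1+O(1/r)$ as $r\to\infty$. If $Q=(\bar X_2,\bar X_3)$, then $A/r^{\beta}$ and $B/r^{\alpha}$ have positive finite limits as $r\to0$, where $\beta=2\bar X_3/\bar X_2$ and $\alpha=-2(1+\bar X_3/\bar X_2)$. * For $Q=P_S$ or $\bar P_S$ one has $y_1=0$ and the metric is the Schwarzschild metric of some negative mass on $0<r<\infty$ (so $A$ and $B$ behave like $1/r$ as $r\to0$). For all remaining points $Q$ of the two arcs, $y_1^2>0$ along the orbit. -/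

import Mathlib

open Real Set Filter Topology

noncomputable section

namespace StaticScalar

/-! ### Curvature of a metric in a four-dimensional coordinate chart -/

/-- Partial derivative of `f` in the direction of the `i`-th coordinate. -/
def pderiv (i : Fin 4) (f : (Fin 4 → ℝ) → ℝ) (p : Fin 4 → ℝ) : ℝ :=
  deriv (fun s => f (Function.update p i s)) (p i)

/-- A field of symmetric bilinear forms on a chart, given by its matrix of components. -/
abbrev MetricField := (Fin 4 → ℝ) → Matrix (Fin 4) (Fin 4) ℝ

/-- Christoffel symbols `Γ^i_{jk}` of the Levi-Civita connection. -/
def christoffel (g : MetricField) (i j k : Fin 4) (p : Fin 4 → ℝ) : ℝ :=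
  (1 / 2) * ∑ l, (g p)⁻¹ i l *
    (pderiv j (fun q => g q l k) p + pderiv k (fun q => g q l j) p - pderiv l (fun q => g q j k) p)

/-- Riemann tensor `R^i_{jkl} = ∂_k Γ^i_{lj} - ∂_l Γ^i_{kj} + Γ^i_{km} Γ^m_{lj} - Γ^i_{lm} Γ^m_{kj}`. -/
def riemann (g : MetricField) (i j k l : Fin 4) (p : Fin 4 → ℝ) : ℝ :=
  pderiv k (christoffel g i l j) p - pderiv l (christoffel g i k j) p
    + ∑ m, (christoffel g i k m p * christoffel g m l j p
          - christoffel g i l m p * christoffel g m k j p)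

/-- Ricci tensor `R_{jl} = R^i_{jil}`. -/
def ricci (g : MetricField) (j l : Fin 4) (p : Fin 4 → ℝ) : ℝ :=
  ∑ i, riemann g i j i l p

/-- Scalar curvature `R = g^{jl} R_{jl}`. -/
def scalarCurvature (g : MetricField) (p : Fin 4 → ℝ) : ℝ :=
  ∑ j, ∑ l, (g p)⁻¹ j l * ricci g j l p

/-- Einstein tensor `G_{ab} = R_{ab} - R g_{ab} / 2`. -/
def einstein (g : MetricField) (a b : Fin 4) (p : Fin 4 → ℝ) : ℝ :=
  ricci g a b p - (1 / 2) * scalarCurvature g p * g p a b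

/-- Riemann tensor with two indices up, `R^{ab}_{cd} = g^{bm} R^a_{mcd}`. -/
def riemannUp (g : MetricField) (a b c d : Fin 4) (p : Fin 4 → ℝ) : ℝ :=
  ∑ m, (g p)⁻¹ b m * riemann g a m c d p

/-- Kretschmann scalar `R_{abcd} R^{abcd} = R^{ab}_{cd} R^{cd}_{ab}`. -/
def kretschmann (g : MetricField) (p : Fin 4 → ℝ) : ℝ :=
  ∑ a, ∑ b, ∑ c, ∑ d, riemannUp g a b c d p * riemannUp g c d a b p

/-- Energy-momentum tensor of a massless canonical scalar field,
`T_{ab} = ∂_a ψ ∂_b ψ - g_{ab} (∇ψ)² / 2`. -/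
def scalarStress (g : MetricField) (f : (Fin 4 → ℝ) → ℝ) (a b : Fin 4) (p : Fin 4 → ℝ) : ℝ :=
  pderiv a f p * pderiv b f p
    - (1 / 2) * g p a b * ∑ c, ∑ d, (g p)⁻¹ c d * (pderiv c f p * pderiv d f p)

/-- Wave operator `g^{ab} (∂_a ∂_b f - Γ^c_{ab} ∂_c f)`. -/
def waveOperator (g : MetricField) (f : (Fin 4 → ℝ) → ℝ) (p : Fin 4 → ℝ) : ℝ :=
  ∑ a, ∑ b, (g p)⁻¹ a b *
    (pderiv a (pderiv b f) p - ∑ c, christoffel g c a b p * pderiv c f p)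

/-! ### Static spherically symmetric solutions with a massless canonical scalar field -/

/-- The metric `-A(ρ) dt² + H(ρ) dρ² + r(ρ)² (dθ² + sin² θ dφ²)` in the coordinates
`(t, ρ, θ, φ)`, for an arbitrary radial coordinate `ρ`. -/
def staticMetric (A H r : ℝ → ℝ) : MetricField := fun p =>
  Matrix.diagonal ![-A (p 1), H (p 1), r (p 1) ^ 2, r (p 1) ^ 2 * sin (p 2) ^ 2]

/-- `(A, H, r, ψ)` is, for `ρ` in the open interval `I`, a static spherically symmetric solution of
general relativity minimally coupled to a massless canonical scalar field `ψ`
(action `∫ √(-g) (R / 2 - (∂ψ)² / 2)`). -/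
structure IsScalarSpacetime (I : Set ℝ) (A H r ψ : ℝ → ℝ) : Prop where
  isOpen : IsOpen I
  ordConnected : I.OrdConnected
  nonempty : I.Nonempty
  contDiff_A : ContDiffOn ℝ 2 A I
  contDiff_H : ContDiffOn ℝ 2 H I
  contDiff_r : ContDiffOn ℝ 2 r I
  contDiff_ψ : ContDiffOn ℝ 2 ψ I
  pos : ∀ ρ ∈ I, 0 < A ρ ∧ 0 < H ρ ∧ 0 < r ρ
  einstein_eq : ∀ p : Fin 4 → ℝ, p 1 ∈ I → sin (p 2) ≠ 0 → ∀ a b,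
    einstein (staticMetric A H r) a b p = scalarStress (staticMetric A H r) (fun q => ψ (q 1)) a b p
  wave_eq : ∀ p : Fin 4 → ℝ, p 1 ∈ I → sin (p 2) ≠ 0 →
    waveOperator (staticMetric A H r) (fun q => ψ (q 1)) p = 0

/-- Derivative along the unit radial vector `n = H^{-1/2} ∂_ρ`. -/
def hat (H f : ℝ → ℝ) (ρ : ℝ) : ℝ := deriv f ρ / √(H ρ)

/-- Sheet expansion: the divergence of `n` along the spheres of radius `r`. -/
def sheetExpansion (H r : ℝ → ℝ) (ρ : ℝ) : ℝ := 2 * hat H r ρ / r ρ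

/-- Acceleration `n^a u^b ∇_b u_a` of the static observers `u = A^{-1/2} ∂_t`. -/
def acceleration (A H : ℝ → ℝ) (ρ : ℝ) : ℝ := hat H A ρ / (2 * A ρ)

/-- Gaussian curvature of the spheres of radius `r`. -/
def gaussCurvature (r : ℝ → ℝ) (ρ : ℝ) : ℝ := 1 / r ρ ^ 2

/-- `x₂ = φ / (2 √K)`, with `φ` the sheet expansion. -/
def x₂ (H r : ℝ → ℝ) (ρ : ℝ) : ℝ := sheetExpansion H r ρ / (2 * √(gaussCurvature r ρ))

/-- `x₃ = 𝒜 / √K`, with `𝒜` the acceleration. -/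
def x₃ (A H r : ℝ → ℝ) (ρ : ℝ) : ℝ := acceleration A H ρ / √(gaussCurvature r ρ)

/-- `y₁ = Ψ / √(2 K)`, with `Ψ` the derivative of the scalar field along `n`. -/
def y₁ (H r ψ : ℝ → ℝ) (ρ : ℝ) : ℝ := hat H ψ ρ / √(2 * gaussCurvature r ρ)

/-- The normalized radial derivative `f' = f̂ / √K`. -/
def normDeriv (H r f : ℝ → ℝ) (ρ : ℝ) : ℝ := hat H f ρ / √(gaussCurvature r ρ)

/-! ### The reduced dynamical system -/

/-- The vector field of `x₂' = 1 - x₂ (x₂ + x₃)`, `x₃' = -x₃ (x₂ + x₃)`. -/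
def field (x : ℝ × ℝ) : ℝ × ℝ := (1 - x.1 * (x.1 + x.2), -x.2 * (x.1 + x.2))

/-- The phase space `x₂² + 2 x₂ x₃ ≥ 1`. -/
def phaseSpace : Set (ℝ × ℝ) := {x | 1 ≤ x.1 ^ 2 + 2 * x.1 * x.2}

/-- `γ` solves the reduced system in the phase space on the open interval `J`. -/
structure IsSolution (γ : ℝ → ℝ × ℝ) (J : Set ℝ) : Prop where
  isOpen : IsOpen J
  ordConnected : J.OrdConnected
  nonempty : J.Nonempty
  hasDerivAt : ∀ ξ ∈ J, HasDerivAt γ (field (γ ξ)) ξ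
  mem : ∀ ξ ∈ J, γ ξ ∈ phaseSpace

/-- A solution that cannot be continued beyond the interval `J`. -/
def IsMaximalSolution (γ : ℝ → ℝ × ℝ) (J : Set ℝ) : Prop :=
  IsSolution γ J ∧ ∀ γ' J', IsSolution γ' J' → J ⊆ J' → EqOn γ' γ J → J' = J

/-- The fixed point `P_M`. -/
def PM : ℝ × ℝ := (1, 0)

/-- The fixed point `P̄_M`. -/
def PMbar : ℝ × ℝ := (-1, 0)

/-- Lyapunov stability of `P` for the flow of `v` on `S`, in forward direction. -/
def IsStable (v : ℝ × ℝ → ℝ × ℝ) (S : Set (ℝ × ℝ)) (P : ℝ × ℝ) : Prop :=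
  ∀ ε > 0, ∃ δ > 0, ∀ (T : ℝ) (γ : ℝ → ℝ × ℝ),
    (∀ τ ∈ Icc 0 T, HasDerivWithinAt γ (v (γ τ)) (Icc 0 T) τ ∧ γ τ ∈ S) →
    dist (γ 0) P < δ → ∀ τ ∈ Icc 0 T, dist (γ τ) P < ε

/-- Asymptotic stability: Lyapunov stability, and all points of `S` near `P` flow to `P`. -/
def IsAsymptoticallyStable (v : ℝ × ℝ → ℝ × ℝ) (S : Set (ℝ × ℝ)) (P : ℝ × ℝ) : Prop :=
  IsStable v S P ∧ ∃ δ > 0, ∀ x ∈ S, dist x P < δ → ∃ γ : ℝ → ℝ × ℝ, γ 0 = x ∧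
    (∀ τ ∈ Ici (0 : ℝ), HasDerivWithinAt γ (v (γ τ)) (Ici 0) τ ∧ γ τ ∈ S) ∧
    Tendsto γ atTop (𝓝 P)

/-! ### Poincaré variables -/

/-- `X = x / √(1 + x₂² + x₃²)`. -/
def toPoincare (x : ℝ × ℝ) : ℝ × ℝ :=
  (x.1 / √(1 + x.1 ^ 2 + x.2 ^ 2), x.2 / √(1 + x.1 ^ 2 + x.2 ^ 2))

/-- The vector field of the system in Poincaré variables. -/
def poincareField (X : ℝ × ℝ) : ℝ × ℝ :=
  ((1 - X.1 * (2 * X.1 + X.2)) * (1 - X.1 ^ 2 - X.2 ^ 2),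
    -X.2 * (2 * X.1 + X.2) * (1 - X.1 ^ 2 - X.2 ^ 2))

/-- The compactified phase space. -/
def poincareSpace : Set (ℝ × ℝ) :=
  {X | 1 ≤ 2 * X.1 ^ 2 + 2 * X.1 * X.2 + X.2 ^ 2 ∧ X.1 ^ 2 + X.2 ^ 2 ≤ 1}

/-- The points at infinity `X₂² + X₃² = 1` of the compactified phase space. -/
def atInfinity : Set (ℝ × ℝ) := {X | X ∈ poincareSpace ∧ X.1 ^ 2 + X.2 ^ 2 = 1}

/-- The arc of the unit circle from `P_S` to `P_H`. -/
def rightArc : Set (ℝ × ℝ) := {X | X.1 ^ 2 + X.2 ^ 2 = 1 ∧ 0 ≤ X.1 ∧ -(1 / √5) ≤ X.2}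

/-- The opposite arc, from `P̄_S` to `P̄_H`. -/
def leftArc : Set (ℝ × ℝ) := {X | -X ∈ rightArc}

/-- The point at infinity `P_H`. -/
def PH : ℝ × ℝ := (0, 1)

/-- The point at infinity `P̄_H`. -/
def PHbar : ℝ × ℝ := (0, -1)

/-- The point at infinity `P_S`. -/
def PS : ℝ × ℝ := (2 / √5, -(1 / √5))

/-- The point at infinity `P̄_S`. -/
def PSbar : ℝ × ℝ := (-(2 / √5), 1 / √5)

/-- The solution `γ` on `J` comes from the point at infinity `Q` and goes to `P_M`. -/
def GoesToPM (γ : ℝ → ℝ × ℝ) (J : Set ℝ) (Q : ℝ × ℝ) : Prop :=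
  (∀ ξ ∈ J, 0 < (γ ξ).1) ∧ ∃ a : ℝ, J = Ioi a ∧
    Tendsto (fun ξ => toPoincare (γ ξ)) (𝓝[>] a) (𝓝 Q) ∧ Tendsto γ atTop (𝓝 PM)

/-- The solution `γ` on `J` comes from `P̄_M` and goes to the point at infinity `Q`. -/
def ComesFromPMbar (γ : ℝ → ℝ × ℝ) (J : Set ℝ) (Q : ℝ × ℝ) : Prop :=
  (∀ ξ ∈ J, (γ ξ).1 < 0) ∧ ∃ b : ℝ, J = Iio b ∧
    Tendsto γ atBot (𝓝 PMbar) ∧ Tendsto (fun ξ => toPoincare (γ ξ)) (𝓝[<] b) (𝓝 Q)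

/-! ### The spacetime of a solution -/

/-- The solution `γ` on `J` describes the metric
`-A(r) dt² + dr² / B(r) + r² (dθ² + sin² θ dφ²)`, `r ∈ I`: the area radius satisfies `r' = x₂ r`
and runs through `I` exactly once, `B = x₂²`, and `d ln A / d ln r = 2 x₃ / x₂`. -/
def Describes (γ : ℝ → ℝ × ℝ) (J I : Set ℝ) (A B : ℝ → ℝ) : Prop :=
  ∃ r : ℝ → ℝ, BijOn r J I ∧ ∀ ξ ∈ J, 0 < r ξ ∧ HasDerivAt r ((γ ξ).1 * r ξ) ξ ∧
    B (r ξ) = (γ ξ).1 ^ 2 ∧ 0 < A (r ξ) ∧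
    HasDerivAt A (2 * (γ ξ).2 / (γ ξ).1 * (A (r ξ) / r ξ)) (r ξ)

/-- The metric `-A(r) dt² + dr² / B(r) + r² (dθ² + sin² θ dφ²)` in the coordinates
`(t, r, θ, φ)`. -/
def schwarzschildForm (A B : ℝ → ℝ) : MetricField := staticMetric A (fun r => 1 / B r) id

/-- Minkowski spacetime, up to a constant rescaling of time. -/
def IsMinkowski (I : Set ℝ) (A B : ℝ → ℝ) : Prop :=
  I = Ioi 0 ∧ ∃ c > 0, ∀ r ∈ I, A r = c ∧ B r = 1

/-- The static (exterior) Schwarzschild spacetime of mass `M`, up to a constant rescaling of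
time. -/
def IsSchwarzschild (M : ℝ) (I : Set ℝ) (A B : ℝ → ℝ) : Prop :=
  I = {r | 0 < r ∧ 0 < 1 - 2 * M / r} ∧
    ∃ c > 0, ∀ r ∈ I, A r = c * (1 - 2 * M / r) ∧ B r = 1 - 2 * M / r

/-- The metric tends to the Minkowski metric for `r → ∞`, up to a constant rescaling of time and
terms of order `1 / r`. -/
def IsAsymptoticallyFlat (A B : ℝ → ℝ) : Prop :=
  (∃ c > 0, (fun r => A r - c) =O[atTop] fun r => 1 / r) ∧
    (fun r => B r - 1) =O[atTop] fun r => 1 / r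

/-- The region `r > r_h` outside a horizon: `A` and `B` are positive and vanish in the limit
`r → r_h > 0`, and the curvature stays bounded. -/
def IsHorizonExterior (I : Set ℝ) (A B : ℝ → ℝ) : Prop :=
  ∃ rh > 0, I = Ioi rh ∧ (∀ r ∈ I, 0 < A r ∧ 0 < B r) ∧
    Tendsto A (𝓝[>] rh) (𝓝 0) ∧ Tendsto B (𝓝[>] rh) (𝓝 0) ∧
    ∃ C, ∀ p : Fin 4 → ℝ, p 1 ∈ I → sin (p 2) ≠ 0 → |kretschmann (schwarzschildForm A B) p| ≤ C

/-- A naked singularity: the static region extends without horizon from `r = 0` to an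
asymptotically flat end, the curvature diverges at `r = 0`, and light rays from `r = 0` reach every
radius within finite static time `∫ dr / √(A B)`. -/
structure IsNakedSingularity (I : Set ℝ) (A B : ℝ → ℝ) : Prop where
  range : I = Ioi 0
  no_horizon : ∀ r > 0, 0 < A r ∧ 0 < B r
  singular : ∀ t θ φ : ℝ, sin θ ≠ 0 →
    Tendsto (fun r => kretschmann (schwarzschildForm A B) ![t, r, θ, φ]) (𝓝[>] 0) atTop
  flat : IsAsymptoticallyFlat A B
  visible : ∀ R > 0, MeasureTheory.IntegrableOn (fun r => 1 / √(A r * B r)) (Ioc 0 R)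

/-- Near `r = 0`, `A ≃ r^β` and `B ≃ r^α`, up to positive constant factors. -/
def HasPowerLaw (A B : ℝ → ℝ) (α β : ℝ) : Prop :=
  (∃ a > 0, Tendsto (fun r => A r / r ^ β) (𝓝[>] 0) (𝓝 a)) ∧
    ∃ b > 0, Tendsto (fun r => B r / r ^ α) (𝓝[>] 0) (𝓝 b)

end StaticScalar

end

noncomputable section

namespace StaticScalar

/-! ### Curvature of a static spherically symmetric metric -/

/-! The reduced system is explicitly solvable. With w = x₂ + x₃ and y = x₃ it reads w' = 1 - w², y'
= -w y, and the region is w² - y² ≥ 1. Writing w = Q'/Q turns the Riccati equation into Q'' = Q, and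
Q y is constant (`solution_formula`). Since |w| ≥ 1 in the region, either w = ±1, which forces y = 0
and gives the two fixed points, or w = coth s and y = c / sinh s with s a translate of ξ. On these
curves (`orbit c`) one has w² - y² - 1 = (1 - c²) / sinh² s, so the region selects |c| ≤ 1. The
reflection (ξ, x) ↦ (-ξ, -x) is a symmetry, hence only s > 0 needs work. This is
`IsMaximalSolution.classification`.

As s → 0⁺ the direction of the orbit tends to that of (1 - c, c). This matches c ∈ [-1, 1]
bijectively with the points of the right arc, with c = 1 at P_H and c = -1 at P_S; as s → ∞ every
orbit tends to P_M.

In terms of T = tanh(s/2), where T'/T = 1 / sinh s, the equations for r and A integrate to r = k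
T^(1-c) / (1 - T²), A = A₀ T^(2c), B = ((1 + T² - c(1 - T²)) / (2T))² (`Describes.explicit`), the
Fisher–Janis–Newman–Winicour family. All global claims are read off from this. For c = ±1 it is
Schwarzschild with mass ±k/2. For c < 1 the radius runs from 0 to ∞, B grows like T⁻² and makes the
curvature diverge, and A B is bounded below near T = 0, so light rays arrive in finite time.

The link with the field equations is that the Riemann tensor of the diagonal metric is carried by
four sectional curvatures (`riemann_staticMetric`). Scaled by r² they are expressions in x₂, x₃ and
their normalized derivatives, so the Einstein equations and the reduced system with its constraint
are equivalent linear systems (`einstein_eq_iff`).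

The end points of the arcs lie in a continuum of equilibria, so their stability is not decided by
linearization. Instability comes from the explicit orbit that leaves the point; stability comes from
local coordinates that increase along the flow and are maximal at the point
(`isStable_of_monotone`). -/

theorem pderiv_congr {i : Fin 4} {f g : (Fin 4 → ℝ) → ℝ} {p : Fin 4 → ℝ} (h : f =ᶠ[𝓝 p] g) :
    pderiv i f p = pderiv i g p := by
  unfold pderiv
  apply Filter.EventuallyEq.deriv_eq
  have : Tendsto (fun s => Function.update p i s) (𝓝 (p i)) (𝓝 p) := by
    have := (continuous_const.update i continuous_id :
      Continuous fun s => Function.update p i s).tendsto (p i)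
    simpa using this
  exact this.eventually h

/-- Metric components and Christoffel symbols are all products of a function of ρ and a function of
θ, so this is the only derivative rule that the curvature computation needs. -/
theorem pderiv_separated (i : Fin 4) (f h : ℝ → ℝ) (p : Fin 4 → ℝ) :
    pderiv i (fun q => f (q 1) * h (q 2)) p =
      if i = 1 then deriv f (p 1) * h (p 2)
      else if i = 2 then f (p 1) * deriv h (p 2) else 0 := by
  unfold pderiv
  fin_cases i <;> simp [Function.update]

theorem pderiv_radial (i : Fin 4) (f : ℝ → ℝ) (p : Fin 4 → ℝ) :
    pderiv i (fun q => f (q 1)) p = if i = 1 then deriv f (p 1) else 0 := by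
  have := pderiv_separated i f (fun _ => 1) p
  simpa using this

/-- Radial factors of the diagonal components of `staticMetric`. -/
def metricRadial (A H r : ℝ → ℝ) : Fin 4 → ℝ → ℝ
  | 0 => fun ρ => -A ρ
  | 1 => H
  | 2 | 3 => fun ρ => r ρ ^ 2

/-- The function `sin²`. -/
def sinSq (θ : ℝ) : ℝ := sin θ ^ 2

/-- Angular factors of the diagonal components of `staticMetric`. -/
def metricAngular : Fin 4 → ℝ → ℝ
  | 3 => sinSq
  | _ => 1

theorem staticMetric_apply (A H r : ℝ → ℝ) (p : Fin 4 → ℝ) (a b : Fin 4) :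
    staticMetric A H r p a b =
      if a = b then metricRadial A H r a (p 1) * metricAngular a (p 2) else 0 := by
  unfold staticMetric
  fin_cases a <;> fin_cases b <;> simp [metricRadial, metricAngular, sinSq]

theorem staticMetric_inv_apply {A H r : ℝ → ℝ} {p : Fin 4 → ℝ} (hA : A (p 1) ≠ 0)
    (hH : H (p 1) ≠ 0) (hr : r (p 1) ≠ 0) (hs : sin (p 2) ≠ 0) (a b : Fin 4) :
    (staticMetric A H r p)⁻¹ a b =
      if a = b then (metricRadial A H r a (p 1) * metricAngular a (p 2))⁻¹ else 0 := by
  have : (staticMetric A H r p)⁻¹ = Matrix.diagonal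
      fun a => (metricRadial A H r a (p 1) * metricAngular a (p 2))⁻¹ := by
    apply Matrix.inv_eq_right_inv
    have : staticMetric A H r p = Matrix.diagonal
        fun a => metricRadial A H r a (p 1) * metricAngular a (p 2) := by
      ext a b
      rw [staticMetric_apply, Matrix.diagonal_apply]
    rw [this, Matrix.diagonal_mul_diagonal, ← Matrix.diagonal_one]
    congr 1
    ext a
    apply mul_inv_cancel₀
    fin_cases a <;> simp [metricRadial, metricAngular, sinSq, *]
  rw [this, Matrix.diagonal_apply]

theorem pderiv_staticMetric (A H r : ℝ → ℝ) (i a b : Fin 4) (p : Fin 4 → ℝ) :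
    pderiv i (fun q => staticMetric A H r q a b) p =
      if a = b then
        (if i = 1 then deriv (metricRadial A H r a) (p 1) * metricAngular a (p 2)
        else if i = 2 then metricRadial A H r a (p 1) * deriv (metricAngular a) (p 2) else 0)
      else 0 := by
  simp only [staticMetric_apply]
  by_cases h : a = b
  · simp only [h, if_true]
    exact pderiv_separated _ _ _ _
  · simp [h, pderiv]

/-- The function `f' / (2 g)`. -/
def halfRatio (f g : ℝ → ℝ) (ρ : ℝ) : ℝ := deriv f ρ / (2 * g ρ)

/-- The function `- r r' / H`. -/
def warp (H r : ℝ → ℝ) (ρ : ℝ) : ℝ := -(r ρ * deriv r ρ) / H ρ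

/-- The function `r' / r`. -/
def ratio (r : ℝ → ℝ) (ρ : ℝ) : ℝ := deriv r ρ / r ρ

/-- The function `- sin cos`. -/
def negSinCos (θ : ℝ) : ℝ := -(sin θ * cos θ)

/-- The function `cos / sin`. -/
def cosDivSin (θ : ℝ) : ℝ := cos θ / sin θ

/-- Radial factors of the Christoffel symbols of `staticMetric`. -/
def christoffelRadial (A H r : ℝ → ℝ) : Fin 4 → Fin 4 → Fin 4 → ℝ → ℝ
  | 0 => fun
    | 0 => fun | 1 => halfRatio A A | _ => 0
    | 1 => fun | 0 => halfRatio A A | _ => 0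
    | _ => 0
  | 1 => fun
    | 0 => fun | 0 => halfRatio A H | _ => 0
    | 1 => fun | 1 => halfRatio H H | _ => 0
    | 2 => fun | 2 => warp H r | _ => 0
    | 3 => fun | 3 => warp H r | _ => 0
  | 2 => fun
    | 0 => 0
    | 1 => fun | 2 => ratio r | _ => 0
    | 2 => fun | 1 => ratio r | _ => 0
    | 3 => fun | 3 => 1 | _ => 0
  | 3 => fun
    | 0 => 0
    | 1 => fun | 3 => ratio r | _ => 0
    | 2 => fun | 3 => 1 | _ => 0
    | 3 => fun | 1 => ratio r | 2 => 1 | _ => 0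

/-- Angular factors of the Christoffel symbols of `staticMetric`. -/
def christoffelAngular : Fin 4 → Fin 4 → Fin 4 → ℝ → ℝ
  | 0 => 1
  | 1 => fun
    | 3 => fun | 3 => sinSq | _ => 1
    | _ => 1
  | 2 => fun
    | 3 => fun | 3 => negSinCos | _ => 1
    | _ => 1
  | 3 => fun
    | 2 => fun | 3 => cosDivSin | _ => 1
    | 3 => fun | 2 => cosDivSin | _ => 1
    | _ => 1

/-- A check of the 64 index triples. Differentiability is needed of `r` alone, because `r ^ 2` goes
through the power rule while `deriv A` and `deriv H` are merely carried along. -/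
theorem christoffel_staticMetric {A H r : ℝ → ℝ} {p : Fin 4 → ℝ} (hA : A (p 1) ≠ 0)
    (hH : H (p 1) ≠ 0) (hr : r (p 1) ≠ 0) (hs : sin (p 2) ≠ 0)
    (hrd : DifferentiableAt ℝ r (p 1)) (i j k : Fin 4) :
    christoffel (staticMetric A H r) i j k p =
      christoffelRadial A H r i j k (p 1) * christoffelAngular i j k (p 2) := by
  have h0 : deriv (metricRadial A H r 0) (p 1) = - deriv A (p 1) := by
    simp [metricRadial]
  have h1 : deriv (metricRadial A H r 1) (p 1) = deriv H (p 1) := by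
    simp [metricRadial]
  have h2 : deriv (metricRadial A H r 2) (p 1) = 2 * r (p 1) * deriv r (p 1) := by
    have := (hrd.hasDerivAt.pow 2).deriv
    simp only [metricRadial]
    simpa [Pi.pow_def] using this
  have h3 : deriv (metricRadial A H r 3) (p 1) = 2 * r (p 1) * deriv r (p 1) := h2
  have k0 : deriv (1 : ℝ → ℝ) = 0 := by ext; simp
  have k3 : ∀ θ, deriv sinSq θ = 2 * sin θ * cos θ := by
    intro θ
    refine (((Real.hasDerivAt_sin θ).pow 2).congr_deriv ?_).deriv
    norm_num
  unfold christoffel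
  simp only [staticMetric_inv_apply hA hH hr hs, pderiv_staticMetric, ite_mul, zero_mul,
    Finset.sum_ite_eq, Finset.mem_univ, if_true]
  fin_cases i <;> fin_cases j <;> fin_cases k <;>
    (dsimp only [Fin.zero_eta, Fin.mk_one, Fin.reduceFinMk, christoffelRadial, christoffelAngular]
     simp [h0, h1, h2, h3]) <;>
    (try simp [metricAngular, metricRadial, k0, k3, halfRatio, warp, ratio, sinSq, negSinCos,
      cosDivSin]) <;> (try field_simp)

/-- Conditions at `p` under which the curvature of `staticMetric A H r` can be computed. -/
structure RegularAt (A H r : ℝ → ℝ) (p : Fin 4 → ℝ) : Prop where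
  contDiffAt_A : ContDiffAt ℝ 2 A (p 1)
  contDiffAt_H : ContDiffAt ℝ 2 H (p 1)
  contDiffAt_r : ContDiffAt ℝ 2 r (p 1)
  pos_A : 0 < A (p 1)
  pos_H : 0 < H (p 1)
  pos_r : 0 < r (p 1)
  sin_ne : sin (p 2) ≠ 0

theorem ContDiffAt.differentiableAt_deriv_of_two {f : ℝ → ℝ} {x : ℝ} (h : ContDiffAt ℝ 2 f x) :
    DifferentiableAt ℝ (deriv f) x := by
  exact (ContDiffAt.derivWithin (m := 1) h (by norm_num)).differentiableAt (by norm_num)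

/-- The Riemann tensor differentiates the Christoffel symbols, so their formula is needed in a whole
neighbourhood of the point. -/
theorem RegularAt.eventually {A H r : ℝ → ℝ} {p : Fin 4 → ℝ} (h : RegularAt A H r p) :
    ∀ᶠ q in 𝓝 p, RegularAt A H r q := by
  have c1 : Tendsto (fun q : Fin 4 → ℝ => q 1) (𝓝 p) (𝓝 (p 1)) := (continuous_apply 1).tendsto p
  have c2 : Tendsto (fun q : Fin 4 → ℝ => q 2) (𝓝 p) (𝓝 (p 2)) := (continuous_apply 2).tendsto p
  filter_upwards [c1.eventually (h.contDiffAt_A.eventually (by simp)),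
    c1.eventually (h.contDiffAt_H.eventually (by simp)),
    c1.eventually (h.contDiffAt_r.eventually (by simp)),
    c1.eventually (h.contDiffAt_A.continuousAt.eventually (lt_mem_nhds h.pos_A)),
    c1.eventually (h.contDiffAt_H.continuousAt.eventually (lt_mem_nhds h.pos_H)),
    c1.eventually (h.contDiffAt_r.continuousAt.eventually (lt_mem_nhds h.pos_r)),
    c2.eventually (Real.continuous_sin.continuousAt.eventually (isOpen_ne.mem_nhds h.sin_ne))]
    with q h1 h2 h3 h4 h5 h6 h7
  exact ⟨h1, h2, h3, h4, h5, h6, h7⟩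

/-- Sectional curvatures `R^{ij}_{ij}` of `staticMetric A H r`. -/
def sectional (A H r : ℝ → ℝ) (ρ : ℝ) : Fin 4 → Fin 4 → ℝ :=
  let a := -(deriv (deriv A) ρ) / (2 * A ρ * H ρ) + deriv A ρ ^ 2 / (4 * A ρ ^ 2 * H ρ)
      + deriv A ρ * deriv H ρ / (4 * A ρ * H ρ ^ 2)
  let b := -(deriv A ρ * deriv r ρ) / (2 * A ρ * r ρ * H ρ)
  let d := -(deriv (deriv r) ρ) / (r ρ * H ρ) + deriv r ρ * deriv H ρ / (2 * r ρ * H ρ ^ 2)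
  let e := (1 - deriv r ρ ^ 2 / H ρ) / r ρ ^ 2
  fun
  | 0 => fun | 0 => 0 | 1 => a | 2 => b | 3 => b
  | 1 => fun | 0 => a | 1 => 0 | 2 => d | 3 => d
  | 2 => fun | 0 => b | 1 => d | 2 => 0 | 3 => e
  | 3 => fun | 0 => b | 1 => d | 2 => e | 3 => 0

theorem riemann_antisymm (g : MetricField) (i j k l : Fin 4) (p : Fin 4 → ℝ) :
    riemann g i j k l p = - riemann g i j l k p := by
  unfold riemann
  rw [neg_add, neg_sub, ← Finset.sum_neg_distrib]
  congr 1
  apply Finset.sum_congr rfl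
  intros
  ring

-- By symmetry the coordinate 2-planes diagonalize the curvature operator: `R^{ij}_{kl}` is a
-- sectional curvature times an antisymmetrized Kronecker delta. The metric factor lowers the index
-- `j`.
set_option maxHeartbeats 4000000 in
theorem riemann_staticMetric {A H r : ℝ → ℝ} {p : Fin 4 → ℝ} (h : RegularAt A H r p)
    (i j k l : Fin 4) :
    riemann (staticMetric A H r) i j k l p =
      sectional A H r (p 1) i j * (metricRadial A H r j (p 1) * metricAngular j (p 2)) *
        ((if i = k ∧ j = l then 1 else 0) - (if i = l ∧ j = k then 1 else 0)) := by
  have hA := h.pos_A.ne'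
  have hH := h.pos_H.ne'
  have hr := h.pos_r.ne'
  have hs := h.sin_ne
  have dA := (h.contDiffAt_A.differentiableAt (by norm_num)).hasDerivAt
  have dH := (h.contDiffAt_H.differentiableAt (by norm_num)).hasDerivAt
  have dr := (h.contDiffAt_r.differentiableAt (by norm_num)).hasDerivAt
  have dA' := (ContDiffAt.differentiableAt_deriv_of_two h.contDiffAt_A).hasDerivAt
  have dr' := (ContDiffAt.differentiableAt_deriv_of_two h.contDiffAt_r).hasDerivAt
  have hchr : ∀ a b c, christoffel (staticMetric A H r) a b c =ᶠ[𝓝 p]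
      fun q => christoffelRadial A H r a b c (q 1) * christoffelAngular a b c (q 2) := by
    intro a b c
    filter_upwards [h.eventually] with q hq
    exact christoffel_staticMetric hq.pos_A.ne' hq.pos_H.ne' hq.pos_r.ne' hq.sin_ne
      (hq.contDiffAt_r.differentiableAt (by norm_num)) a b c
  have hp : ∀ m a b c, pderiv m (christoffel (staticMetric A H r) a b c) p =
      if m = 1 then deriv (christoffelRadial A H r a b c) (p 1) * christoffelAngular a b c (p 2)
      else if m = 2 then christoffelRadial A H r a b c (p 1) *
        deriv (christoffelAngular a b c) (p 2) else 0 := by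
    intro m a b c
    rw [pderiv_congr (hchr a b c), pderiv_separated]
  have hc : ∀ a b c, christoffel (staticMetric A H r) a b c p =
      christoffelRadial A H r a b c (p 1) * christoffelAngular a b c (p 2) :=
    fun a b c => (hchr a b c).self_of_nhds
  have D1 : deriv (halfRatio A A) (p 1) =
      (deriv (deriv A) (p 1) * A (p 1) - deriv A (p 1) ^ 2) / (2 * A (p 1) ^ 2) := by
    refine ((dA'.div (dA.const_mul 2) (by simpa using hA)).congr_deriv ?_).deriv
    field_simp
  have D2 : deriv (halfRatio A H) (p 1) =
      (deriv (deriv A) (p 1) * H (p 1) - deriv A (p 1) * deriv H (p 1)) / (2 * H (p 1) ^ 2) := by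
    refine ((dA'.div (dH.const_mul 2) (by simpa using hH)).congr_deriv ?_).deriv
    field_simp
  have D4 : deriv (warp H r) (p 1) =
      (-(deriv r (p 1) ^ 2 + r (p 1) * deriv (deriv r) (p 1)) * H (p 1)
        + r (p 1) * deriv r (p 1) * deriv H (p 1)) / H (p 1) ^ 2 := by
    refine (((dr.mul dr').neg.div dH hH).congr_deriv ?_).deriv
    simp only [Pi.mul_apply, Pi.neg_apply]
    field_simp
    ring
  have D5 : deriv (ratio r) (p 1) =
      (deriv (deriv r) (p 1) * r (p 1) - deriv r (p 1) ^ 2) / r (p 1) ^ 2 := by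
    refine ((dr'.div dr hr).congr_deriv ?_).deriv
    field_simp
  have S1 : deriv sinSq (p 2) = 2 * sin (p 2) * cos (p 2) := by
    refine (((Real.hasDerivAt_sin (p 2)).pow 2).congr_deriv ?_).deriv
    norm_num
  have S2 : deriv negSinCos (p 2) = sin (p 2) ^ 2 - cos (p 2) ^ 2 := by
    refine ((((Real.hasDerivAt_sin (p 2)).mul (Real.hasDerivAt_cos (p 2))).neg).congr_deriv ?_).deriv
    ring
  have S3 : deriv cosDivSin (p 2) = -1 / sin (p 2) ^ 2 := by
    refine (((Real.hasDerivAt_cos (p 2)).div (Real.hasDerivAt_sin (p 2)) hs).congr_deriv ?_).deriv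
    rw [div_left_inj' (pow_ne_zero 2 hs)]
    linear_combination -Real.sin_sq_add_cos_sq (p 2)
  wlog hkl : k ≤ l generalizing k l
  · rw [riemann_antisymm, this l k (le_of_not_ge hkl)]
    ring
  have hcos := Real.cos_sq' (p 2)
  have hp0 : ∀ a b c, pderiv 0 (christoffel (staticMetric A H r) a b c) p = 0 := fun a b c => by
    simp [hp]
  have hp1 : ∀ a b c, pderiv 1 (christoffel (staticMetric A H r) a b c) p =
      deriv (christoffelRadial A H r a b c) (p 1) * christoffelAngular a b c (p 2) :=
    fun a b c => by simp [hp]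
  have hp2 : ∀ a b c, pderiv 2 (christoffel (staticMetric A H r) a b c) p =
      christoffelRadial A H r a b c (p 1) * deriv (christoffelAngular a b c) (p 2) :=
    fun a b c => by simp [hp]
  have hp3 : ∀ a b c, pderiv 3 (christoffel (staticMetric A H r) a b c) p = 0 := fun a b c => by
    simp [hp]
  have k0 : deriv (0 : ℝ → ℝ) = 0 := by ext; simp
  have k1 : deriv (1 : ℝ → ℝ) = 0 := by ext; simp
  unfold riemann
  fin_cases k <;> fin_cases l <;> first | (exfalso; revert hkl; decide) | skip
  all_goals
    simp only [Fin.zero_eta, Fin.mk_one, Fin.reduceFinMk, hp0, hp1, hp2, hp3, hc,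
      Fin.sum_univ_four]
    fin_cases i <;> fin_cases j <;>
    (dsimp only [Fin.zero_eta, Fin.mk_one, Fin.reduceFinMk, christoffelRadial, christoffelAngular,
      sectional]
     simp [D1, D2, D4, D5, S1, S2, S3, k0, k1]) <;>
    (try simp only [halfRatio, warp, ratio, sinSq, negSinCos, cosDivSin, metricRadial,
      metricAngular, Pi.one_apply]) <;>
    (try field_simp) <;> (try rw [hcos]) <;> (try ring)

section Curvature

variable {A H r : ℝ → ℝ} {p : Fin 4 → ℝ}

/-- The diagonal components of `staticMetric A H r` at `p`. -/
def metricDiag (A H r : ℝ → ℝ) (p : Fin 4 → ℝ) (a : Fin 4) : ℝ :=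
  metricRadial A H r a (p 1) * metricAngular a (p 2)

theorem RegularAt.metricDiag_ne_zero (h : RegularAt A H r p) (a : Fin 4) :
    metricDiag A H r p a ≠ 0 := by
  have hA := h.pos_A.ne'
  have hH := h.pos_H.ne'
  have hr := h.pos_r.ne'
  have hs := h.sin_ne
  fin_cases a <;> simp [metricDiag, metricRadial, metricAngular, sinSq, *]

theorem RegularAt.inv_apply (h : RegularAt A H r p) (a b : Fin 4) :
    (staticMetric A H r p)⁻¹ a b = if a = b then (metricDiag A H r p a)⁻¹ else 0 :=
  staticMetric_inv_apply h.pos_A.ne' h.pos_H.ne' h.pos_r.ne' h.sin_ne a b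

theorem sectional_self (ρ : ℝ) (i : Fin 4) : sectional A H r ρ i i = 0 := by
  fin_cases i <;> rfl

theorem sectional_symm (ρ : ℝ) (i j : Fin 4) :
    sectional A H r ρ i j = sectional A H r ρ j i := by
  fin_cases i <;> fin_cases j <;> rfl

theorem ricci_staticMetric (h : RegularAt A H r p) (j l : Fin 4) :
    ricci (staticMetric A H r) j l p =
      if j = l then metricDiag A H r p j * ∑ i, sectional A H r (p 1) i j else 0 := by
  unfold ricci
  simp only [riemann_staticMetric h]
  by_cases hjl : j = l
  · subst hjl
    rw [if_pos rfl, Finset.mul_sum]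
    apply Finset.sum_congr rfl
    intro i _
    by_cases hij : i = j
    · subst hij
      simp [sectional_self]
    · simp [hij, Ne.symm hij, metricDiag, mul_comm]
  · rw [if_neg hjl]
    apply Finset.sum_eq_zero
    intro i _
    by_cases hij : i = l
    · subst hij
      simp [hjl]
    · simp [hjl, hij]

theorem scalarCurvature_staticMetric (h : RegularAt A H r p) :
    scalarCurvature (staticMetric A H r) p = ∑ j, ∑ i, sectional A H r (p 1) i j := by
  unfold scalarCurvature
  simp only [ricci_staticMetric h, h.inv_apply]
  apply Finset.sum_congr rfl
  intro j _
  rw [Finset.sum_eq_single j]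
  · have := h.metricDiag_ne_zero j
    simp only [if_true]
    field_simp
  · intro b _ hb
    simp [Ne.symm hb]
  · simp

theorem einstein_staticMetric (h : RegularAt A H r p) (a b : Fin 4) :
    einstein (staticMetric A H r) a b p =
      if a = b then metricDiag A H r p a * (∑ i, sectional A H r (p 1) i a
        - (1 / 2) * ∑ j, ∑ i, sectional A H r (p 1) i j) else 0 := by
  unfold einstein
  rw [ricci_staticMetric h, scalarCurvature_staticMetric h, staticMetric_apply]
  by_cases hab : a = b
  · simp only [if_pos hab, ← metricDiag.eq_1 A H r p a]
    ring
  · simp [hab]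

theorem scalarStress_staticMetric (h : RegularAt A H r p) (ψ : ℝ → ℝ) (a b : Fin 4) :
    scalarStress (staticMetric A H r) (fun q => ψ (q 1)) a b p =
      if a = b then metricDiag A H r p a * ((if a = 1 then 2 else 0) - 1) *
        (deriv ψ (p 1) ^ 2 / (2 * H (p 1))) else 0 := by
  have hH := h.pos_H.ne'
  have h1 : metricDiag A H r p 1 = H (p 1) := by simp [metricDiag, metricRadial, metricAngular]
  have key : ∑ c, ∑ d, (staticMetric A H r p)⁻¹ c d *
      (pderiv c (fun q => ψ (q 1)) p * pderiv d (fun q => ψ (q 1)) p) =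
      deriv ψ (p 1) ^ 2 / H (p 1) := by
    simp only [h.inv_apply, pderiv_radial, ite_mul, zero_mul, Finset.mem_univ,
      if_true, mul_ite, mul_zero, Finset.sum_ite_eq', h1]
    field_simp
  unfold scalarStress
  rw [key, staticMetric_apply]
  simp only [pderiv_radial]
  by_cases hab : a = b
  · subst hab
    simp only [if_true, ← metricDiag.eq_1 A H r p a]
    by_cases ha : a = 1
    · subst ha
      simp only [if_true, h1]
      field_simp
    · simp only [if_neg ha]
      field_simp
      ring
  · simp only [if_neg hab]
    by_cases ha : a = 1
    · subst ha
      simp [Ne.symm hab]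
    · simp [ha]

/-- The Einstein equations in terms of the sectional curvatures. -/
theorem einstein_eq_iff_sectional (h : RegularAt A H r p) (ψ : ℝ → ℝ) :
    (∀ a b, einstein (staticMetric A H r) a b p =
      scalarStress (staticMetric A H r) (fun q => ψ (q 1)) a b p) ↔
      2 * sectional A H r (p 1) 1 2 + sectional A H r (p 1) 2 3 =
          deriv ψ (p 1) ^ 2 / (2 * H (p 1)) ∧
        2 * sectional A H r (p 1) 0 2 + sectional A H r (p 1) 2 3 =
          -(deriv ψ (p 1) ^ 2 / (2 * H (p 1))) ∧
        sectional A H r (p 1) 0 1 + sectional A H r (p 1) 0 2 + sectional A H r (p 1) 1 2 =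
          deriv ψ (p 1) ^ 2 / (2 * H (p 1)) := by
  -- Both tensors are diagonal, and the nonzero metric entry cancels from the diagonal equations.
  -- The stress has the opposite sign in the radial direction `a = 1`.
  have key : (∀ a b, einstein (staticMetric A H r) a b p =
      scalarStress (staticMetric A H r) (fun q => ψ (q 1)) a b p) ↔
      ∀ a, ∑ i, sectional A H r (p 1) i a - (1 / 2) * ∑ j, ∑ i, sectional A H r (p 1) i j =
        ((if a = 1 then 2 else 0) - 1) * (deriv ψ (p 1) ^ 2 / (2 * H (p 1))) := by
    simp only [einstein_staticMetric h, scalarStress_staticMetric h]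
    constructor
    · intro h' a
      have := h' a a
      simp only [if_true] at this
      rw [mul_assoc] at this
      exact mul_left_cancel₀ (h.metricDiag_ne_zero a) this
    · intro h' a b
      rw [h' a, mul_assoc]
  rw [key]
  generalize deriv ψ (p 1) ^ 2 / (2 * H (p 1)) = P
  simp only [Fin.forall_fin_succ, Fin.sum_univ_four, IsEmpty.forall_iff, and_true]
  simp only [Fin.succ_zero_eq_one, Fin.succ_one_eq_two, Fin.reduceSucc, Fin.reduceEq, if_true,
    if_false, zero_ne_one]
  have e13 : sectional A H r (p 1) 1 3 = sectional A H r (p 1) 1 2 := rfl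
  have e03 : sectional A H r (p 1) 0 3 = sectional A H r (p 1) 0 2 := rfl
  simp only [sectional_self, sectional_symm _ 1 0, sectional_symm _ 2 0, sectional_symm _ 3 0,
    sectional_symm _ 2 1, sectional_symm _ 3 1, sectional_symm _ 3 2, e13, e03]
  constructor
  · rintro ⟨h0, h1, h2, h3⟩
    refine ⟨?_, ?_, ?_⟩ <;> linarith
  · rintro ⟨h0, h1, h2⟩
    refine ⟨?_, ?_, ?_, ?_⟩ <;> linarith

theorem riemannUp_staticMetric (h : RegularAt A H r p) (a b c d : Fin 4) :
    riemannUp (staticMetric A H r) a b c d p = sectional A H r (p 1) a b *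
      ((if a = c ∧ b = d then 1 else 0) - (if a = d ∧ b = c then 1 else 0)) := by
  unfold riemannUp
  simp only [h.inv_apply, riemann_staticMetric h, ite_mul, zero_mul, Finset.sum_ite_eq,
    Finset.mem_univ, if_true, ← metricDiag.eq_1 A H r p]
  have := h.metricDiag_ne_zero b
  field_simp

/-- Each unordered index pair contributes four times its squared sectional curvature; the inner
factors 2 account for the two angular directions. -/
theorem kretschmann_staticMetric (h : RegularAt A H r p) :
    kretschmann (staticMetric A H r) p =
      4 * (sectional A H r (p 1) 0 1 ^ 2 + 2 * sectional A H r (p 1) 0 2 ^ 2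
        + 2 * sectional A H r (p 1) 1 2 ^ 2 + sectional A H r (p 1) 2 3 ^ 2) := by
  unfold kretschmann
  simp only [riemannUp_staticMetric h]
  -- For fixed `a ≠ b` only `(c, d) = (a, b)` and `(c, d) = (b, a)` survive, and the two signs of
  -- the second term multiply to +1.
  have key : ∀ a b, ∑ c, ∑ d, (sectional A H r (p 1) a b *
      ((if a = c ∧ b = d then 1 else 0) - (if a = d ∧ b = c then 1 else 0)) *
      (sectional A H r (p 1) c d *
      ((if c = a ∧ d = b then 1 else 0) - (if c = b ∧ d = a then 1 else 0)))) =
      2 * sectional A H r (p 1) a b ^ 2 := by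
    intro a b
    by_cases hab : a = b
    · subst hab
      simp [sectional_self]
    have : ∀ c d, (sectional A H r (p 1) a b *
      ((if a = c ∧ b = d then 1 else 0) - (if a = d ∧ b = c then 1 else 0)) *
      (sectional A H r (p 1) c d *
      ((if c = a ∧ d = b then 1 else 0) - (if c = b ∧ d = a then 1 else 0)))) =
      (if a = c then (if b = d then sectional A H r (p 1) a b ^ 2 else 0) else 0) +
      (if b = c then (if a = d then sectional A H r (p 1) a b ^ 2 else 0) else 0) := by
      intro c d
      by_cases h1 : a = c
      · subst h1
        by_cases h2 : b = d
        · subst h2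
          simp [hab, Ne.symm hab]
          ring
        · simp [h2, Ne.symm hab, Ne.symm h2]
      · by_cases h2 : b = c
        · subst h2
          by_cases h3 : a = d
          · subst h3
            simp [hab, Ne.symm hab, sectional_symm _ b a]
            ring
          · simp [h1, h3]
        · simp [h1, h2]
    simp only [this, Finset.sum_add_distrib, Finset.sum_ite_eq, Finset.mem_univ, if_true,
      Finset.sum_ite_irrel, Finset.sum_const_zero]
    ring
  rw [Finset.sum_congr rfl fun a _ => Finset.sum_congr rfl fun b _ => key a b]
  simp only [Fin.sum_univ_four]
  have e13 : sectional A H r (p 1) 1 3 = sectional A H r (p 1) 1 2 := rfl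
  have e03 : sectional A H r (p 1) 0 3 = sectional A H r (p 1) 0 2 := rfl
  simp only [sectional_self, sectional_symm _ 1 0, sectional_symm _ 2 0, sectional_symm _ 3 0,
    sectional_symm _ 2 1, sectional_symm _ 3 1, sectional_symm _ 3 2, e13, e03]
  ring

theorem waveOperator_staticMetric (h : RegularAt A H r p) (ψ : ℝ → ℝ) :
    waveOperator (staticMetric A H r) (fun q => ψ (q 1)) p =
      (deriv (deriv ψ) (p 1) + (deriv A (p 1) / (2 * A (p 1)) - deriv H (p 1) / (2 * H (p 1))
        + 2 * (deriv r (p 1) / r (p 1))) * deriv ψ (p 1)) / H (p 1) := by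
  have hA := h.pos_A.ne'
  have hH := h.pos_H.ne'
  have hr := h.pos_r.ne'
  have hs := h.sin_ne
  unfold waveOperator
  have e : ∀ b, pderiv b (fun q : Fin 4 → ℝ => ψ (q 1)) =
      fun q => if b = 1 then deriv ψ (q 1) else 0 := by
    intro b
    ext q
    exact pderiv_radial b ψ q
  have e2 : ∀ a b, pderiv a (pderiv b (fun q : Fin 4 → ℝ => ψ (q 1))) p =
      if b = 1 then (if a = 1 then deriv (deriv ψ) (p 1) else 0) else 0 := by
    intro a b
    rw [e]
    by_cases hb : b = 1
    · simp only [hb, if_true]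
      exact pderiv_radial a (deriv ψ) p
    · simp [hb, pderiv]
  simp only [e2, h.inv_apply, pderiv_radial, christoffel_staticMetric hA hH hr hs
    (h.contDiffAt_r.differentiableAt (by norm_num)), ite_mul, zero_mul, Finset.sum_ite_eq,
    Finset.mem_univ, if_true, mul_ite, mul_zero, Finset.sum_ite_eq', Fin.sum_univ_four]
  simp only [Fin.reduceEq, if_false, zero_ne_one]
  dsimp only [metricDiag, christoffelRadial, christoffelAngular, metricRadial, metricAngular]
  simp only [halfRatio, warp, sinSq, Pi.one_apply]
  field_simp
  ring

/-! ### The normalized variables and the field equations in terms of them. -/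

theorem x₂_eq {ρ : ℝ} (hr : 0 < r ρ) : x₂ H r ρ = deriv r ρ / √(H ρ) := by
  have : √(gaussCurvature r ρ) = 1 / r ρ := by
    rw [gaussCurvature, Real.sqrt_div zero_le_one, Real.sqrt_one, Real.sqrt_sq hr.le]
  rw [x₂, this, sheetExpansion, hat]
  field_simp

theorem x₃_eq {ρ : ℝ} (hr : 0 < r ρ) :
    x₃ A H r ρ = r ρ * deriv A ρ / (2 * A ρ * √(H ρ)) := by
  have : √(gaussCurvature r ρ) = 1 / r ρ := by
    rw [gaussCurvature, Real.sqrt_div zero_le_one, Real.sqrt_one, Real.sqrt_sq hr.le]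
  rw [x₃, this, acceleration, hat]
  field_simp

theorem normDeriv_eq {f : ℝ → ℝ} {ρ : ℝ} (hr : 0 < r ρ) :
    normDeriv H r f ρ = r ρ * deriv f ρ / √(H ρ) := by
  have : √(gaussCurvature r ρ) = 1 / r ρ := by
    rw [gaussCurvature, Real.sqrt_div zero_le_one, Real.sqrt_one, Real.sqrt_sq hr.le]
  rw [normDeriv, this, hat]
  field_simp

theorem y₁_sq_eq {ψ : ℝ → ℝ} {ρ : ℝ} (hr : 0 < r ρ) (hH : 0 < H ρ) :
    y₁ H r ψ ρ ^ 2 = r ρ ^ 2 * (deriv ψ ρ ^ 2 / (2 * H ρ)) := by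
  have h0 : 0 ≤ 2 * gaussCurvature r ρ := by unfold gaussCurvature; positivity
  rw [y₁, hat, div_pow, Real.sq_sqrt h0, div_pow, Real.sq_sqrt hH.le, gaussCurvature]
  field_simp

/-- `x₂` is the proper radial derivative of `r`, so its derivative is a second derivative of `r`,
which is the curvature of a plane spanned by the radial and an angular direction. -/
theorem RegularAt.hasDerivAt_x₂ (h : RegularAt A H r p) :
    HasDerivAt (x₂ H r) (-(r (p 1) * √(H (p 1)) * sectional A H r (p 1) 1 2)) (p 1) := by
  have hH := h.pos_H
  have hr := h.pos_r
  have dH := (h.contDiffAt_H.differentiableAt (by norm_num)).hasDerivAt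
  have dr' := (ContDiffAt.differentiableAt_deriv_of_two h.contDiffAt_r).hasDerivAt
  have hs : 0 < √(H (p 1)) := Real.sqrt_pos.2 hH
  have hsq : √(H (p 1)) ^ 2 = H (p 1) := Real.sq_sqrt hH.le
  have ev : x₂ H r =ᶠ[𝓝 (p 1)] fun ρ => deriv r ρ / √(H ρ) := by
    filter_upwards [h.contDiffAt_r.continuousAt.eventually (lt_mem_nhds hr)] with ρ hρ
    exact x₂_eq hρ
  refine ((dr'.div (dH.sqrt hH.ne') hs.ne').congr_deriv ?_).congr_of_eventuallyEq ev
  simp only [sectional, hsq]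
  generalize √(H (p 1)) = s at *
  rw [← hsq]
  field_simp
  ring

theorem RegularAt.hasDerivAt_x₃ (h : RegularAt A H r p) :
    HasDerivAt (x₃ A H r) (√(H (p 1)) / r (p 1) * (-(r (p 1) ^ 2 * sectional A H r (p 1) 0 1)
      + x₂ H r (p 1) * x₃ A H r (p 1) - x₃ A H r (p 1) ^ 2)) (p 1) := by
  have hA := h.pos_A
  have hH := h.pos_H
  have hr := h.pos_r
  have dH := (h.contDiffAt_H.differentiableAt (by norm_num)).hasDerivAt
  have dA := (h.contDiffAt_A.differentiableAt (by norm_num)).hasDerivAt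
  have dr := (h.contDiffAt_r.differentiableAt (by norm_num)).hasDerivAt
  have dA' := (ContDiffAt.differentiableAt_deriv_of_two h.contDiffAt_A).hasDerivAt
  have hs : 0 < √(H (p 1)) := Real.sqrt_pos.2 hH
  have hsq : √(H (p 1)) ^ 2 = H (p 1) := Real.sq_sqrt hH.le
  have ev : x₃ A H r =ᶠ[𝓝 (p 1)] fun ρ => r ρ * deriv A ρ / (2 * A ρ * √(H ρ)) := by
    filter_upwards [h.contDiffAt_r.continuousAt.eventually (lt_mem_nhds hr)] with ρ hρ
    exact x₃_eq hρ
  refine (((dr.mul dA').div ((dA.const_mul 2).mul (dH.sqrt hH.ne')) ?_).congr_deriv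
    ?_).congr_of_eventuallyEq ev
  · simp only [Pi.mul_apply]
    positivity
  simp only [sectional, x₂_eq hr, x₃_eq hr, Pi.mul_apply]
  generalize √(H (p 1)) = s at *
  rw [← hsq]
  field_simp
  ring

/-- The Einstein equations are the reduced system. -/
theorem einstein_eq_iff (h : RegularAt A H r p) (ψ : ℝ → ℝ) :
    (∀ a b, einstein (staticMetric A H r) a b p =
      scalarStress (staticMetric A H r) (fun q => ψ (q 1)) a b p) ↔
      (normDeriv H r (x₂ H r) (p 1), normDeriv H r (x₃ A H r) (p 1)) =
        field (x₂ H r (p 1), x₃ A H r (p 1)) ∧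
      y₁ H r ψ (p 1) ^ 2 = x₂ H r (p 1) ^ 2 + 2 * x₂ H r (p 1) * x₃ A H r (p 1) - 1 := by
  have hA := h.pos_A
  have hH := h.pos_H
  have hr := h.pos_r
  have hs : 0 < √(H (p 1)) := Real.sqrt_pos.2 hH
  have hsq : √(H (p 1)) ^ 2 = H (p 1) := Real.sq_sqrt hH.le
  -- `e1` to `e4` express the four sectional curvatures, scaled by `r ^ 2`, through `x₂`, `x₃` and
  -- their normalized derivatives. The equivalence is then linear algebra.
  have e1 : normDeriv H r (x₂ H r) (p 1) = -(r (p 1) ^ 2 * sectional A H r (p 1) 1 2) := by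
    rw [normDeriv_eq hr, h.hasDerivAt_x₂.deriv]
    field_simp
  have e2 : normDeriv H r (x₃ A H r) (p 1) = -(r (p 1) ^ 2 * sectional A H r (p 1) 0 1)
      + x₂ H r (p 1) * x₃ A H r (p 1) - x₃ A H r (p 1) ^ 2 := by
    rw [normDeriv_eq hr, h.hasDerivAt_x₃.deriv]
    field_simp
  have e3 : x₂ H r (p 1) * x₃ A H r (p 1) = -(r (p 1) ^ 2 * sectional A H r (p 1) 0 2) := by
    rw [x₂_eq hr, x₃_eq hr]
    simp only [sectional]
    generalize √(H (p 1)) = s at *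
    rw [← hsq]
    field_simp
  have e4 : x₂ H r (p 1) ^ 2 = 1 - r (p 1) ^ 2 * sectional A H r (p 1) 2 3 := by
    rw [x₂_eq hr]
    simp only [sectional]
    generalize √(H (p 1)) = s at *
    rw [← hsq]
    field_simp
    ring
  rw [einstein_eq_iff_sectional h, y₁_sq_eq hr hH, e1, e2, field, Prod.mk.injEq]
  dsimp only
  generalize deriv ψ (p 1) ^ 2 / (2 * H (p 1)) = P
  have hr2 : r (p 1) ^ 2 ≠ 0 := pow_ne_zero 2 hr.ne'
  constructor
  · rintro ⟨h0, h1, h2⟩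
    refine ⟨⟨?_, ?_⟩, ?_⟩
    · linear_combination e4 + e3 - r (p 1) ^ 2 / 2 * (h0 + h1)
    · linear_combination 2 * e3 - r (p 1) ^ 2 * (h2 - h0 / 2 + h1 / 2)
    · linear_combination -e4 - 2 * e3 + r (p 1) ^ 2 * h1
  · rintro ⟨⟨h0, h1⟩, h2⟩
    refine ⟨?_, ?_, ?_⟩ <;> apply mul_left_cancel₀ hr2
    · linear_combination -2 * h0 + e4 - h2
    · linear_combination e4 + 2 * e3 + h2
    · linear_combination -h0 - h1 - h2 + e3
  
/-- The wave equation in terms of the normalized radial derivative. -/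
theorem wave_eq_iff (h : RegularAt A H r p) {ψ : ℝ → ℝ} (hψ : ContDiffAt ℝ 2 ψ (p 1)) :
    waveOperator (staticMetric A H r) (fun q => ψ (q 1)) p = 0 ↔
      normDeriv H r (normDeriv H r ψ) (p 1) =
        -(x₂ H r (p 1) + x₃ A H r (p 1)) * normDeriv H r ψ (p 1) := by
  have hA := h.pos_A
  have hH := h.pos_H
  have hr := h.pos_r
  have dH := (h.contDiffAt_H.differentiableAt (by norm_num)).hasDerivAt
  have dr := (h.contDiffAt_r.differentiableAt (by norm_num)).hasDerivAt
  have dψ' := (ContDiffAt.differentiableAt_deriv_of_two hψ).hasDerivAt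
  have hs : 0 < √(H (p 1)) := Real.sqrt_pos.2 hH
  have hsq : √(H (p 1)) ^ 2 = H (p 1) := Real.sq_sqrt hH.le
  have ev : normDeriv H r ψ =ᶠ[𝓝 (p 1)] fun ρ => r ρ * deriv ψ ρ / √(H ρ) := by
    filter_upwards [h.contDiffAt_r.continuousAt.eventually (lt_mem_nhds hr)] with ρ hρ
    exact normDeriv_eq hρ
  rw [waveOperator_staticMetric h, normDeriv_eq hr,
    (((dr.mul dψ').div (dH.sqrt hH.ne') hs.ne').congr_of_eventuallyEq ev).deriv, normDeriv_eq hr,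
    x₂_eq hr, x₃_eq hr, ← sub_eq_zero (b := -_ * _)]
  simp only [Pi.mul_apply]
  generalize √(H (p 1)) = s at *
  rw [← hsq]
  rw [← mul_right_inj' (pow_ne_zero 2 hr.ne'), mul_zero]
  apply Eq.congr_left
  field_simp
  ring

end Curvature

/-! ### Solutions of the reduced system -/

/-- An even field makes `(ξ, x) ↦ (-ξ, -x)` a symmetry, which reduces solutions with x₂ < 0 to those
with x₂ > 0. -/
theorem field_neg (x : ℝ × ℝ) : field (-x) = field x := by
  simp only [field, Prod.fst_neg, Prod.snd_neg]
  ext <;> dsimp only <;> ring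

theorem hasDerivWithinAt_fst {γ : ℝ → ℝ × ℝ} {v : ℝ × ℝ} {s : Set ℝ} {τ : ℝ}
    (h : HasDerivWithinAt γ v s τ) : HasDerivWithinAt (fun τ => (γ τ).1) v.1 s τ :=
  (hasFDerivAt_fst (𝕜 := ℝ) (p := γ τ)).comp_hasDerivWithinAt τ h

theorem hasDerivWithinAt_snd {γ : ℝ → ℝ × ℝ} {v : ℝ × ℝ} {s : Set ℝ} {τ : ℝ}
    (h : HasDerivWithinAt γ v s τ) : HasDerivWithinAt (fun τ => (γ τ).2) v.2 s τ :=
  (hasFDerivAt_snd (𝕜 := ℝ) (p := γ τ)).comp_hasDerivWithinAt τ h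

theorem hasDerivWithinAt_sinh_sub (t₀ τ : ℝ) (s : Set ℝ) :
    HasDerivWithinAt (fun τ => sinh (τ - t₀)) (cosh (τ - t₀)) s τ := by
  have := ((hasDerivAt_id τ).sub_const t₀).sinh
  simpa using this.hasDerivWithinAt

theorem hasDerivWithinAt_cosh_sub (t₀ τ : ℝ) (s : Set ℝ) :
    HasDerivWithinAt (fun τ => cosh (τ - t₀)) (sinh (τ - t₀)) s τ := by
  have := ((hasDerivAt_id τ).sub_const t₀).cosh
  simpa using this.hasDerivWithinAt

/-- The form in which conserved quantities are used: one-sided derivatives suffice at the ends, and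
`a = b` is allowed. -/
theorem eq_of_hasDerivWithinAt_zero {a b : ℝ} {f : ℝ → ℝ}
    (h : ∀ τ ∈ Icc a b, HasDerivWithinAt f 0 (Icc a b) τ) {s t : ℝ} (hs : s ∈ Icc a b)
    (ht : t ∈ Icc a b) : f s = f t := by
  have key : ∀ x ∈ Icc a b, f x = f a := by
    intro x hx
    rcases eq_or_lt_of_le (hx.1.trans hx.2) with hab | hab
    · rw [← hab, Icc_self] at hx
      rw [hx]
    · refine constant_of_derivWithin_zero (fun x hx => (h x hx).differentiableWithinAt)
        (fun x hx => ?_) x hx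
      exact (h x (Ico_subset_Icc_self hx)).derivWithin
        ((uniqueDiffOn_Icc hab) x (Ico_subset_Icc_self hx))
  rw [key s hs, key t ht]

/-- The integrating factor of the reduced system is a solution of `Q'' = Q`. -/
theorem solution_formula {a b t₀ : ℝ} {γ : ℝ → ℝ × ℝ}
    (h : ∀ τ ∈ Icc a b, HasDerivWithinAt γ (field (γ τ)) (Icc a b) τ) (ht₀ : t₀ ∈ Icc a b)
    {τ : ℝ} (hτ : τ ∈ Icc a b) :
    0 < cosh (τ - t₀) + ((γ t₀).1 + (γ t₀).2) * sinh (τ - t₀) ∧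
    ((γ τ).1 + (γ τ).2) * (cosh (τ - t₀) + ((γ t₀).1 + (γ t₀).2) * sinh (τ - t₀)) =
      sinh (τ - t₀) + ((γ t₀).1 + (γ t₀).2) * cosh (τ - t₀) ∧
    (γ τ).2 * (cosh (τ - t₀) + ((γ t₀).1 + (γ t₀).2) * sinh (τ - t₀)) = (γ t₀).2 := by
  have hab : a ≤ b := hτ.1.trans hτ.2
  -- In the variables `w = x₂ + x₃` and `y = x₃` the system is triangular: a Riccati equation for
  -- `w` and a linear one for `y`.
  set w : ℝ → ℝ := fun τ => (γ τ).1 + (γ τ).2 with hw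
  set y : ℝ → ℝ := fun τ => (γ τ).2 with hy
  have hdy : ∀ τ ∈ Icc a b, HasDerivWithinAt y (-(y τ * w τ)) (Icc a b) τ := by
    intro τ hτ
    have : HasDerivWithinAt y (field (γ τ)).2 (Icc a b) τ := by
      exact hasDerivWithinAt_snd (h τ hτ)
    refine this.congr_deriv ?_
    simp only [field, hw, hy]
    ring
  have hdw : ∀ τ ∈ Icc a b, HasDerivWithinAt w (1 - w τ ^ 2) (Icc a b) τ := by
    intro τ hτ
    have : HasDerivWithinAt (fun τ => (γ τ).1) (field (γ τ)).1 (Icc a b) τ := by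
      exact hasDerivWithinAt_fst (h τ hτ)
    refine (this.add (hdy τ hτ)).congr_deriv ?_
    simp only [field, hw, hy]
    ring
  have hwc : ContinuousOn w (Icc a b) := fun τ hτ => (hdw τ hτ).continuousWithinAt
  -- Extending `w` continuously to ℝ lets the fundamental theorem of calculus apply at the end
  -- points of the interval too.
  set W : ℝ → ℝ := IccExtend hab ((Icc a b).domRestrict w) with hW
  have hWc : Continuous W := (continuousOn_iff_continuous_domRestrict.1 hwc).Icc_extend'
  have hWw : ∀ τ ∈ Icc a b, W τ = w τ := fun τ hτ => by
    rw [hW, IccExtend_of_mem hab _ hτ]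
    rfl
  set Q : ℝ → ℝ := fun τ => exp (∫ x in t₀..τ, W x) with hQ
  have hQpos : ∀ τ, 0 < Q τ := fun τ => exp_pos _
  have hQ0 : Q t₀ = 1 := by simp [hQ]
  have hdQ : ∀ τ ∈ Icc a b, HasDerivWithinAt Q (w τ * Q τ) (Icc a b) τ := by
    intro τ hτ
    have := (intervalIntegral.integral_hasDerivAt_right (hWc.intervalIntegrable t₀ τ)
      (hWc.stronglyMeasurableAtFilter _ _) hWc.continuousAt).exp.hasDerivWithinAt (s := Icc a b)
    refine this.congr_deriv ?_
    rw [hWw τ hτ, mul_comm]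
  -- Since `Q' = w Q` and `Q'' = Q`, the combinations `Q cosh - Q' sinh`, `Q' cosh - Q sinh` and `Q
  -- y` are conserved. The first two determine `Q` and `Q'` by `cosh² - sinh² = 1`.
  have e1 := eq_of_hasDerivWithinAt_zero (f := fun τ => Q τ * (cosh (τ - t₀) - w τ * sinh (τ - t₀)))
    (fun τ hτ => ((hdQ τ hτ).mul ((hasDerivWithinAt_cosh_sub t₀ τ _).sub
      ((hdw τ hτ).mul (hasDerivWithinAt_sinh_sub t₀ τ _)))).congr_deriv (by
        simp only [Pi.mul_apply, Pi.sub_apply]; ring)) hτ ht₀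
  have e2 := eq_of_hasDerivWithinAt_zero (f := fun τ => Q τ * (w τ * cosh (τ - t₀) - sinh (τ - t₀)))
    (fun τ hτ => ((hdQ τ hτ).mul (((hdw τ hτ).mul (hasDerivWithinAt_cosh_sub t₀ τ _)).sub
      (hasDerivWithinAt_sinh_sub t₀ τ _))).congr_deriv (by
        simp only [Pi.mul_apply, Pi.sub_apply]; ring)) hτ ht₀
  have e3 := eq_of_hasDerivWithinAt_zero (f := fun τ => Q τ * y τ)
    (fun τ hτ => ((hdQ τ hτ).mul (hdy τ hτ)).congr_deriv (by ring)) hτ ht₀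
  simp only [hQ0, sub_self, cosh_zero, sinh_zero, mul_zero, sub_zero, mul_one, one_mul] at e1 e2 e3
  have hcs := cosh_sq_sub_sinh_sq (τ - t₀)
  have eQ : Q τ = cosh (τ - t₀) + w t₀ * sinh (τ - t₀) := by
    linear_combination cosh (τ - t₀) * e1 + sinh (τ - t₀) * e2 - Q τ * hcs
  change 0 < cosh (τ - t₀) + w t₀ * sinh (τ - t₀) ∧
    w τ * (cosh (τ - t₀) + w t₀ * sinh (τ - t₀)) = sinh (τ - t₀) + w t₀ * cosh (τ - t₀) ∧
    y τ * (cosh (τ - t₀) + w t₀ * sinh (τ - t₀)) = y t₀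
  rw [← eQ]
  refine ⟨hQpos τ, ?_, ?_⟩
  · linear_combination sinh (τ - t₀) * e1 + cosh (τ - t₀) * e2 - w τ * Q τ * hcs
  · linear_combination e3

theorem IsSolution.formula {γ : ℝ → ℝ × ℝ} {J : Set ℝ} (h : IsSolution γ J) {t₀ τ : ℝ}
    (ht₀ : t₀ ∈ J) (hτ : τ ∈ J) :
    0 < cosh (τ - t₀) + ((γ t₀).1 + (γ t₀).2) * sinh (τ - t₀) ∧
    ((γ τ).1 + (γ τ).2) * (cosh (τ - t₀) + ((γ t₀).1 + (γ t₀).2) * sinh (τ - t₀)) =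
      sinh (τ - t₀) + ((γ t₀).1 + (γ t₀).2) * cosh (τ - t₀) ∧
    (γ τ).2 * (cosh (τ - t₀) + ((γ t₀).1 + (γ t₀).2) * sinh (τ - t₀)) = (γ t₀).2 := by
  have hsub : uIcc t₀ τ ⊆ J := h.ordConnected.uIcc_subset ht₀ hτ
  exact solution_formula (fun x hx => (h.hasDerivAt x (hsub hx)).hasDerivWithinAt)
    left_mem_uIcc right_mem_uIcc

/-- The non-constant solutions of the reduced system. -/
def orbit (c s : ℝ) : ℝ × ℝ := ((cosh s - c) / sinh s, c / sinh s)

theorem orbit_neg (c s : ℝ) : orbit c (-s) = -orbit c s := by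
  simp [orbit, div_neg]

theorem hasDerivAt_orbit (c : ℝ) {s : ℝ} (hs : s ≠ 0) :
    HasDerivAt (orbit c) (field (orbit c s)) s := by
  have h0 : sinh s ≠ 0 := by simpa using hs
  have hcs := cosh_sq_sub_sinh_sq s
  refine HasDerivAt.prodMk
    ((((hasDerivAt_cosh s).sub_const c).div (hasDerivAt_sinh s) h0).congr_deriv ?_)
    (((hasDerivAt_const s c).div (hasDerivAt_sinh s) h0).congr_deriv ?_)
  · simp only [orbit]
    field_simp
    ring
  · simp only [orbit]
    field_simp
    ring

/-- The left side is `w² - x₃²` with `w = coth s` and `x₃ = c / sinh s`. Its excess over 1 is `y₁²`,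
so `|c| = 1` are exactly the orbits with constant scalar field. -/
theorem orbit_constraint (c : ℝ) {s : ℝ} (hs : s ≠ 0) :
    (orbit c s).1 ^ 2 + 2 * (orbit c s).1 * (orbit c s).2 = 1 + (1 - c ^ 2) / sinh s ^ 2 := by
  have h0 : sinh s ≠ 0 := by simpa using hs
  have hcs := cosh_sq_sub_sinh_sq s
  simp only [orbit]
  field_simp
  linear_combination hcs

theorem orbit_mem_phaseSpace {c s : ℝ} (hc : |c| ≤ 1) (hs : s ≠ 0) : orbit c s ∈ phaseSpace := by
  have h0 : sinh s ≠ 0 := by simpa using hs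
  change (1 : ℝ) ≤ _
  rw [orbit_constraint c hs]
  have : c ^ 2 ≤ 1 := by rwa [sq_le_one_iff_abs_le_one]
  have : 0 ≤ (1 - c ^ 2) / sinh s ^ 2 := by
    apply div_nonneg <;> nlinarith
  linarith

theorem orbit_fst_pos {c s : ℝ} (hc : |c| ≤ 1) (hs : 0 < s) : 0 < (orbit c s).1 := by
  have h0 : 0 < sinh s := by simpa using hs
  have h1 : 1 < cosh s := by simpa using hs.ne'
  have := (abs_le.1 hc).2
  exact div_pos (by linarith) h0

theorem phaseSpace_neg {x : ℝ × ℝ} : -x ∈ phaseSpace ↔ x ∈ phaseSpace := by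
  simp only [phaseSpace, mem_ofPred_eq, Prod.fst_neg, Prod.snd_neg]
  ring_nf

/-- The constraint says `w² ≥ 1 + x₃²`. Hence `w ≥ 1`; equality forces `x₃ = 0`, and otherwise `w =
coth s` can be solved for `s > 0`. -/
theorem exists_orbit_of_pos {x : ℝ × ℝ} (hx : x ∈ phaseSpace) (hw : 0 < x.1 + x.2) :
    x = PM ∨ ∃ c s, |c| ≤ 1 ∧ 0 < s ∧ x = orbit c s := by
  have hx' : 1 ≤ x.1 ^ 2 + 2 * x.1 * x.2 := hx
  rcases (by nlinarith [sq_nonneg x.2] : 1 ≤ x.1 + x.2).eq_or_lt with h | h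
  · left
    have h2 : x.2 = 0 := by
      have : x.2 ^ 2 ≤ 0 := by nlinarith
      nlinarith [sq_nonneg x.2]
    ext
    · simp only [PM]; linarith
    · simpa [PM] using h2
  · right
    set w := x.1 + x.2
    have hw1 : 0 < w ^ 2 - 1 := by nlinarith
    have hsq : 0 < √(w ^ 2 - 1) := Real.sqrt_pos.2 hw1
    have hs2 : √(w ^ 2 - 1) ^ 2 = w ^ 2 - 1 := Real.sq_sqrt hw1.le
    have hs : sinh (arsinh (1 / √(w ^ 2 - 1))) = 1 / √(w ^ 2 - 1) := sinh_arsinh _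
    have hc : cosh (arsinh (1 / √(w ^ 2 - 1))) = w / √(w ^ 2 - 1) := by
      rw [cosh_arsinh, show 1 + (1 / √(w ^ 2 - 1)) ^ 2 = (w / √(w ^ 2 - 1)) ^ 2 by
        field_simp; linarith, Real.sqrt_sq (by positivity)]
    -- `coth s = w` means `sinh s = 1 / √(w² - 1)`, and then `c = x₃ sinh s`.
    refine ⟨x.2 / √(w ^ 2 - 1), arsinh (1 / √(w ^ 2 - 1)), ?_, ?_, ?_⟩
    · rw [abs_div, abs_of_pos hsq, div_le_one hsq]
      apply Real.abs_le_sqrt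
      nlinarith
    · rw [arsinh_pos_iff]
      positivity
    · simp only [orbit, hs, hc]
      ext
      · field_simp
        ring
      · field_simp

/-- The region splits into the halves `w > 0` and `w < 0`, which the reflection exchanges. -/
theorem add_ne_zero_of_mem_phaseSpace {x : ℝ × ℝ} (hx : x ∈ phaseSpace) : x.1 + x.2 ≠ 0 := by
  intro h
  have hx' : 1 ≤ x.1 ^ 2 + 2 * x.1 * x.2 := hx
  nlinarith [sq_nonneg x.2, congrArg (· ^ 2) h]

theorem neg_PM : -PM = PMbar := by simp [PM, PMbar]

theorem neg_PMbar : -PMbar = PM := by simp [PM, PMbar]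

theorem exists_orbit {x : ℝ × ℝ} (hx : x ∈ phaseSpace) :
    x = PM ∨ x = PMbar ∨ ∃ c s, |c| ≤ 1 ∧ s ≠ 0 ∧ x = orbit c s := by
  rcases lt_or_gt_of_ne (add_ne_zero_of_mem_phaseSpace hx) with h | h
  · rcases exists_orbit_of_pos (phaseSpace_neg.2 hx) (by simp; linarith) with h | ⟨c, s, h1, h2, h3⟩
    · right; left
      rw [← neg_neg x, h, neg_PM]
    · refine Or.inr (Or.inr ⟨c, -s, h1, by simpa using h2.ne', ?_⟩)
      rw [orbit_neg, ← h3, neg_neg]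
  · rcases exists_orbit_of_pos hx h with h | ⟨c, s, h1, h2, h3⟩
    · exact Or.inl h
    · exact Or.inr (Or.inr ⟨c, s, h1, h2.ne', h3⟩)

theorem IsSolution.eq_PM {γ : ℝ → ℝ × ℝ} {J : Set ℝ} (h : IsSolution γ J) {t₀ : ℝ} (ht₀ : t₀ ∈ J)
    (h0 : γ t₀ = PM) {τ : ℝ} (hτ : τ ∈ J) : γ τ = PM := by
  obtain ⟨h1, h2, h3⟩ := h.formula ht₀ hτ
  simp only [h0, PM, add_zero, one_mul] at h1 h2 h3
  have h4 : (γ τ).2 = 0 := by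
    rcases mul_eq_zero.1 h3 with h | h
    · exact h
    · exact absurd h h1.ne'
  rw [h4, add_zero] at h2
  ext
  · exact mul_right_cancel₀ h1.ne' (by simp only [PM]; linarith)
  · exact h4

/-- By the addition theorems the integrating factor is `sinh (τ - t₀ + s) / sinh s`. Its positivity
keeps the shifted time on the same side of 0 as `s`: no solution passes the blow-up time `t₀ - s`.
-/
theorem IsSolution.eq_orbit {γ : ℝ → ℝ × ℝ} {J : Set ℝ} (h : IsSolution γ J) {t₀ : ℝ}
    (ht₀ : t₀ ∈ J) {c s : ℝ} (hs : s ≠ 0) (h0 : γ t₀ = orbit c s) {τ : ℝ} (hτ : τ ∈ J) :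
    0 < s * (τ - (t₀ - s)) ∧ γ τ = orbit c (τ - (t₀ - s)) := by
  obtain ⟨h1, h2, h3⟩ := h.formula ht₀ hτ
  have hs0 : sinh s ≠ 0 := by simpa using hs
  have hw : (γ t₀).1 + (γ t₀).2 = cosh s / sinh s := by
    rw [h0, orbit]
    field_simp
    ring
  have hy : (γ t₀).2 = c / sinh s := by rw [h0, orbit]
  rw [hw] at h1 h2 h3
  rw [hy] at h3
  have e1 : sinh (τ - (t₀ - s)) =
      (cosh (τ - t₀) + cosh s / sinh s * sinh (τ - t₀)) * sinh s := by
    rw [show τ - (t₀ - s) = (τ - t₀) + s by ring, sinh_add]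
    field_simp
    ring
  have e2 : cosh (τ - (t₀ - s)) =
      (sinh (τ - t₀) + cosh s / sinh s * cosh (τ - t₀)) * sinh s := by
    rw [show τ - (t₀ - s) = (τ - t₀) + s by ring, cosh_add]
    field_simp
    ring
  constructor
  · rcases lt_or_gt_of_ne hs with hneg | hpos
    · have h5 : sinh (τ - (t₀ - s)) < 0 := by
        rw [e1]
        exact mul_neg_of_pos_of_neg h1 (by simpa using hneg)
      rw [Real.sinh_neg_iff] at h5
      exact mul_pos_of_neg_of_neg hneg h5
    · have h5 : 0 < sinh (τ - (t₀ - s)) := by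
        rw [e1]
        exact mul_pos h1 (by simpa using hpos)
      rw [Real.sinh_pos_iff] at h5
      exact mul_pos hpos h5
  · have h6 : (γ τ).1 + (γ τ).2 = cosh (τ - (t₀ - s)) / sinh (τ - (t₀ - s)) := by
      rw [e1, e2, ← h2, eq_div_iff (mul_ne_zero h1.ne' hs0), mul_assoc]
    have h7 : (γ τ).2 = c / sinh (τ - (t₀ - s)) := by
      rw [e1, eq_div_iff (mul_ne_zero h1.ne' hs0), ← mul_assoc, h3]
      field_simp
    ext
    · simp only [orbit]
      rw [sub_div, ← h6, ← h7]
      ring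
    · exact h7

/-- The reflection `ξ ↦ -ξ`, `x ↦ -x` of the reduced system. -/
def reflection (γ : ℝ → ℝ × ℝ) (ξ : ℝ) : ℝ × ℝ := -γ (-ξ)

theorem reflection_reflection (γ : ℝ → ℝ × ℝ) : reflection (reflection γ) = γ := by
  ext ξ <;> simp [reflection]

theorem IsSolution.reflect {γ : ℝ → ℝ × ℝ} {J : Set ℝ} (h : IsSolution γ J) :
    IsSolution (reflection γ) (-J) where
  isOpen := h.isOpen.neg
  ordConnected := ⟨fun x hx y hy z hz =>
    h.ordConnected.out (x := -y) (y := -x) hy hx ⟨neg_le_neg hz.2, neg_le_neg hz.1⟩⟩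
  nonempty := h.nonempty.neg
  hasDerivAt ξ hξ := by
    have := ((h.hasDerivAt (-ξ) hξ).scomp ξ (hasDerivAt_neg ξ)).neg
    refine this.congr_deriv ?_
    simp [reflection, field_neg]
  mem ξ hξ := phaseSpace_neg.2 (h.mem (-ξ) hξ)

theorem IsMaximalSolution.reflect {γ : ℝ → ℝ × ℝ} {J : Set ℝ} (h : IsMaximalSolution γ J) :
    IsMaximalSolution (reflection γ) (-J) := by
  refine ⟨h.1.reflect, fun γ' J' h' hJ hγ => ?_⟩
  have := h.2 (reflection γ') (-J') h'.reflect (by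
    rw [← Set.neg_subset_neg, neg_neg]; exact hJ) (fun ξ hξ => by
      have := hγ (x := -ξ) (by simpa using hξ)
      simp only [reflection, neg_neg] at this ⊢
      rw [this, neg_neg])
  rw [← this, neg_neg]

theorem isSolution_PM : IsSolution (fun _ => PM) univ where
  isOpen := isOpen_univ
  ordConnected := ordConnected_univ
  nonempty := univ_nonempty
  hasDerivAt ξ _ := by
    have : field PM = 0 := by ext <;> norm_num [field, PM]
    rw [this]
    exact hasDerivAt_const ξ PM
  mem ξ _ := by norm_num [phaseSpace, PM]

theorem isSolution_orbit {c : ℝ} (hc : |c| ≤ 1) (a : ℝ) :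
    IsSolution (fun ξ => orbit c (ξ - a)) (Ioi a) where
  isOpen := isOpen_Ioi
  ordConnected := ordConnected_Ioi
  nonempty := nonempty_Ioi
  hasDerivAt ξ hξ := by
    exact (hasDerivAt_orbit c (s := ξ - a) (sub_ne_zero.2 (ne_of_gt hξ))).comp_sub_const ξ a
  mem ξ hξ := orbit_mem_phaseSpace hc (sub_ne_zero.2 (ne_of_gt hξ))

theorem isMaximalSolution_PM : IsMaximalSolution (fun _ => PM) univ :=
  ⟨isSolution_PM, fun _ _ _ h _ => univ_subset_iff.1 h⟩

theorem isMaximalSolution_orbit {c : ℝ} (hc : |c| ≤ 1) (a : ℝ) :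
    IsMaximalSolution (fun ξ => orbit c (ξ - a)) (Ioi a) := by
  refine ⟨isSolution_orbit hc a, fun γ' J' h' hJ hγ => ?_⟩
  have hm : a + 1 ∈ Ioi a := by simp
  -- Any extension agrees with the orbit at `a + 1`, where the orbit parameter is 1; the positivity
  -- in `eq_orbit` then confines it to times after `a`.
  refine Subset.antisymm (fun τ hτ => ?_) hJ
  have := (h'.eq_orbit (hJ hm) (c := c) (s := 1) one_ne_zero (by
    rw [hγ hm]; simp) hτ).1
  simp at this
  simpa using this

/-- One value determines an explicit solution that agrees with `γ` on `J` and whose domain contains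
`J`; maximality makes the domains equal. -/
theorem IsMaximalSolution.classification {γ : ℝ → ℝ × ℝ} {J : Set ℝ}
    (h : IsMaximalSolution γ J) :
    (J = univ ∧ ∀ ξ, γ ξ = PM) ∨ (J = univ ∧ ∀ ξ, γ ξ = PMbar) ∨
      (∃ a c, |c| ≤ 1 ∧ J = Ioi a ∧ ∀ ξ ∈ J, γ ξ = orbit c (ξ - a)) ∨
      (∃ a c, |c| ≤ 1 ∧ J = Iio a ∧ ∀ ξ ∈ J, γ ξ = orbit c (ξ - a)) := by
  have key1 : ∀ {γ : ℝ → ℝ × ℝ} {J : Set ℝ}, IsMaximalSolution γ J → ∀ {t}, t ∈ J → γ t = PM →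
      J = univ ∧ ∀ ξ, γ ξ = PM := by
    intro γ J h t ht h0
    have : univ = J := h.2 _ _ isSolution_PM (subset_univ _)
      (fun τ hτ => (h.1.eq_PM ht h0 hτ).symm)
    subst this
    exact ⟨rfl, fun ξ => h.1.eq_PM ht h0 (mem_univ ξ)⟩
  have key2 : ∀ {γ : ℝ → ℝ × ℝ} {J : Set ℝ}, IsMaximalSolution γ J → ∀ {t}, t ∈ J →
      ∀ {c s}, |c| ≤ 1 → 0 < s → γ t = orbit c s →
      ∃ a c, |c| ≤ 1 ∧ J = Ioi a ∧ ∀ ξ ∈ J, γ ξ = orbit c (ξ - a) := by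
    intro γ J h t ht c s hc hs h0
    have h1 : ∀ τ ∈ J, γ τ = orbit c (τ - (t - s)) := fun τ hτ => (h.1.eq_orbit ht hs.ne' h0 hτ).2
    have h2 : J ⊆ Ioi (t - s) := fun τ hτ => by
      have := (h.1.eq_orbit ht hs.ne' h0 hτ).1
      exact sub_pos.1 (pos_of_mul_pos_right this hs.le)
    have h3 := h.2 _ _ (isSolution_orbit hc (t - s)) h2 (fun τ hτ => (h1 τ hτ).symm)
    exact ⟨t - s, c, hc, h3.symm, h1⟩
  obtain ⟨t, ht⟩ := h.1.nonempty
  have htn : -t ∈ -J := by simpa using ht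
  rcases exists_orbit (h.1.mem t ht) with h0 | h0 | ⟨c, s, hc, hs, h0⟩
  · exact Or.inl (key1 h ht h0)
  · obtain ⟨h1, h2⟩ := key1 h.reflect htn (by simp [reflection, h0, neg_PMbar])
    refine Or.inr (Or.inl ⟨by rw [← neg_neg J, h1]; simp, fun ξ => ?_⟩)
    have := h2 (-ξ)
    rw [reflection, neg_neg, neg_eq_iff_eq_neg, neg_PM] at this
    exact this
  · rcases lt_or_gt_of_ne hs with hs | hs
    · obtain ⟨a, c, hc, h1, h2⟩ := key2 h.reflect htn hc (neg_pos.2 hs)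
        (by simp [reflection, h0, orbit_neg])
      refine Or.inr (Or.inr (Or.inr ⟨-a, c, hc, by rw [← neg_neg J, h1]; simp, fun ξ hξ => ?_⟩))
      have := h2 (-ξ) (by simpa using hξ)
      rw [reflection, neg_neg, neg_eq_iff_eq_neg, ← orbit_neg] at this
      rw [this]
      ring_nf
    · exact Or.inr (Or.inr (Or.inl (key2 h ht hc hs h0)))

theorem exists_isMaximalSolution {x : ℝ × ℝ} (hx : x ∈ phaseSpace) :
    ∃ γ J, IsMaximalSolution γ J ∧ (0 : ℝ) ∈ J ∧ γ 0 = x := by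
  have key : ∀ {x : ℝ × ℝ}, x ∈ phaseSpace → 0 < x.1 + x.2 →
      ∃ γ J, IsMaximalSolution γ J ∧ (0 : ℝ) ∈ J ∧ γ 0 = x := by
    intro x hx hw
    rcases exists_orbit_of_pos hx hw with h | ⟨c, s, h1, h2, h3⟩
    · exact ⟨_, _, isMaximalSolution_PM, mem_univ _, h.symm⟩
    · exact ⟨_, _, isMaximalSolution_orbit h1 (-s), by simpa using h2, by simp [h3]⟩
  rcases lt_or_gt_of_ne (add_ne_zero_of_mem_phaseSpace hx) with h | h
  · obtain ⟨γ, J, h1, h2, h3⟩ := key (phaseSpace_neg.2 hx) (by simp; linarith)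
    exact ⟨_, _, h1.reflect, by simpa using h2, by simp [reflection, h3]⟩
  · exact key hx h

/-! ### Finite fixed points -/

theorem fixedPoints_eq : {x | x ∈ phaseSpace ∧ field x = 0} = {PM, PMbar} := by
  ext x
  simp only [mem_ofPred_eq, mem_insert_iff, mem_singleton_iff]
  constructor
  · rintro ⟨-, h⟩
    have h1 : 1 - x.1 * (x.1 + x.2) = 0 := congrArg Prod.fst h
    have h2 : -x.2 * (x.1 + x.2) = 0 := congrArg Prod.snd h
    have h3 : x.2 = 0 := by
      rcases mul_eq_zero.1 h2 with h | h
      · linarith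
      · rw [h] at h1
        norm_num at h1
    have h4 : x.1 ^ 2 = 1 := by
      rw [h3] at h1
      linarith
    rcases sq_eq_sq_iff_eq_or_eq_neg.1 (h4.trans (one_pow 2).symm) with h | h
    · left
      ext
      · exact h
      · exact h3
    · right
      ext
      · exact h
      · exact h3
  · rintro (h | h) <;> rw [h] <;> norm_num [phaseSpace, field, PM, PMbar]

theorem fderiv_field_apply (p v : ℝ × ℝ) :
    fderiv ℝ field p v = (-(v.1 * (p.1 + p.2)) - p.1 * (v.1 + v.2),
      -(v.2 * (p.1 + p.2)) - p.2 * (v.1 + v.2)) := by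
  have h1 : HasFDerivAt (fun x : ℝ × ℝ => x.1) (ContinuousLinearMap.fst ℝ ℝ ℝ) p := hasFDerivAt_fst
  have h2 : HasFDerivAt (fun x : ℝ × ℝ => x.2) (ContinuousLinearMap.snd ℝ ℝ ℝ) p := hasFDerivAt_snd
  have h : HasFDerivAt field _ p :=
    ((h1.mul (h1.add h2)).const_sub 1).prodMk (h2.neg.mul (h1.add h2))
  rw [h.fderiv]
  ext <;> simp <;> ring

theorem hasEigenvalue_fderiv_field_PM (μ : ℝ) : Module.End.HasEigenvalue
      ((fderiv ℝ field PM : ℝ × ℝ →L[ℝ] ℝ × ℝ) : Module.End ℝ (ℝ × ℝ)) μ ↔ μ = -2 ∨ μ = -1 := by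
  constructor
  · intro h
    obtain ⟨v, hv⟩ := h.exists_hasEigenvector
    have h0 := hv.2
    have h1 := hv.apply_eq_smul
    rw [ContinuousLinearMap.coe_coe, fderiv_field_apply] at h1
    have h2 := congrArg Prod.fst h1
    have h3 := congrArg Prod.snd h1
    simp only [PM, Prod.smul_fst, Prod.smul_snd, smul_eq_mul] at h2 h3
    -- The linearization is the triangular map `(v₁, v₂) ↦ (-2 v₁ - v₂, -v₂)`; a nonzero second
    -- component forces the eigenvalue -1, a vanishing one forces -2.
    by_cases hv2 : v.2 = 0
    · left
      have hv1 : v.1 ≠ 0 := fun h => h0 (Prod.ext h hv2)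
      rw [hv2] at h2
      apply mul_right_cancel₀ hv1
      linarith
    · right
      apply mul_right_cancel₀ hv2
      linarith
  · rintro (rfl | rfl)
    · refine Module.End.hasEigenvalue_of_hasEigenvector (x := ((1, 0) : ℝ × ℝ))
        ⟨Module.End.mem_eigenspace_iff.2 ?_, by simp⟩
      rw [ContinuousLinearMap.coe_coe, fderiv_field_apply]
      ext <;> norm_num [PM]
    · refine Module.End.hasEigenvalue_of_hasEigenvector (x := ((1, -1) : ℝ × ℝ))
        ⟨Module.End.mem_eigenspace_iff.2 ?_, by simp⟩
      rw [ContinuousLinearMap.coe_coe, fderiv_field_apply]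
      ext <;> norm_num [PM]

theorem hasEigenvalue_fderiv_field_PMbar (μ : ℝ) : Module.End.HasEigenvalue
      ((fderiv ℝ field PMbar : ℝ × ℝ →L[ℝ] ℝ × ℝ) : Module.End ℝ (ℝ × ℝ)) μ ↔
      μ = 2 ∨ μ = 1 := by
  constructor
  · intro h
    obtain ⟨v, hv⟩ := h.exists_hasEigenvector
    have h0 := hv.2
    have h1 := hv.apply_eq_smul
    rw [ContinuousLinearMap.coe_coe, fderiv_field_apply] at h1
    have h2 := congrArg Prod.fst h1
    have h3 := congrArg Prod.snd h1
    simp only [PMbar, Prod.smul_fst, Prod.smul_snd, smul_eq_mul] at h2 h3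
    by_cases hv2 : v.2 = 0
    · left
      have hv1 : v.1 ≠ 0 := fun h => h0 (Prod.ext h hv2)
      rw [hv2] at h2
      apply mul_right_cancel₀ hv1
      linarith
    · right
      apply mul_right_cancel₀ hv2
      linarith
  · rintro (rfl | rfl)
    · refine Module.End.hasEigenvalue_of_hasEigenvector (x := ((1, 0) : ℝ × ℝ))
        ⟨Module.End.mem_eigenspace_iff.2 ?_, by simp⟩
      rw [ContinuousLinearMap.coe_coe, fderiv_field_apply]
      ext <;> norm_num [PMbar]
    · refine Module.End.hasEigenvalue_of_hasEigenvector (x := ((1, -1) : ℝ × ℝ))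
        ⟨Module.End.mem_eigenspace_iff.2 ?_, by simp⟩
      rw [ContinuousLinearMap.coe_coe, fderiv_field_apply]
      ext <;> norm_num [PMbar]

/-- From the explicit solution, `(w - 1) Q = (w₀ - 1) e^{-τ}` and `y Q = y₀`. For `w₀ ≥ 0` one has
`Q ≥ 1`, so neither deviation grows. -/
theorem isStable_PM : IsStable field univ PM := by
  intro ε hε
  -- The bound 1/2 ensures `w₀ ≥ 0`. The third of `ε` is used for `|x₂ - 1| ≤ |w - 1| + |y| ≤ |x₂(0)
  -- - 1| + 2 |y₀|`.
  refine ⟨min (ε / 3) (1 / 2), by positivity, fun T γ h h0 τ hτ => ?_⟩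
  have hT : (0 : ℝ) ≤ T := hτ.1.trans hτ.2
  obtain ⟨h1, h2, h3⟩ := solution_formula (fun t ht => (h t ht).1) (left_mem_Icc.2 hT) hτ
  rw [sub_zero] at h1 h2 h3
  rw [Prod.dist_eq, max_lt_iff, Real.dist_eq, Real.dist_eq] at h0
  obtain ⟨ha, hb⟩ := h0
  simp only [PM, sub_zero] at ha hb
  have ha1 := ha.trans_le (min_le_left _ _)
  have ha2 := ha.trans_le (min_le_right _ _)
  have hb1 := hb.trans_le (min_le_left _ _)
  have hb2 := hb.trans_le (min_le_right _ _)
  set w₀ := (γ 0).1 + (γ 0).2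
  set y₀ := (γ 0).2
  have hw₀ : 0 ≤ w₀ := by
    have := abs_lt.1 ha2
    have := abs_lt.1 hb2
    simp only [w₀]
    linarith
  have hs : 0 ≤ sinh τ := Real.sinh_nonneg_iff.2 hτ.1
  have hQ : 1 ≤ cosh τ + w₀ * sinh τ := by
    have := one_le_cosh τ
    have := mul_nonneg hw₀ hs
    linarith
  have hw : |(γ τ).1 + (γ τ).2 - 1| ≤ |w₀ - 1| := by
    have e : ((γ τ).1 + (γ τ).2 - 1) * (cosh τ + w₀ * sinh τ) = (w₀ - 1) * exp (-τ) := by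
      rw [← cosh_sub_sinh]
      linear_combination h2
    calc |(γ τ).1 + (γ τ).2 - 1| ≤ |(γ τ).1 + (γ τ).2 - 1| * (cosh τ + w₀ * sinh τ) :=
          le_mul_of_one_le_right (abs_nonneg _) hQ
      _ = |w₀ - 1| * exp (-τ) := by
          rw [← abs_of_pos h1, ← abs_mul, e, abs_mul, abs_of_pos (exp_pos _)]
      _ ≤ |w₀ - 1| := mul_le_of_le_one_right (abs_nonneg _) (by simpa using hτ.1)
  have hy : |(γ τ).2| ≤ |y₀| := by
    calc |(γ τ).2| ≤ |(γ τ).2| * (cosh τ + w₀ * sinh τ) :=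
          le_mul_of_one_le_right (abs_nonneg _) hQ
      _ = |y₀| := by rw [← abs_of_pos h1, ← abs_mul, h3]
  have e1 : |w₀ - 1| ≤ |(γ 0).1 - 1| + |y₀| := by
    rw [show w₀ - 1 = ((γ 0).1 - 1) + y₀ by simp only [w₀, y₀]; ring]
    exact abs_add_le _ _
  have e2 : |(γ τ).1 - 1| ≤ |(γ τ).1 + (γ τ).2 - 1| + |(γ τ).2| := by
    rw [show (γ τ).1 - 1 = ((γ τ).1 + (γ τ).2 - 1) - (γ τ).2 by ring]
    exact abs_sub _ _
  rw [Prod.dist_eq, max_lt_iff, Real.dist_eq, Real.dist_eq]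
  simp only [PM, sub_zero]
  constructor <;> linarith

theorem isAsymptoticallyStable_PM : IsAsymptoticallyStable field univ PM := by
  refine ⟨isStable_PM, 1 / 2, by norm_num, fun x _ hx => ?_⟩
  rw [Prod.dist_eq, max_lt_iff, Real.dist_eq, Real.dist_eq] at hx
  simp only [PM, sub_zero] at hx
  have ha := abs_lt.1 hx.1
  have hb := abs_lt.1 hx.2
  set w₀ := x.1 + x.2 with hw₀
  have hw : 0 ≤ w₀ := by simp only [w₀]; linarith
  set Q : ℝ → ℝ := fun τ => cosh τ + w₀ * sinh τ with hQ
  have hQc : ∀ τ, 0 ≤ τ → cosh τ ≤ Q τ := fun τ hτ => by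
    have := mul_nonneg hw (Real.sinh_nonneg_iff.2 hτ)
    simp only [hQ]
    linarith
  have hQpos : ∀ τ, 0 ≤ τ → 0 < Q τ := fun τ hτ => (cosh_pos τ).trans_le (hQc τ hτ)
  have hdQ : ∀ τ, HasDerivAt Q (sinh τ + w₀ * cosh τ) τ := fun τ =>
    (hasDerivAt_cosh τ).add ((hasDerivAt_sinh τ).const_mul w₀)
  have hdQ' : ∀ τ, HasDerivAt (fun τ => sinh τ + w₀ * cosh τ) (Q τ) τ := fun τ =>
    (hasDerivAt_sinh τ).add ((hasDerivAt_cosh τ).const_mul w₀)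
  -- This is `((Q' - y₀) / Q, y₀ / Q)`, the solution written with the integrating factor; it exists
  -- for all `τ ≥ 0` because `Q ≥ cosh τ`.
  refine ⟨fun τ => ((sinh τ + w₀ * cosh τ - x.2) / Q τ, x.2 / Q τ), ?_, ?_, ?_⟩
  · ext <;> simp [hQ, hw₀]
  · intro τ hτ
    refine ⟨HasDerivAt.hasDerivWithinAt ?_, mem_univ _⟩
    have h0 := (hQpos τ hτ).ne'
    refine HasDerivAt.prodMk ((((hdQ' τ).sub_const x.2).div (hdQ τ) h0).congr_deriv ?_)
      (((hasDerivAt_const τ x.2).div (hdQ τ) h0).congr_deriv ?_)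
    · simp only
      field_simp
      ring
    · simp only
      field_simp
      ring
  · have hQt : Tendsto Q atTop atTop := by
      refine tendsto_atTop_mono' atTop ?_ (tendsto_exp_atTop.atTop_div_const (r := 2) (by norm_num))
      filter_upwards [eventually_ge_atTop 0] with τ hτ
      refine le_trans ?_ (hQc τ hτ)
      rw [cosh_eq]
      have := exp_pos (-τ)
      linarith
    have h1 : Tendsto (fun τ => x.2 / Q τ) atTop (𝓝 0) := hQt.const_div_atTop x.2
    have h2 : Tendsto (fun τ => 1 + ((w₀ - 1) * exp (-τ)) / Q τ - x.2 / Q τ) atTop (𝓝 1) := by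
      have h3 : Tendsto (fun τ => exp (-τ)) atTop (𝓝 0) :=
        tendsto_exp_atBot.comp tendsto_neg_atTop_atBot
      have := ((h3.const_mul (w₀ - 1)).div_atTop hQt).const_add 1 |>.sub h1
      simpa using this
    refine Tendsto.prodMk_nhds (h2.congr' ?_) h1
    filter_upwards [eventually_ge_atTop 0] with τ hτ
    have h0 := (hQpos τ hτ).ne'
    rw [← cosh_sub_sinh]
    field_simp
    simp only [hQ]
    ring

theorem IsAsymptoticallyStable.neg {v v' : ℝ × ℝ → ℝ × ℝ} {P : ℝ × ℝ}
    (h : IsAsymptoticallyStable v univ P) (hv : ∀ x, v' (-x) = -v x) :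
    IsAsymptoticallyStable v' univ (-P) := by
  have hv' : ∀ x, v' x = -v (-x) := fun x => by rw [← hv, neg_neg]
  have hd : ∀ x y : ℝ × ℝ, dist (-x) y = dist x (-y) := fun x y => by
    rw [← dist_neg_neg, neg_neg]
  constructor
  · intro ε hε
    obtain ⟨δ, hδ, h1⟩ := h.1 ε hε
    refine ⟨δ, hδ, fun T γ hγ h0 τ hτ => ?_⟩
    have := h1 T (fun t => -γ t) (fun t ht => ⟨by
      have := (hγ t ht).1.neg
      rwa [hv', neg_neg] at this, mem_univ _⟩) (by rwa [hd]) τ hτ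
    rwa [hd] at this
  · obtain ⟨δ, hδ, h1⟩ := h.2
    refine ⟨δ, hδ, fun x _ hx => ?_⟩
    obtain ⟨γ, h2, h3, h4⟩ := h1 (-x) (mem_univ _) (by rwa [hd])
    refine ⟨fun t => -γ t, by simp [h2], fun t ht => ⟨?_, mem_univ _⟩, h4.neg⟩
    rw [hv]
    exact (h3 t ht).1.neg

theorem isAsymptoticallyStable_PMbar :
    IsAsymptoticallyStable (fun x => -field x) univ PMbar := by
  rw [← neg_PM]
  exact isAsymptoticallyStable_PM.neg fun x => by rw [field_neg]

/-! ### The Poincaré compactification -/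

theorem one_sub_normSq_toPoincare (x : ℝ × ℝ) :
    1 - (toPoincare x).1 ^ 2 - (toPoincare x).2 ^ 2 = 1 / (1 + x.1 ^ 2 + x.2 ^ 2) := by
  have h : 0 < 1 + x.1 ^ 2 + x.2 ^ 2 := by positivity
  simp only [toPoincare, div_pow, Real.sq_sqrt h.le]
  field_simp
  ring

theorem toPoincare_neg (x : ℝ × ℝ) : toPoincare (-x) = -toPoincare x := by
  simp [toPoincare, neg_div]

theorem toPoincare_mem_iff (x : ℝ × ℝ) : toPoincare x ∈ poincareSpace ↔ x ∈ phaseSpace := by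
  have h : 0 < 1 + x.1 ^ 2 + x.2 ^ 2 := by positivity
  have h1 : 2 * (toPoincare x).1 ^ 2 + 2 * (toPoincare x).1 * (toPoincare x).2
      + (toPoincare x).2 ^ 2 =
      (2 * x.1 ^ 2 + 2 * x.1 * x.2 + x.2 ^ 2) / (1 + x.1 ^ 2 + x.2 ^ 2) := by
    have hs := Real.sq_sqrt h.le
    have hp := Real.sqrt_pos.2 h
    simp only [toPoincare]
    generalize √(1 + x.1 ^ 2 + x.2 ^ 2) = s at *
    rw [← hs]
    field_simp
  have h2 : (toPoincare x).1 ^ 2 + (toPoincare x).2 ^ 2 ≤ 1 := by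
    have := one_sub_normSq_toPoincare x
    have : 0 < 1 / (1 + x.1 ^ 2 + x.2 ^ 2) := by positivity
    linarith
  simp only [poincareSpace, phaseSpace, mem_ofPred_eq, h1, h2, and_true, le_div_iff₀ h]
  constructor <;> intro <;> linarith

/-- The length of the image determines the length of `x`, hence the normalizing factor. -/
theorem toPoincare_injective : Function.Injective toPoincare := by
  intro x y hxy
  have hx : 0 < 1 + x.1 ^ 2 + x.2 ^ 2 := by positivity
  have hy : 0 < 1 + y.1 ^ 2 + y.2 ^ 2 := by positivity
  have h1 := one_sub_normSq_toPoincare x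
  rw [hxy, one_sub_normSq_toPoincare y, div_eq_div_iff hy.ne' hx.ne', one_mul, one_mul] at h1
  have h2 := congrArg Prod.fst hxy
  have h3 := congrArg Prod.snd hxy
  simp only [toPoincare] at h2 h3
  rw [h1] at h2 h3
  have hs := (Real.sqrt_pos.2 hy).ne'
  ext
  · exact (div_left_inj' hs).1 h2
  · exact (div_left_inj' hs).1 h3

theorem bijOn_toPoincare : BijOn toPoincare phaseSpace (poincareSpace \ atInfinity) := by
  refine ⟨fun x hx => ?_, toPoincare_injective.injOn, fun X hX => ?_⟩
  · refine ⟨(toPoincare_mem_iff x).2 hx, fun h => ?_⟩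
    have h1 := one_sub_normSq_toPoincare x
    have h2 : 0 < 1 / (1 + x.1 ^ 2 + x.2 ^ 2) := by positivity
    have h3 := h.2
    linarith
  · have h1 : X.1 ^ 2 + X.2 ^ 2 < 1 := lt_of_le_of_ne hX.1.2 fun h => hX.2 ⟨hX.1, h⟩
    have h2 : 0 < 1 - X.1 ^ 2 - X.2 ^ 2 := by linarith
    have hs := Real.sq_sqrt h2.le
    have hp := Real.sqrt_pos.2 h2
    have key : toPoincare (X.1 / √(1 - X.1 ^ 2 - X.2 ^ 2), X.2 / √(1 - X.1 ^ 2 - X.2 ^ 2)) = X := by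
      have e : √(1 + (X.1 / √(1 - X.1 ^ 2 - X.2 ^ 2)) ^ 2 + (X.2 / √(1 - X.1 ^ 2 - X.2 ^ 2)) ^ 2) =
          1 / √(1 - X.1 ^ 2 - X.2 ^ 2) := by
        rw [← Real.sqrt_sq (show 0 ≤ 1 / √(1 - X.1 ^ 2 - X.2 ^ 2) by positivity)]
        congr 1
        rw [div_pow, div_pow, div_pow, hs]
        field_simp
        ring
      simp only [toPoincare, e]
      ext <;> field_simp
    exact ⟨_, (toPoincare_mem_iff _).1 (by rw [key]; exact hX.1), key⟩

theorem differentiableAt_toPoincare (x : ℝ × ℝ) : DifferentiableAt ℝ toPoincare x := by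
  have h : 1 + x.1 ^ 2 + x.2 ^ 2 ≠ 0 := by positivity
  have h' : √(1 + x.1 ^ 2 + x.2 ^ 2) ≠ 0 := by positivity
  unfold toPoincare
  fun_prop (disch := assumption)

theorem fderiv_toPoincare_apply (x v : ℝ × ℝ) :
    fderiv ℝ toPoincare x v =
      (v.1 / √(1 + x.1 ^ 2 + x.2 ^ 2)
        - x.1 * (x.1 * v.1 + x.2 * v.2) / √(1 + x.1 ^ 2 + x.2 ^ 2) ^ 3,
      v.2 / √(1 + x.1 ^ 2 + x.2 ^ 2)
        - x.2 * (x.1 * v.1 + x.2 * v.2) / √(1 + x.1 ^ 2 + x.2 ^ 2) ^ 3) := by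
  have h : 0 < 1 + x.1 ^ 2 + x.2 ^ 2 := by positivity
  have hs := Real.sqrt_pos.2 h
  -- The derivative in direction `v` is computed as that of a curve along the line `x + t v`.
  have h1 : HasDerivAt (fun t : ℝ => x.1 + t * v.1) v.1 0 := by
    simpa using ((hasDerivAt_id (0 : ℝ)).mul_const v.1).const_add x.1
  have h2 : HasDerivAt (fun t : ℝ => x.2 + t * v.2) v.2 0 := by
    simpa using ((hasDerivAt_id (0 : ℝ)).mul_const v.2).const_add x.2
  have hc : HasDerivAt (fun t : ℝ => (x.1 + t * v.1, x.2 + t * v.2)) v 0 := h1.prodMk h2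
  have hc0 : ((x.1 + 0 * v.1, x.2 + 0 * v.2) : ℝ × ℝ) = x := by simp
  have hd : HasFDerivAt toPoincare (fderiv ℝ toPoincare x) (x.1 + 0 * v.1, x.2 + 0 * v.2) := by
    rw [hc0]
    exact (differentiableAt_toPoincare x).hasFDerivAt
  have hN : HasDerivAt (fun t : ℝ => √(1 + (x.1 + t * v.1) ^ 2 + (x.2 + t * v.2) ^ 2))
      ((x.1 * v.1 + x.2 * v.2) / √(1 + x.1 ^ 2 + x.2 ^ 2)) 0 := by
    have := (((h1.pow 2).const_add 1).add (h2.pow 2)).sqrt (by simp; positivity)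
    refine this.congr_deriv ?_
    simp
    field_simp
  have e1 : HasDerivAt (fun t : ℝ => toPoincare (x.1 + t * v.1, x.2 + t * v.2)) _ 0 :=
    (h1.div hN (by simpa using hs.ne')).prodMk (h2.div hN (by simpa using hs.ne'))
  have e2 : HasDerivAt (fun t : ℝ => toPoincare (x.1 + t * v.1, x.2 + t * v.2))
      (fderiv ℝ toPoincare x v) 0 := 
    HasFDerivAt.comp_hasDerivAt (f := fun t : ℝ => (x.1 + t * v.1, x.2 + t * v.2)) 0 hd hc
  rw [e2.unique e1]
  ext <;> simp <;> field_simp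

theorem fderiv_toPoincare_field (x : ℝ × ℝ) :
    √(1 - (toPoincare x).1 ^ 2 - (toPoincare x).2 ^ 2) • fderiv ℝ toPoincare x (field x)
        = poincareField (toPoincare x) := by
  have h : 0 < 1 + x.1 ^ 2 + x.2 ^ 2 := by positivity
  have hs := Real.sqrt_pos.2 h
  have hsq := Real.sq_sqrt h.le
  have e : √(1 - (toPoincare x).1 ^ 2 - (toPoincare x).2 ^ 2) = 1 / √(1 + x.1 ^ 2 + x.2 ^ 2) := by
    rw [one_sub_normSq_toPoincare, Real.sqrt_div zero_le_one, Real.sqrt_one]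
  have e' : 1 - (toPoincare x).1 ^ 2 - (toPoincare x).2 ^ 2 = 1 / √(1 + x.1 ^ 2 + x.2 ^ 2) ^ 2 := by
    rw [one_sub_normSq_toPoincare, hsq]
  rw [e, fderiv_toPoincare_apply, poincareField, e']
  simp only [field, toPoincare]
  generalize √(1 + x.1 ^ 2 + x.2 ^ 2) = s at *
  ext
  · simp only [Prod.smul_fst, smul_eq_mul]
    field_simp
    linear_combination (-(x.1 * (x.1 + x.2))) * hsq
  · simp only [Prod.smul_snd, smul_eq_mul]
    field_simp
    linear_combination (-(x.2 * (x.1 + x.2))) * hsq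

/-! ### Points at infinity -/

theorem poincareField_eq_zero {X : ℝ × ℝ} (hX : X ∈ atInfinity) : poincareField X = 0 := by
  have h : 1 - X.1 ^ 2 - X.2 ^ 2 = 0 := by
    have := hX.2
    linarith
  ext <;> simp [poincareField, h]

theorem sqrt_five_sq : √5 ^ 2 = (5 : ℝ) := Real.sq_sqrt (by norm_num)

theorem sqrt_five_pos : 0 < √(5 : ℝ) := Real.sqrt_pos.2 (by norm_num)

theorem inv_sqrt_five_sq : (1 / √5) ^ 2 = (1 / 5 : ℝ) := by
  rw [div_pow, sqrt_five_sq, one_pow]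

theorem inv_sqrt_five_pos : 0 < 1 / √(5 : ℝ) := by have := sqrt_five_pos; positivity

/-- On the unit circle `2 X₂² + 2 X₂ X₃ + X₃² - 1 = X₂ (X₂ + 2 X₃)`, so the arcs are cut out by two
lines through the origin; the four end points lie on these lines. -/
theorem mem_atInfinity_iff {X : ℝ × ℝ} :
    X ∈ atInfinity ↔ X.1 ^ 2 + X.2 ^ 2 = 1 ∧ 0 ≤ X.1 * (X.1 + 2 * X.2) := by
  simp only [atInfinity, poincareSpace, mem_ofPred_eq]
  constructor
  · rintro ⟨⟨h1, h2⟩, h3⟩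
    exact ⟨h3, by nlinarith⟩
  · rintro ⟨h1, h2⟩
    exact ⟨⟨by nlinarith, h1.le⟩, h1⟩

/-- On the circle with `X₂ ≥ 0`, the bound `-1/√5` on `X₃` is the half-plane bounded by the line
through P_S. In this form the condition is linear and free of `√5`. -/
theorem mem_rightArc_iff {X : ℝ × ℝ} :
    X ∈ rightArc ↔ X.1 ^ 2 + X.2 ^ 2 = 1 ∧ 0 ≤ X.1 ∧ 0 ≤ X.1 + 2 * X.2 := by
  have h5 := inv_sqrt_five_sq
  have h5' := inv_sqrt_five_pos
  simp only [rightArc, mem_ofPred_eq]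
  generalize 1 / √5 = q at *
  constructor
  · rintro ⟨h1, h2, h3⟩
    refine ⟨h1, h2, ?_⟩
    rcases le_total 0 X.2 with h | h
    · linarith
    · have : (2 * X.2) ^ 2 ≤ X.1 ^ 2 := by nlinarith
      have := abs_le_of_sq_le_sq' this h2
      linarith
  · rintro ⟨h1, h2, h3⟩
    refine ⟨h1, h2, ?_⟩
    by_contra h
    push Not at h
    nlinarith

theorem atInfinity_eq : atInfinity = rightArc ∪ leftArc := by
  ext X
  rw [mem_union, leftArc, mem_ofPred_eq, mem_rightArc_iff, mem_rightArc_iff, mem_atInfinity_iff]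
  simp only [Prod.fst_neg, Prod.snd_neg, neg_sq]
  constructor
  · rintro ⟨h1, h2⟩
    rcases mul_nonneg_iff.1 h2 with ⟨h3, h4⟩ | ⟨h3, h4⟩
    · exact Or.inl ⟨h1, h3, h4⟩
    · exact Or.inr ⟨h1, by linarith, by linarith⟩
  · rintro (⟨h1, h2, h3⟩ | ⟨h1, h2, h3⟩)
    · exact ⟨h1, mul_nonneg h2 h3⟩
    · exact ⟨h1, by nlinarith⟩

theorem disjoint_rightArc_leftArc : Disjoint rightArc leftArc := by
  rw [Set.disjoint_left]
  intro X h1 h2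
  rw [leftArc, mem_ofPred_eq] at h2
  rw [mem_rightArc_iff] at h1 h2
  simp only [Prod.fst_neg, Prod.snd_neg] at h1 h2
  have h3 : X.1 = 0 := by linarith
  have h4 : X.2 = 0 := by linarith
  have := h1.1
  rw [h3, h4] at this
  norm_num at this

theorem PS_eq : PS = (2 * (1 / √5), -(1 / √5)) := by
  rw [PS]
  ring_nf

theorem neg_PH : -PH = PHbar := by simp [PH, PHbar]

theorem neg_PS : -PS = PSbar := by simp [PS, PSbar]

theorem atInfinity_boundary :
    {X | X ∈ atInfinity ∧ 2 * X.1 ^ 2 + 2 * X.1 * X.2 + X.2 ^ 2 = 1} = {PH, PHbar, PS, PSbar} := by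
  have h5 := inv_sqrt_five_sq
  have h5' := inv_sqrt_five_pos
  ext X
  simp only [mem_ofPred_eq, mem_insert_iff, mem_singleton_iff, mem_atInfinity_iff]
  rw [← neg_PS, PS_eq, PH, PHbar, Prod.neg_mk, neg_neg]
  generalize 1 / √5 = q at *
  constructor
  · rintro ⟨⟨h1, -⟩, h3⟩
    have h4 : X.1 * (X.1 + 2 * X.2) = 0 := by linarith
    rcases mul_eq_zero.1 h4 with h | h
    · have h6 : X.2 ^ 2 = 1 := by rw [h] at h1; linarith
      rcases sq_eq_sq_iff_eq_or_eq_neg.1 (h6.trans (one_pow 2).symm) with h7 | h7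
      · left; ext; exacts [h, h7]
      · right; left; ext; exacts [h, h7]
    · have h6 : X.1 = -2 * X.2 := by linarith
      have h7 : X.2 ^ 2 = q ^ 2 := by rw [h6] at h1; linarith
      rcases sq_eq_sq_iff_eq_or_eq_neg.1 h7 with h8 | h8
      · right; right; right; ext
        · simp only; rw [h6, h8]; ring
        · exact h8
      · right; right; left; ext
        · simp only; rw [h6, h8]; ring
        · exact h8
  · rintro (h | h | h | h) <;> rw [h] <;> simp only <;> refine ⟨⟨?_, ?_⟩, ?_⟩ <;> nlinarith

theorem PH_mem_rightArc : PH ∈ rightArc := by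
  rw [mem_rightArc_iff]
  norm_num [PH]

theorem PS_mem_rightArc : PS ∈ rightArc := by
  have h5 := inv_sqrt_five_sq
  have h5' := inv_sqrt_five_pos
  rw [mem_rightArc_iff, PS_eq]
  generalize 1 / √5 = q at *
  refine ⟨?_, ?_, ?_⟩ <;> simp only <;> nlinarith

theorem PHbar_mem_leftArc : PHbar ∈ leftArc := by
  rw [leftArc, mem_ofPred_eq, ← neg_PH, neg_neg]
  exact PH_mem_rightArc

theorem PSbar_mem_leftArc : PSbar ∈ leftArc := by
  rw [leftArc, mem_ofPred_eq, ← neg_PS, neg_neg]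
  exact PS_mem_rightArc

/-! ### Stability of points at infinity -/

/-- Continuity argument: before the first time with `d ≥ ρ` one has `d ≤ η`, which persists at that
time by continuity and contradicts `η < ρ`. -/
theorem forall_le_of_bootstrap {T ρ η : ℝ} {d : ℝ → ℝ} (hd : ContinuousOn d (Icc 0 T))
    (hη : η < ρ) (step : ∀ t ∈ Icc 0 T, (∀ s ∈ Icc 0 t, d s < ρ) → d t ≤ η) (h0 : d 0 < ρ) :
    ∀ t ∈ Icc 0 T, d t ≤ η := by
  suffices h : ∀ t ∈ Icc 0 T, d t < ρ from
    fun t ht => step t ht fun s hs => h s ⟨hs.1, hs.2.trans ht.2⟩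
  by_contra! hcon
  set B := {t | t ∈ Icc 0 T ∧ ρ ≤ d t} with hB
  have hBc : IsClosed B := by
    have : B = Icc 0 T ∩ d ⁻¹' Ici ρ := rfl
    rw [this]
    exact hd.preimage_isClosed_of_isClosed isClosed_Icc isClosed_Ici
  have hBn : B.Nonempty := by
    obtain ⟨t, ht, h⟩ := hcon
    exact ⟨t, ht, h⟩
  have hBb : BddBelow B := ⟨0, fun t ht => ht.1.1⟩
  obtain ⟨⟨hm0, hmT⟩, hm⟩ := hBc.csInf_mem hBn hBb
  set m := sInf B
  have hlt : ∀ s ∈ Ico 0 m, d s < ρ := by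
    intro s hs
    by_contra! h
    exact absurd (csInf_le hBb (⟨⟨hs.1, hs.2.le.trans hmT⟩, h⟩ : s ∈ B)) (not_le.2 hs.2)
  rcases hm0.eq_or_lt with h | h
  · rw [← h] at hm
    linarith
  · have h1 : ∀ s ∈ Ico 0 m, d s ≤ η := fun s hs => step s ⟨hs.1, hs.2.le.trans hmT⟩
      fun u hu => hlt u ⟨hu.1, hu.2.trans_lt hs.2⟩
    have h2 : ContinuousWithinAt d (Ico 0 m) m :=
      (hd m ⟨hm0, hmT⟩).mono fun s hs => ⟨hs.1, hs.2.le.trans hmT⟩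
    have h3 : m ∈ closure (Ico 0 m) := by
      rw [closure_Ico h.ne]
      exact right_mem_Icc.2 hm0
    have : (𝓝[Ico 0 m] m).NeBot := mem_closure_iff_nhdsWithin_neBot.1 h3
    have h4 : d m ≤ η := le_of_tendsto h2 (eventually_mem_nhdsWithin.mono h1)
    linarith

/-- Stability from a local coordinate system in which all motion is upwards and bounded by `P`. -/
theorem isStable_of_monotone {v : ℝ × ℝ → ℝ × ℝ} {S : Set (ℝ × ℝ)} {P : ℝ × ℝ} {ρ : ℝ}
    (hρ : 0 < ρ) (F G : ℝ × ℝ → ℝ × ℝ) (hF : ContinuousAt F P) (hG : ContinuousAt G (F P))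
    (hP : G (F P) = P) (hGF : ∀ X ∈ S, dist X P < ρ → G (F X) = X)
    (hle : ∀ X ∈ S, dist X P < ρ → F X ≤ F P)
    (hmono : ∀ X ∈ S, dist X P < ρ → ∃ F' : ℝ × ℝ →L[ℝ] ℝ × ℝ,
      HasFDerivAt F F' X ∧ 0 ≤ F' (v X)) : IsStable v S P := by
  intro ε hε
  -- Half the minimum lies strictly below both `ε`, the goal, and `ρ`, the radius where the
  -- coordinates are valid.
  have hη : 0 < min ε ρ / 2 := by positivity
  obtain ⟨η, hη0, h1⟩ := Metric.continuousAt_iff.1 hG _ hη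
  obtain ⟨δ, hδ0, h2⟩ := Metric.continuousAt_iff.1 hF _ hη0
  refine ⟨min δ ρ, by positivity, fun T γ hγ h0 => ?_⟩
  have hcont : ContinuousOn γ (Icc 0 T) := fun t ht => (hγ t ht).1.continuousWithinAt
  have key := forall_le_of_bootstrap (d := fun t => dist (γ t) P) (ρ := ρ) (η := min ε ρ / 2)
    (continuous_dist.comp_continuousOn (hcont.prodMk continuousOn_const)) (by have := min_le_right ε ρ; linarith) ?_
    (h0.trans_le (min_le_right _ _))
  · intro t ht
    have := key t ht
    have := min_le_left ε ρ
    linarith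
  · intro t ht hs
    -- Along the motion each component of `F` stays between its initial value and its value at `P`,
    -- so `F (γ t)` remains near `F P`, and `G` carries this back.
    have hsub : Icc 0 t ⊆ Icc 0 T := Icc_subset_Icc le_rfl ht.2
    have hderiv : ∀ s ∈ Icc 0 t, ∃ F' : ℝ × ℝ, HasDerivWithinAt (fun s => F (γ s)) F' (Icc 0 t) s ∧
        0 ≤ F' := by
      intro s hs'
      obtain ⟨F', hF', hpos⟩ := hmono _ (hγ s (hsub hs')).2 (hs s hs')
      exact ⟨_, hF'.comp_hasDerivWithinAt s ((hγ s (hsub hs')).1.mono hsub), hpos⟩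
    have hm1 : MonotoneOn (fun s => (F (γ s)).1) (Icc 0 t) := by
      choose! F' hF' hpos using hderiv
      refine monotoneOn_of_hasDerivWithinAt_nonneg (convex_Icc 0 t) (f' := fun s => (F' s).1)
        (fun s hs => (hasDerivWithinAt_fst (hF' s hs)).continuousWithinAt)
        (fun s hs => (hasDerivWithinAt_fst (hF' s (interior_subset hs))).mono interior_subset)
        (fun s hs => (hpos s (interior_subset hs)).1)
    have hm2 : MonotoneOn (fun s => (F (γ s)).2) (Icc 0 t) := by
      choose! F' hF' hpos using hderiv
      refine monotoneOn_of_hasDerivWithinAt_nonneg (convex_Icc 0 t) (f' := fun s => (F' s).2)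
        (fun s hs => (hasDerivWithinAt_snd (hF' s hs)).continuousWithinAt)
        (fun s hs => (hasDerivWithinAt_snd (hF' s (interior_subset hs))).mono interior_subset)
        (fun s hs => (hpos s (interior_subset hs)).2)
    have hl : (0 : ℝ) ∈ Icc 0 t := left_mem_Icc.2 ht.1
    have hr : t ∈ Icc 0 t := right_mem_Icc.2 ht.1
    have hb1 : (F (γ 0)).1 ≤ (F (γ t)).1 := hm1 hl hr ht.1
    have hb2 : (F (γ 0)).2 ≤ (F (γ t)).2 := hm2 hl hr ht.1
    have hb3 := hle _ (hγ t ht).2 (hs t hr)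
    have hd0 := h2 (h0.trans_le (min_le_left _ _))
    have hd : dist (F (γ t)) (F P) < η := by
      rw [Prod.dist_eq, max_lt_iff, Real.dist_eq, Real.dist_eq] at hd0 ⊢
      have h5 := abs_lt.1 hd0.1
      have h6 := abs_lt.1 hd0.2
      have h7 := hb3.1
      have h8 := hb3.2
      exact ⟨abs_lt.2 ⟨by linarith, by linarith⟩, abs_lt.2 ⟨by linarith, by linarith⟩⟩
    have := h1 hd
    rw [hP, hGF _ (hγ t ht).2 (hs t hr)] at this
    exact this.le

/-- This is the difference of the two defining inequalities, valid inside the disc too. It puts the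
space on one side of each of the four end points. -/
theorem fst_mul_nonneg_of_mem_poincareSpace {X : ℝ × ℝ} (hX : X ∈ poincareSpace) :
    0 ≤ X.1 * (X.1 + 2 * X.2) := by
  have h1 := hX.1
  have h2 := hX.2
  nlinarith

theorem exists_hasFDerivAt_div {f g : ℝ × ℝ → ℝ} {f' g' : ℝ × ℝ →L[ℝ] ℝ} {X : ℝ × ℝ}
    (hf : HasFDerivAt f f' X) (hg : HasFDerivAt g g' X) (h0 : g X ≠ 0) :
    ∃ L : ℝ × ℝ →L[ℝ] ℝ, HasFDerivAt (fun x => f x / g x) L X ∧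
      ∀ v, L v = (f' v * g X - f X * g' v) / g X ^ 2 := by
  have e : (fun x => f x / g x) = f * (Inv.inv ∘ g) := by
    ext x
    simp [div_eq_mul_inv]
  refine ⟨_, by rw [e]; exact hf.mul ((hasDerivAt_inv h0).comp_hasFDerivAt X hg), fun v => ?_⟩
  simp
  field_simp
  ring

/-- The coordinates are the squared radius, which is at most 1, and minus the slope `X₂ / X₃`, which
is at most 0 because the arc ends at this point. Near the point both increase along the flow. -/
theorem isStable_PHbar : IsStable poincareField poincareSpace PHbar := by
  have hball : ∀ X ∈ poincareSpace, dist X PHbar < 1 / 4 →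
      X.2 < -(3 / 4) ∧ X.1 ≤ 0 ∧ X.1 ^ 2 + X.2 ^ 2 ≤ 1 := by
    intro X hX hd
    rw [Prod.dist_eq, max_lt_iff, Real.dist_eq, Real.dist_eq] at hd
    have h1 := abs_lt.1 hd.1
    have h2 := abs_lt.1 hd.2
    have h3 := fst_mul_nonneg_of_mem_poincareSpace hX
    simp only [PHbar] at h1 h2
    refine ⟨by linarith, ?_, hX.2⟩
    by_contra h
    push Not at h
    nlinarith
  -- The second map recovers the point from squared radius and slope; the sign of the root is fixed
  -- by `X₃ < 0`.
  refine isStable_of_monotone (ρ := 1 / 4) (by norm_num)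
    (fun X => (X.1 ^ 2 + X.2 ^ 2, -(X.1 / X.2)))
    (fun u => (u.2 * (√u.1 / √(1 + u.2 ^ 2)), -(√u.1 / √(1 + u.2 ^ 2)))) ?_ ?_ ?_ ?_ ?_ ?_
  · have : PHbar.2 ≠ 0 := by norm_num [PHbar]
    fun_prop (disch := assumption)
  · have : √(1 + (-(PHbar.1 / PHbar.2)) ^ 2) ≠ 0 := by positivity
    fun_prop (disch := assumption)
  · norm_num [PHbar]
  · intro X hX hd
    obtain ⟨h1, h2, h3⟩ := hball X hX hd
    have hY : X.2 ≠ 0 := by linarith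
    have e : √(X.1 ^ 2 + X.2 ^ 2) / √(1 + (-(X.1 / X.2)) ^ 2) = -X.2 := by
      rw [← Real.sqrt_div (by positivity), ← Real.sqrt_sq (show 0 ≤ -X.2 by linarith)]
      congr 1
      field_simp
      ring
    simp only [e]
    ext
    · field_simp
    · simp
  · intro X hX hd
    obtain ⟨h1, h2, h3⟩ := hball X hX hd
    refine ⟨by simpa [PHbar] using h3, ?_⟩
    have : 0 ≤ X.1 / X.2 := div_nonneg_of_nonpos h2 (by linarith)
    simpa [PHbar] using this
  · intro X hX hd
    obtain ⟨h1, h2, h3⟩ := hball X hX hd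
    have hY : X.2 ≠ 0 := by linarith
    have d1 : HasFDerivAt (fun x : ℝ × ℝ => x.1) (ContinuousLinearMap.fst ℝ ℝ ℝ) X := hasFDerivAt_fst
    have d2 : HasFDerivAt (fun x : ℝ × ℝ => x.2) (ContinuousLinearMap.snd ℝ ℝ ℝ) X := hasFDerivAt_snd
    obtain ⟨L, d3, hL⟩ := exists_hasFDerivAt_div d1 d2 hY
    refine ⟨_, ((d1.pow 2).add (d2.pow 2)).prodMk d3.neg, ?_, ?_⟩
    · have e : 0 ≤ 2 * (1 - X.1 ^ 2 - X.2 ^ 2) *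
          (X.1 * (1 - 2 * (X.1 ^ 2 + X.2 ^ 2)) - X.2 * (X.1 ^ 2 + X.2 ^ 2)) := by
        refine mul_nonneg (by linarith) ?_
        have : 1 - 2 * (X.1 ^ 2 + X.2 ^ 2) ≤ 0 := by nlinarith
        have := mul_nonneg_of_nonpos_of_nonpos h2 this
        have : 0 ≤ -X.2 * (X.1 ^ 2 + X.2 ^ 2) := mul_nonneg (by linarith) (by positivity)
        linarith
      refine e.trans (le_of_eq ?_)
      simp [poincareField]
      ring
    · have e : 0 ≤ (1 - X.1 ^ 2 - X.2 ^ 2) / -X.2 := div_nonneg (by linarith) (by linarith)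
      refine e.trans (le_of_eq ?_)
      simp [poincareField, hL]
      field_simp
      ring

/-- The same argument with the slope `X₃ / X₂`, since `X₂` is the component that stays away from 0
in the ball used and the boundary line `X₂ + 2 X₃ = 0` bounds this slope. -/
theorem isStable_PSbar : IsStable poincareField poincareSpace PSbar := by
  have hPS : PSbar = (-(2 * (1 / √5)), 1 / √5) := by rw [PSbar]; ring_nf
  have h5 := inv_sqrt_five_sq
  have h5' := inv_sqrt_five_pos
  rw [hPS]
  generalize 1 / √5 = q at *
  have hq1 : 0.44 < q := by nlinarith
  have hq2 : q < 0.45 := by nlinarith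
  have hball : ∀ X ∈ poincareSpace, dist X (-(2 * q), q) < 1 / 10 →
      X.1 < -(3 / 4) ∧ 1 / 3 < X.2 ∧ X.1 + 2 * X.2 ≤ 0 ∧ X.1 ^ 2 + X.2 ^ 2 ≤ 1 := by
    intro X hX hd
    rw [Prod.dist_eq, max_lt_iff, Real.dist_eq, Real.dist_eq] at hd
    have h1 := abs_lt.1 hd.1
    have h2 := abs_lt.1 hd.2
    have h3 := fst_mul_nonneg_of_mem_poincareSpace hX
    simp only at h1 h2
    refine ⟨by linarith, by linarith, ?_, hX.2⟩
    by_contra h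
    push Not at h
    nlinarith
  refine isStable_of_monotone (ρ := 1 / 10) (by norm_num)
    (fun X => (X.1 ^ 2 + X.2 ^ 2, -(X.2 / X.1)))
    (fun u => (-(√u.1 / √(1 + u.2 ^ 2)), u.2 * (√u.1 / √(1 + u.2 ^ 2)))) ?_ ?_ ?_ ?_ ?_ ?_
  · have : ((-(2 * q), q) : ℝ × ℝ).1 ≠ 0 := by simp; linarith
    fun_prop (disch := assumption)
  · have : √(1 + (-(((-(2 * q), q) : ℝ × ℝ).2 / ((-(2 * q), q) : ℝ × ℝ).1)) ^ 2) ≠ 0 := by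
      positivity
    fun_prop (disch := assumption)
  · have e : √((-(2 * q)) ^ 2 + q ^ 2) / √(1 + (-(q / -(2 * q))) ^ 2) = 2 * q := by
      rw [← Real.sqrt_div (by positivity), Real.sqrt_eq_iff_mul_self_eq (by positivity)
        (by linarith)]
      field_simp
    simp only [e]
    ext
    · simp
    · field_simp
  · intro X hX hd
    obtain ⟨h1, h2, h3, h4⟩ := hball X hX hd
    have hx : X.1 ≠ 0 := by linarith
    have e : √(X.1 ^ 2 + X.2 ^ 2) / √(1 + (-(X.2 / X.1)) ^ 2) = -X.1 := by
      rw [← Real.sqrt_div (by positivity), ← Real.sqrt_sq (show 0 ≤ -X.1 by linarith)]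
      congr 1
      field_simp
    simp only [e]
    ext
    · simp
    · field_simp
  · intro X hX hd
    obtain ⟨h1, h2, h3, h4⟩ := hball X hX hd
    refine ⟨?_, ?_⟩
    · simp only
      nlinarith
    · have e : -(q / -(2 * q)) = 1 / 2 := by field_simp
      simp only [e]
      rw [← neg_div, div_le_iff_of_neg (by linarith)]
      linarith
  · intro X hX hd
    obtain ⟨h1, h2, h3, h4⟩ := hball X hX hd
    have hx : X.1 ≠ 0 := by linarith
    have d1 : HasFDerivAt (fun x : ℝ × ℝ => x.1) (ContinuousLinearMap.fst ℝ ℝ ℝ) X := hasFDerivAt_fst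
    have d2 : HasFDerivAt (fun x : ℝ × ℝ => x.2) (ContinuousLinearMap.snd ℝ ℝ ℝ) X := hasFDerivAt_snd
    obtain ⟨L, d3, hL⟩ := exists_hasFDerivAt_div d2 d1 hx
    refine ⟨_, ((d1.pow 2).add (d2.pow 2)).prodMk d3.neg, ?_, ?_⟩
    · have e : 0 ≤ 2 * (1 - X.1 ^ 2 - X.2 ^ 2) *
          (X.1 * (1 - 2 * (X.1 ^ 2 + X.2 ^ 2)) - X.2 * (X.1 ^ 2 + X.2 ^ 2)) := by
        refine mul_nonneg (by linarith) ?_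
        -- With `R` the squared radius, the last factor is `-(X₂ + 2 X₃)(2R - 1) + X₃ (3R - 2)`, and
        -- both summands are nonnegative once `R ≥ 2/3`.
        have hR : 2 / 3 ≤ X.1 ^ 2 + X.2 ^ 2 := by nlinarith
        have := mul_nonneg (show 0 ≤ -(X.1 + 2 * X.2) by linarith)
          (show 0 ≤ 2 * (X.1 ^ 2 + X.2 ^ 2) - 1 by linarith)
        have := mul_nonneg (show 0 ≤ X.2 by linarith)
          (show 0 ≤ 3 * (X.1 ^ 2 + X.2 ^ 2) - 2 by linarith)
        nlinarith
      refine e.trans (le_of_eq ?_)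
      simp [poincareField]
      ring
    · have e : 0 ≤ (1 - X.1 ^ 2 - X.2 ^ 2) * X.2 / X.1 ^ 2 :=
        div_nonneg (mul_nonneg (by linarith) (by linarith)) (by positivity)
      refine e.trans (le_of_eq ?_)
      simp [poincareField, hL]
      field_simp
      ring

/-! ### Orbits and their end points at infinity -/

/-- The point at infinity at which `orbit c` starts. -/
def endpoint (c : ℝ) : ℝ × ℝ := ((1 - c) / √((1 - c) ^ 2 + c ^ 2), c / √((1 - c) ^ 2 + c ^ 2))

theorem endpoint_normSq_pos (c : ℝ) : 0 < (1 - c) ^ 2 + c ^ 2 := by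
  nlinarith [sq_nonneg (2 * c - 1)]

theorem endpoint_normSq (c : ℝ) : (endpoint c).1 ^ 2 + (endpoint c).2 ^ 2 = 1 := by
  have h := endpoint_normSq_pos c
  rw [endpoint, div_pow, div_pow, Real.sq_sqrt h.le]
  field_simp

theorem endpoint_mem_rightArc {c : ℝ} (hc : |c| ≤ 1) : endpoint c ∈ rightArc := by
  have h := Real.sqrt_pos.2 (endpoint_normSq_pos c)
  have h1 := abs_le.1 hc
  rw [mem_rightArc_iff]
  refine ⟨endpoint_normSq c, ?_, ?_⟩
  · exact div_nonneg (by linarith) h.le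
  · rw [endpoint, show (1 - c) / √((1 - c) ^ 2 + c ^ 2) + 2 * (c / √((1 - c) ^ 2 + c ^ 2)) =
      (1 + c) / √((1 - c) ^ 2 + c ^ 2) by ring]
    exact div_nonneg (by linarith) h.le

theorem exists_endpoint {Q : ℝ × ℝ} (hQ : Q ∈ rightArc) : ∃ c, |c| ≤ 1 ∧ Q = endpoint c := by
  obtain ⟨h1, h2, h3⟩ := mem_rightArc_iff.1 hQ
  have hw : 0 < Q.1 + Q.2 := by
    by_contra h
    push Not at h
    have h4 : Q.1 = 0 := by linarith
    have h5 : Q.2 = 0 := by linarith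
    rw [h4, h5] at h1
    norm_num at h1
  -- The end point has the direction of `(1 - c, c)`, whose components sum to 1, so `c` is the share
  -- of the second component.
  refine ⟨Q.2 / (Q.1 + Q.2), ?_, ?_⟩
  · rw [abs_div, abs_of_pos hw, div_le_one hw, abs_le]
    constructor <;> linarith
  · have e : √((1 - Q.2 / (Q.1 + Q.2)) ^ 2 + (Q.2 / (Q.1 + Q.2)) ^ 2) = 1 / (Q.1 + Q.2) := by
      rw [← Real.sqrt_sq (show 0 ≤ 1 / (Q.1 + Q.2) by positivity)]
      congr 1
      field_simp
      linear_combination h1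
    rw [endpoint, e]
    ext <;> field_simp
    ring

theorem endpoint_injective : Function.Injective endpoint := by
  intro c c' h
  have h0 := Real.sqrt_pos.2 (endpoint_normSq_pos c)
  have h0' := Real.sqrt_pos.2 (endpoint_normSq_pos c')
  have h1 := congrArg Prod.fst h
  have h2 := congrArg Prod.snd h
  simp only [endpoint] at h1 h2
  have h3 : 1 / √((1 - c) ^ 2 + c ^ 2) = 1 / √((1 - c') ^ 2 + c' ^ 2) := by
    have e : ∀ x s : ℝ, 1 / s = (1 - x) / s + x / s := fun x s => by ring
    rw [e c, e c', h1, h2]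
  have h4 : √((1 - c) ^ 2 + c ^ 2) = √((1 - c') ^ 2 + c' ^ 2) := by
    field_simp at h3
    exact h3.symm
  rw [h4] at h2
  exact (div_left_inj' h0'.ne').1 h2

theorem endpoint_one : endpoint 1 = PH := by
  norm_num [endpoint, PH]

theorem endpoint_neg_one : endpoint (-1) = PS := by
  norm_num [endpoint, PS, neg_div]

/-- The pole `1 / sinh s` cancels in the normalized vector, which leaves `(cosh s - c, c)` divided
by a function that is continuous and nonzero at `s = 0`. -/
theorem tendsto_toPoincare_orbit (c : ℝ) :
    Tendsto (fun s => toPoincare (orbit c s)) (𝓝[>] 0) (𝓝 (endpoint c)) := by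
  set D : ℝ → ℝ := fun s => √(sinh s ^ 2 + (cosh s - c) ^ 2 + c ^ 2) with hD
  have hD0 : D 0 = √((1 - c) ^ 2 + c ^ 2) := by simp [hD]
  have hDpos : D 0 ≠ 0 := by
    rw [hD0]
    exact (Real.sqrt_pos.2 (endpoint_normSq_pos c)).ne'
  have hcont : ContinuousAt (fun s => ((cosh s - c) / D s, c / D s)) 0 := by
    have h1 : ContinuousAt D 0 := by
      simp only [hD]
      exact Continuous.continuousAt (by fun_prop)
    exact ContinuousAt.prodMk (((continuous_cosh.sub continuous_const).continuousAt).div h1 hDpos)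
      (continuousAt_const.div h1 hDpos)
  have h2 : endpoint c = (fun s => ((cosh s - c) / D s, c / D s)) 0 := by
    simp only [hD0, cosh_zero]
    rfl
  rw [h2]
  refine (hcont.tendsto.mono_left nhdsWithin_le_nhds).congr' ?_
  filter_upwards [self_mem_nhdsWithin] with s hs
  have hsh : 0 < sinh s := Real.sinh_pos_iff.2 hs
  have e : √(1 + ((cosh s - c) / sinh s) ^ 2 + (c / sinh s) ^ 2) = D s / sinh s := by
    have : 0 ≤ D s / sinh s := div_nonneg (Real.sqrt_nonneg _) hsh.le
    rw [← Real.sqrt_sq this]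
    congr 1
    rw [div_pow, div_pow, div_pow, hD, Real.sq_sqrt (by positivity)]
    field_simp
  simp only [toPoincare, orbit, e]
  ext <;> field_simp

theorem tendsto_orbit_atTop (c : ℝ) : Tendsto (orbit c) atTop (𝓝 PM) := by
  have hs : Tendsto sinh atTop atTop := by
    refine tendsto_atTop_mono' atTop ?_ tendsto_id
    filter_upwards [eventually_ge_atTop 0] with s hs
    exact self_le_sinh_iff.2 hs
  have h1 : Tendsto (fun s => c / sinh s) atTop (𝓝 0) := hs.const_div_atTop c
  have h3 : Tendsto (fun s => exp (-s)) atTop (𝓝 0) :=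
    tendsto_exp_atBot.comp tendsto_neg_atTop_atBot
  have h2 : Tendsto (fun s => 1 + exp (-s) / sinh s - c / sinh s) atTop (𝓝 1) := by
    have := ((h3.div_atTop hs).const_add 1).sub h1
    simpa using this
  refine Tendsto.prodMk_nhds (h2.congr' ?_) h1
  filter_upwards [eventually_gt_atTop 0] with s hs
  have hsh : 0 < sinh s := Real.sinh_pos_iff.2 hs
  rw [← cosh_sub_sinh]
  field_simp
  ring

theorem goesToPM_orbit {γ : ℝ → ℝ × ℝ} {a c : ℝ} (hc : |c| ≤ 1)
    (hγ : ∀ ξ ∈ Ioi a, γ ξ = orbit c (ξ - a)) : GoesToPM γ (Ioi a) (endpoint c) := by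
  refine ⟨fun ξ hξ => ?_, a, rfl, ?_, ?_⟩
  · rw [hγ ξ hξ]
    exact orbit_fst_pos hc (sub_pos.2 (mem_Ioi.1 hξ))
  · have h : Tendsto (fun ξ : ℝ => ξ - a) (𝓝[>] a) (𝓝[>] 0) := by
      refine tendsto_nhdsWithin_iff.2 ⟨?_, ?_⟩
      · have : Tendsto (fun ξ : ℝ => ξ - a) (𝓝 a) (𝓝 (a - a)) := tendsto_id.sub_const a
        rw [sub_self] at this
        exact this.mono_left nhdsWithin_le_nhds
      · filter_upwards [self_mem_nhdsWithin] with ξ hξ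
        exact mem_Ioi.2 (sub_pos.2 (mem_Ioi.1 hξ))
    refine ((tendsto_toPoincare_orbit c).comp h).congr' ?_
    filter_upwards [self_mem_nhdsWithin] with ξ hξ
    simp only [Function.comp, hγ ξ hξ]
  · refine ((tendsto_orbit_atTop c).comp (tendsto_atTop_add_const_right atTop (-a)
      tendsto_id)).congr' ?_
    filter_upwards [eventually_gt_atTop a] with ξ hξ
    simp [hγ ξ hξ, sub_eq_add_neg]

theorem IsMaximalSolution.exists_orbit_of_goesToPM {γ : ℝ → ℝ × ℝ} {J : Set ℝ} {Q : ℝ × ℝ}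
    (h : IsMaximalSolution γ J) (hQ : GoesToPM γ J Q) :
    ∃ a c, |c| ≤ 1 ∧ J = Ioi a ∧ (∀ ξ ∈ Ioi a, γ ξ = orbit c (ξ - a)) ∧ Q = endpoint c := by
  obtain ⟨-, a, hJ, hlim, -⟩ := hQ
  have hne : J ≠ univ := fun h => by
    have : a ∈ Ioi a := by rw [← hJ, h]; exact mem_univ a
    exact lt_irrefl a this
  rcases h.classification with ⟨h1, -⟩ | ⟨h1, -⟩ | ⟨a', c, hc, h1, h2⟩ | ⟨b, c, hc, h1, h2⟩
  · exact absurd h1 hne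
  · exact absurd h1 hne
  · have ha : a' = a := Ioi_injective (h1.symm.trans hJ)
    subst ha
    subst h1
    obtain ⟨-, a, hJ, hlim', -⟩ := goesToPM_orbit hc h2
    have ha : a' = a := Ioi_injective hJ
    subst ha
    exact ⟨a', c, hc, rfl, h2, tendsto_nhds_unique hlim hlim'⟩
  · have h3 : max a b + 1 ∈ Iio b := by
      rw [← h1, hJ]
      exact lt_of_le_of_lt (le_max_left a b) (lt_add_one _)
    have h4 : max a b + 1 < b := h3
    have := le_max_right a b
    linarith

theorem ComesFromPMbar.reflect {γ : ℝ → ℝ × ℝ} {J : Set ℝ} {Q : ℝ × ℝ}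
    (h : ComesFromPMbar γ J Q) : GoesToPM (reflection γ) (-J) (-Q) := by
  obtain ⟨h1, b, rfl, h3, h4⟩ := h
  refine ⟨fun ξ hξ => ?_, -b, by simp, ?_, ?_⟩
  · have := h1 (-ξ) hξ
    simpa [reflection] using this
  · have : Tendsto (fun ξ : ℝ => -ξ) (𝓝[>] (-b)) (𝓝[<] b) := by
      simpa using tendsto_neg_nhdsGT (a := -b)
    simpa [reflection, toPoincare_neg, Function.comp_def] using (h4.comp this).neg
  · rw [← neg_PMbar]
    exact (h3.comp tendsto_neg_atTop_atBot).neg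

theorem GoesToPM.reflect {γ : ℝ → ℝ × ℝ} {J : Set ℝ} {Q : ℝ × ℝ}
    (h : GoesToPM γ J Q) : ComesFromPMbar (reflection γ) (-J) (-Q) := by
  obtain ⟨h1, a, rfl, h3, h4⟩ := h
  refine ⟨fun ξ hξ => ?_, -a, by simp, ?_, ?_⟩
  · have := h1 (-ξ) hξ
    simpa [reflection] using this
  · rw [← neg_PM]
    exact (h4.comp tendsto_neg_atBot_atTop).neg
  · have : Tendsto (fun ξ : ℝ => -ξ) (𝓝[<] (-a)) (𝓝[>] a) := by
      simpa using tendsto_neg_nhdsLT (a := -a)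
    simpa [reflection, toPoincare_neg, Function.comp_def] using (h3.comp this).neg

theorem IsMaximalSolution.trichotomy {γ : ℝ → ℝ × ℝ} {J : Set ℝ} (h : IsMaximalSolution γ J) :
    (J = univ ∧ ∀ ξ, γ ξ = PM) ∨ (J = univ ∧ ∀ ξ, γ ξ = PMbar) ∨
      (∃ Q ∈ rightArc, GoesToPM γ J Q) ∨ (∃ Q ∈ leftArc, ComesFromPMbar γ J Q) := by
  rcases h.classification with h1 | h1 | ⟨a, c, hc, h1, h2⟩ | ⟨b, c, hc, h1, h2⟩
  · exact Or.inl h1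
  · exact Or.inr (Or.inl h1)
  · subst h1
    exact Or.inr (Or.inr (Or.inl ⟨_, endpoint_mem_rightArc hc, goesToPM_orbit hc h2⟩))
  · subst h1
    have h3 : GoesToPM (reflection γ) (Ioi (-b)) (endpoint c) := by
      refine goesToPM_orbit hc fun ξ hξ => ?_
      have : -ξ ∈ Iio b := mem_Iio.2 (neg_lt.1 (mem_Ioi.1 hξ))
      rw [reflection, h2 _ this, ← orbit_neg]
      ring_nf
    refine Or.inr (Or.inr (Or.inr ⟨-endpoint c, ?_, ?_⟩))
    · rw [leftArc, mem_ofPred_eq, neg_neg]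
      exact endpoint_mem_rightArc hc
    · simpa [reflection_reflection] using h3.reflect

theorem image_orbit {γ : ℝ → ℝ × ℝ} {a c : ℝ} (hγ : ∀ ξ ∈ Ioi a, γ ξ = orbit c (ξ - a)) :
    γ '' Ioi a = orbit c '' Ioi 0 := by
  ext x
  constructor
  · rintro ⟨ξ, hξ, rfl⟩
    exact ⟨ξ - a, mem_Ioi.2 (sub_pos.2 (mem_Ioi.1 hξ)), (hγ ξ hξ).symm⟩
  · rintro ⟨s, hs, rfl⟩
    have : s + a ∈ Ioi a := by simpa using hs
    exact ⟨s + a, this, by rw [hγ _ this]; simp⟩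

/-- Uniqueness concerns the image, since solutions through the same points differ by a shift of ξ;
the image depends only on `c`, and `Q` determines `c`. -/
theorem existsUnique_orbit_goesToPM {Q : ℝ × ℝ} (hQ : Q ∈ rightArc) :
    ∃! O : Set (ℝ × ℝ), ∃ γ J, IsMaximalSolution γ J ∧ GoesToPM γ J Q ∧ O = γ '' J := by
  obtain ⟨c, hc, rfl⟩ := exists_endpoint hQ
  refine ⟨orbit c '' Ioi 0, ⟨fun ξ => orbit c (ξ - 0), Ioi 0, isMaximalSolution_orbit hc 0,
    goesToPM_orbit hc fun _ _ => rfl, by simp⟩, ?_⟩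
  rintro O ⟨γ, J, h1, h2, rfl⟩
  obtain ⟨a, c', hc', rfl, h3, h4⟩ := h1.exists_orbit_of_goesToPM h2
  rw [endpoint_injective h4, image_orbit h3]

theorem reflection_image_neg (γ : ℝ → ℝ × ℝ) (J : Set ℝ) : reflection γ '' (-J) = -(γ '' J) := by
  ext x
  constructor
  · rintro ⟨ξ, hξ, rfl⟩
    exact ⟨-ξ, hξ, by simp [reflection]⟩
  · rintro ⟨ξ, hξ, h⟩
    exact ⟨-ξ, by simpa using hξ, by simp [reflection, h]⟩

theorem existsUnique_orbit_comesFromPMbar {Q : ℝ × ℝ} (hQ : Q ∈ leftArc) :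
    ∃! O : Set (ℝ × ℝ), ∃ γ J, IsMaximalSolution γ J ∧ ComesFromPMbar γ J Q ∧ O = γ '' J := by
  obtain ⟨O, ⟨γ, J, h1, h2, rfl⟩, hu⟩ := existsUnique_orbit_goesToPM hQ
  refine ⟨reflection γ '' (-J), ⟨_, _, h1.reflect, by simpa using h2.reflect, rfl⟩, ?_⟩
  rintro O ⟨γ', J', h1', h2', rfl⟩
  have := hu _ ⟨_, _, h1'.reflect, h2'.reflect, rfl⟩
  rw [reflection_image_neg] at this ⊢
  rw [← this, neg_neg]

/-! ### Instability -/

/-- Used for two changes of variable: to the time of the compactified flow, and to the area radius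
as a coordinate. -/
theorem exists_inverse {f f' : ℝ → ℝ} {J : Set ℝ} (hJ : IsOpen J) (hJc : J.OrdConnected)
    (hf : ∀ x ∈ J, HasDerivAt f (f' x) x) (hf' : ContinuousOn f' J) (hpos : ∀ x ∈ J, 0 < f' x) :
    StrictMonoOn f J ∧ IsOpen (f '' J) ∧
      ∃ g : ℝ → ℝ, ∀ x ∈ J, g (f x) = x ∧ HasDerivAt g (f' x)⁻¹ (f x) := by
  have hmono : StrictMonoOn f J := by
    refine strictMonoOn_of_hasDerivWithinAt_pos hJc.convex
      (fun x hx => (hf x hx).continuousAt.continuousWithinAt)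
      (fun x hx => (hf x (interior_subset hx)).hasDerivWithinAt)
      (fun x hx => hpos x (interior_subset hx))
  have hinv := hmono.injOn.leftInvOn_invFunOn
  have hstrict : ∀ x ∈ J, HasStrictDerivAt f (f' x) x := by
    intro x hx
    refine hasStrictDerivAt_of_hasDerivAt_of_continuousAt ?_ (hf'.continuousAt (hJ.mem_nhds hx))
    filter_upwards [hJ.mem_nhds hx] with y hy
    exact hf y hy
  refine ⟨hmono, ?_, Function.invFunOn f J, fun x hx => ⟨hinv hx, ?_⟩⟩
  · rw [isOpen_iff_mem_nhds]
    rintro _ ⟨x, hx, rfl⟩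
    rw [← (hstrict x hx).map_nhds_eq (hpos x hx).ne']
    exact image_mem_map (hJ.mem_nhds hx)
  refine ((hstrict x hx).to_local_left_inverse (hpos x hx).ne' ?_).hasDerivAt
  filter_upwards [hJ.mem_nhds hx] with y hy
  exact hinv hy

/-- The orbit that emanates from the point passes arbitrarily close to it and still reaches the
fixed point `Z 1` of the disc after finite compactified time. -/
theorem not_isStable_endpoint {c : ℝ} (hc : |c| ≤ 1) :
    ¬ IsStable poincareField poincareSpace (endpoint c) := by
  intro h
  set Z : ℝ → ℝ × ℝ := fun s => toPoincare (orbit c s) with hZ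
  have hne : Z 1 ≠ endpoint c := by
    intro h
    have h1 := one_sub_normSq_toPoincare (orbit c 1)
    have h2 := endpoint_normSq c
    rw [← h] at h2
    have : 0 < 1 / (1 + (orbit c 1).1 ^ 2 + (orbit c 1).2 ^ 2) := by positivity
    simp only [hZ] at h2
    linarith
  obtain ⟨δ, hδ, h1⟩ := h _ (dist_pos.2 hne)
  have hev : ∀ᶠ s in 𝓝[>] (0 : ℝ), dist (Z s) (endpoint c) < δ :=
    (tendsto_toPoincare_orbit c).eventually (Metric.ball_mem_nhds _ hδ)
  obtain ⟨s₀, ⟨hs₀, hs₀'⟩, hd⟩ :=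
    ((Ioo_mem_nhdsGT (zero_lt_one' ℝ)) |> fun hm => (hev.and (eventually_of_mem hm fun x hx => hx)).exists.imp
      fun s hs => And.intro hs.2 hs.1)
  -- The compactified field is the pushed-forward field divided by `N`, so its time satisfies `dτ =
  -- N ds`.
  set N : ℝ → ℝ := fun s => √(1 + (orbit c s).1 ^ 2 + (orbit c s).2 ^ 2) with hN
  have hNpos : ∀ s, 0 < N s := fun s => Real.sqrt_pos.2 (by positivity)
  have hNc : ContinuousOn N (Ioi 0) := by
    have hc : ContinuousOn (orbit c) (Ioi 0) := fun s hs =>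
      (hasDerivAt_orbit c (ne_of_gt hs)).continuousAt.continuousWithinAt
    exact (((hc.fst.pow 2).const_add 1).add (hc.snd.pow 2)).sqrt
  set τ : ℝ → ℝ := fun s => ∫ t in s₀..s, N t with hτ
  have hτd : ∀ s ∈ Ioi (0 : ℝ), HasDerivAt τ (N s) s := by
    intro s hs
    have hsub : uIcc s₀ s ⊆ Ioi 0 := ordConnected_Ioi.uIcc_subset hs₀ hs
    exact intervalIntegral.integral_hasDerivAt_right ((hNc.mono hsub).intervalIntegrable)
      (hNc.stronglyMeasurableAtFilter isOpen_Ioi s hs) (hNc.continuousAt (Ioi_mem_nhds hs))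
  obtain ⟨hmono, -, g, hg⟩ := exists_inverse isOpen_Ioi ordConnected_Ioi hτd hNc fun s _ => hNpos s
  have hτ0 : τ s₀ = 0 := by simp [hτ]
  have hτ1 : 0 < τ 1 := by
    rw [← hτ0]
    exact hmono hs₀ (mem_Ioi.2 one_pos) hs₀'
  have hsurj : ∀ t ∈ Icc 0 (τ 1), ∃ s ∈ Icc s₀ 1, τ s = t := by
    have hcont : ContinuousOn τ (Icc s₀ 1) := fun s hs =>
      (hτd s (hs₀.trans_le hs.1)).continuousAt.continuousWithinAt
    intro t ht
    rw [← hτ0] at ht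
    exact intermediate_value_Icc hs₀'.le hcont ht
  have hend := h1 (τ 1) (fun t => Z (g t)) ?_ ?_ (τ 1) ⟨hτ1.le, le_rfl⟩
  · simp only [(hg 1 (mem_Ioi.2 one_pos)).1] at hend
    exact lt_irrefl _ hend
  · intro t ht
    obtain ⟨s, hs, rfl⟩ := hsurj t ht
    have hs0 : 0 < s := hs₀.trans_le hs.1
    obtain ⟨hg1, hg2⟩ := hg s hs0
    refine ⟨HasDerivAt.hasDerivWithinAt ?_, ?_⟩
    · have h2 : HasDerivAt Z (fderiv ℝ toPoincare (orbit c s) (field (orbit c s))) s :=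
        (differentiableAt_toPoincare _).hasFDerivAt.comp_hasDerivAt s (hasDerivAt_orbit c hs0.ne')
      rw [← hg1] at h2
      have h3 := h2.scomp (τ s) hg2
      refine h3.congr_deriv ?_
      simp only [hg1]
      rw [← fderiv_toPoincare_field, one_sub_normSq_toPoincare, Real.sqrt_div zero_le_one,
        Real.sqrt_one, one_div]
    · simp only [hg1]
      exact (toPoincare_mem_iff _).2 (orbit_mem_phaseSpace hc hs0.ne')
  · rw [← hτ0]
    simp only [(hg s₀ hs₀).1]
    exact hd

theorem not_isStable_PH : ¬ IsStable poincareField poincareSpace PH := by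
  rw [← endpoint_one]
  exact not_isStable_endpoint (by simp)

theorem not_isStable_PS : ¬ IsStable poincareField poincareSpace PS := by
  rw [← endpoint_neg_one]
  exact not_isStable_endpoint (by simp)

/-! ### The spacetime of a solution -/

theorem contDiffOn_succ_of_hasDerivAt {I : Set ℝ} (hI : IsOpen I) {n : ℕ} {f f' : ℝ → ℝ}
    (hf : ∀ ρ ∈ I, HasDerivAt f (f' ρ) ρ) (hf' : ContDiffOn ℝ n f' I) :
    ContDiffOn ℝ (n + 1 : ℕ) f I := by
  push_cast
  rw [contDiffOn_succ_iff_deriv_of_isOpen hI]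
  refine ⟨fun ρ hρ => (hf ρ hρ).differentiableAt.differentiableWithinAt, by simp, ?_⟩
  exact hf'.congr fun ρ hρ => (hf ρ hρ).deriv

/-- Solutions of the reduced system, with the area radius as independent variable, solve the
field equations. -/
theorem isScalarSpacetime_of_radial {I : Set ℝ} {A B X Y V ψ : ℝ → ℝ} (hI : IsOpen I)
    (hIc : I.OrdConnected) (hIn : I.Nonempty) (hρ : ∀ ρ ∈ I, 0 < ρ) (hXpos : ∀ ρ ∈ I, 0 < X ρ)
    (hApos : ∀ ρ ∈ I, 0 < A ρ) (hB : ∀ ρ ∈ I, B ρ = X ρ ^ 2)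
    (hX : ∀ ρ ∈ I, HasDerivAt X ((1 - X ρ * (X ρ + Y ρ)) / (X ρ * ρ)) ρ)
    (hY : ∀ ρ ∈ I, HasDerivAt Y (-Y ρ * (X ρ + Y ρ) / (X ρ * ρ)) ρ)
    (hV : ∀ ρ ∈ I, HasDerivAt V (-(X ρ + Y ρ) * V ρ / (X ρ * ρ)) ρ)
    (hVsq : ∀ ρ ∈ I, V ρ ^ 2 = X ρ ^ 2 + 2 * X ρ * Y ρ - 1)
    (hA : ∀ ρ ∈ I, HasDerivAt A (2 * Y ρ / X ρ * (A ρ / ρ)) ρ)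
    (hψ : ∀ ρ ∈ I, HasDerivAt ψ (√2 * V ρ / (X ρ * ρ)) ρ) :
    IsScalarSpacetime I A (fun ρ => 1 / B ρ) id ψ := by
  have hXρ : ∀ ρ ∈ I, X ρ * ρ ≠ 0 := fun ρ h => (mul_pos (hXpos ρ h) (hρ ρ h)).ne'
  have hid : ∀ n : ℕ, ContDiffOn ℝ n (fun ρ : ℝ => ρ) I := fun n => contDiff_id.contDiffOn
  -- Bootstrap: the derivatives are rational expressions in the functions and ρ with nonzero
  -- denominators, so each order of smoothness yields the next.
  have reg : ∀ n : ℕ, ContDiffOn ℝ n X I ∧ ContDiffOn ℝ n Y I ∧ ContDiffOn ℝ n V I ∧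
      ContDiffOn ℝ n A I := by
    intro n
    induction n with
    | zero =>
      simp only [Nat.cast_zero, contDiffOn_zero]
      exact ⟨fun ρ h => (hX ρ h).continuousAt.continuousWithinAt,
        fun ρ h => (hY ρ h).continuousAt.continuousWithinAt,
        fun ρ h => (hV ρ h).continuousAt.continuousWithinAt,
        fun ρ h => (hA ρ h).continuousAt.continuousWithinAt⟩
    | succ n ih =>
      obtain ⟨h1, h2, h3, h4⟩ := ih
      refine ⟨contDiffOn_succ_of_hasDerivAt hI hX ?_, contDiffOn_succ_of_hasDerivAt hI hY ?_,
        contDiffOn_succ_of_hasDerivAt hI hV ?_, contDiffOn_succ_of_hasDerivAt hI hA ?_⟩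
      · exact (contDiffOn_const.sub (h1.mul (h1.add h2))).div (h1.mul (hid n)) hXρ
      · exact (h2.neg.mul (h1.add h2)).div (h1.mul (hid n)) hXρ
      · exact ((h1.add h2).neg.mul h3).div (h1.mul (hid n)) hXρ
      · exact ((contDiffOn_const.mul h2).div h1 fun ρ h => (hXpos ρ h).ne').mul
          (h4.div (hid n) fun ρ h => (hρ ρ h).ne')
  have hBpos : ∀ ρ ∈ I, 0 < B ρ := fun ρ h => by
    rw [hB ρ h]
    exact pow_pos (hXpos ρ h) 2
  have cA : ContDiffOn ℝ 2 A I := (reg 2).2.2.2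
  have cB : ContDiffOn ℝ 2 B I := ((reg 2).1.pow 2).congr hB
  have cH : ContDiffOn ℝ 2 (fun ρ => 1 / B ρ) I := contDiffOn_const.div cB fun ρ h => (hBpos ρ h).ne'
  have cψ : ContDiffOn ℝ 2 ψ I := contDiffOn_succ_of_hasDerivAt (n := 1) hI hψ
    ((contDiffOn_const.mul (reg 1).2.2.1).div ((reg 1).1.mul (hid 1)) hXρ)
  have hreg : ∀ p : Fin 4 → ℝ, p 1 ∈ I → sin (p 2) ≠ 0 →
      RegularAt A (fun ρ => 1 / B ρ) id p := fun p hp hs =>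
    ⟨cA.contDiffAt (hI.mem_nhds hp), cH.contDiffAt (hI.mem_nhds hp), contDiffAt_id, hApos _ hp,
      one_div_pos.2 (hBpos _ hp), hρ _ hp, hs⟩
  have hsqrt : ∀ ρ ∈ I, √(1 / B ρ) = 1 / X ρ := fun ρ h => by
    rw [hB ρ h, ← Real.sqrt_sq (one_div_pos.2 (hXpos ρ h)).le, div_pow, one_pow]
  have ex₂ : ∀ ρ ∈ I, x₂ (fun ρ => 1 / B ρ) id ρ = X ρ := fun ρ h => by
    have := hXpos ρ h
    rw [x₂_eq (hρ ρ h), hsqrt ρ h, deriv_id]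
    field_simp
  have ex₃ : ∀ ρ ∈ I, x₃ A (fun ρ => 1 / B ρ) id ρ = Y ρ := fun ρ h => by
    have h1 := hXpos ρ h
    have h2 := hApos ρ h
    have h3 := hρ ρ h
    rw [x₃_eq (hρ ρ h), hsqrt ρ h, (hA ρ h).deriv, id]
    field_simp
  have hnd : ∀ f : ℝ → ℝ, ∀ f' ρ : ℝ, ρ ∈ I → HasDerivAt f (f' / (X ρ * ρ)) ρ →
      normDeriv (fun ρ => 1 / B ρ) id f ρ = f' := fun f f' ρ h hf => by
    have h1 := hXpos ρ h
    have h3 := hρ ρ h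
    rw [normDeriv_eq (hρ ρ h), hsqrt ρ h, hf.deriv, id]
    field_simp
  have hev : ∀ {f g : ℝ → ℝ}, (∀ ρ ∈ I, f ρ = g ρ) → ∀ ρ ∈ I, f =ᶠ[𝓝 ρ] g := fun h ρ hρ => by
    filter_upwards [hI.mem_nhds hρ] with x hx
    exact h x hx
  refine ⟨hI, hIc, hIn, cA, cH, contDiff_id.contDiffOn, cψ,
    fun ρ h => ⟨hApos ρ h, one_div_pos.2 (hBpos ρ h), hρ ρ h⟩, fun p hp hs => ?_, fun p hp hs => ?_⟩
  · rw [einstein_eq_iff (hreg p hp hs), ex₂ _ hp, ex₃ _ hp,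
      hnd _ _ _ hp ((hX _ hp).congr_of_eventuallyEq (hev ex₂ _ hp)),
      hnd _ _ _ hp ((hY _ hp).congr_of_eventuallyEq (hev ex₃ _ hp))]
    refine ⟨rfl, ?_⟩
    have h1 := hXpos _ hp
    have h2 := hρ _ hp
    have h3 : √2 ^ 2 = (2 : ℝ) := Real.sq_sqrt (by norm_num)
    rw [y₁_sq_eq (r := id) (H := fun ρ => 1 / B ρ) h2 (one_div_pos.2 (hBpos _ hp)), ← hVsq _ hp, (hψ _ hp).deriv, hB _ hp, id]
    field_simp
    rw [h3]
    ring
  · have e : ∀ ρ ∈ I, normDeriv (fun ρ => 1 / B ρ) id ψ ρ = √2 * V ρ :=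
      fun ρ h => hnd _ _ _ h (hψ ρ h)
    rw [wave_eq_iff (hreg p hp hs) (cψ.contDiffAt (hI.mem_nhds hp)), ex₂ _ hp, ex₃ _ hp, e _ hp]
    refine hnd _ _ _ hp ((((hV _ hp).const_mul √2).congr_deriv ?_).congr_of_eventuallyEq
      (hev e _ hp))
    ring

/-- The same metric is described: `x₂²` and `x₃ / x₂` are even in `x`, and the sign of `r'` changes
with the direction of ξ. -/
theorem Describes.reflect {γ : ℝ → ℝ × ℝ} {J I : Set ℝ} {A B : ℝ → ℝ} (h : Describes γ J I A B) :
    Describes (reflection γ) (-J) I A B := by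
  obtain ⟨r, h1, h2⟩ := h
  refine ⟨fun ξ => r (-ξ), ⟨fun ξ hξ => h1.mapsTo hξ, fun ξ hξ η hη h => ?_, fun ρ hρ => ?_⟩,
    fun ξ hξ => ?_⟩
  · exact neg_injective (h1.injOn hξ hη h)
  · obtain ⟨ξ, hξ, rfl⟩ := h1.surjOn hρ
    exact ⟨-ξ, by simpa using hξ, by simp⟩
  · obtain ⟨h3, h4, h5, h6, h7⟩ := h2 (-ξ) hξ
    refine ⟨h3, ?_, ?_, h6, ?_⟩
    · have := h4.scomp ξ (hasDerivAt_neg ξ)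
      refine this.congr_deriv ?_
      simp [reflection]
    · rw [h5]
      simp [reflection]
    · refine h7.congr_deriv ?_
      simp [reflection, neg_div_neg_eq]

theorem IsSolution.hasDerivAt_fst {γ : ℝ → ℝ × ℝ} {J : Set ℝ} (h : IsSolution γ J) {ξ : ℝ}
    (hξ : ξ ∈ J) :
    HasDerivAt (fun ξ => (γ ξ).1) (1 - (γ ξ).1 * ((γ ξ).1 + (γ ξ).2)) ξ :=
  (hasFDerivAt_fst (𝕜 := ℝ) (p := γ ξ)).comp_hasDerivAt ξ (h.hasDerivAt ξ hξ)

theorem IsSolution.hasDerivAt_snd {γ : ℝ → ℝ × ℝ} {J : Set ℝ} (h : IsSolution γ J) {ξ : ℝ}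
    (hξ : ξ ∈ J) :
    HasDerivAt (fun ξ => (γ ξ).2) (-(γ ξ).2 * ((γ ξ).1 + (γ ξ).2)) ξ :=
  (hasFDerivAt_snd (𝕜 := ℝ) (p := γ ξ)).comp_hasDerivAt ξ (h.hasDerivAt ξ hξ)

theorem IsSolution.continuousOn {γ : ℝ → ℝ × ℝ} {J : Set ℝ} (h : IsSolution γ J) :
    ContinuousOn γ J :=
  fun ξ hξ => (h.hasDerivAt ξ hξ).continuousAt.continuousWithinAt

/-- A solution with an integral of `√2 y₁` describes a spacetime with a scalar field. -/
theorem Describes.exists_isScalarSpacetime {γ : ℝ → ℝ × ℝ} {J I : Set ℝ} {A B V Ψ : ℝ → ℝ}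
    (h : Describes γ J I A B) (hγ : IsSolution γ J) (hpos : ∀ ξ ∈ J, 0 < (γ ξ).1)
    (hV : ∀ ξ ∈ J, HasDerivAt V (-((γ ξ).1 + (γ ξ).2) * V ξ) ξ)
    (hVsq : ∀ ξ ∈ J, V ξ ^ 2 = (γ ξ).1 ^ 2 + 2 * (γ ξ).1 * (γ ξ).2 - 1)
    (hΨ : ∀ ξ ∈ J, HasDerivAt Ψ (√2 * V ξ) ξ) :
    ∃ ψ, IsScalarSpacetime I A (fun r => 1 / B r) id ψ := by
  obtain ⟨r, hbij, hr⟩ := h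
  have hrc : ContinuousOn r J := fun ξ hξ => (hr ξ hξ).2.1.continuousAt.continuousWithinAt
  obtain ⟨-, hopen, g, hg⟩ := exists_inverse hγ.isOpen hγ.ordConnected (fun ξ hξ => (hr ξ hξ).2.1)
    (hγ.continuousOn.fst.mul hrc) (fun ξ hξ => mul_pos (hpos ξ hξ) (hr ξ hξ).1)
  have hI : I = r '' J := hbij.image_eq.symm
  subst hI
  have hcomp : ∀ (f : ℝ → ℝ) (f' ξ : ℝ), ξ ∈ J → HasDerivAt f f' ξ →
      HasDerivAt (fun ρ => f (g ρ)) (f' / ((γ ξ).1 * r ξ)) (r ξ) := by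
    intro f f' ξ hξ hf
    rw [← (hg ξ hξ).1] at hf
    exact hf.comp (r ξ) (hg ξ hξ).2
  refine ⟨fun ρ => Ψ (g ρ), isScalarSpacetime_of_radial (X := fun ρ => (γ (g ρ)).1)
    (Y := fun ρ => (γ (g ρ)).2) (V := fun ρ => V (g ρ)) hopen
    ((hγ.ordConnected.isPreconnected.image r hrc).ordConnected) (hγ.nonempty.image r)
    ?_ ?_ ?_ ?_ ?_ ?_ ?_ ?_ ?_ ?_⟩ <;> rintro _ ⟨ξ, hξ, rfl⟩ <;>
    (try simp only [(hg ξ hξ).1])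
  · exact (hr ξ hξ).1
  · exact hpos ξ hξ
  · exact (hr ξ hξ).2.2.2.1
  · exact (hr ξ hξ).2.2.1
  · exact hcomp _ _ ξ hξ (hγ.hasDerivAt_fst hξ)
  · exact hcomp _ _ ξ hξ (hγ.hasDerivAt_snd hξ)
  · exact hcomp _ _ ξ hξ (hV ξ hξ)
  · exact hVsq ξ hξ
  · exact (hr ξ hξ).2.2.2.2
  · exact hcomp _ _ ξ hξ (hΨ ξ hξ)

/-- The function `tanh (s / 2)`. -/
def halfTanh (s : ℝ) : ℝ := (cosh s - 1) / sinh s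

section HalfTanh

variable {s : ℝ}

theorem halfTanh_pos (hs : 0 < s) : 0 < halfTanh s := by
  have h1 : 0 < sinh s := Real.sinh_pos_iff.2 hs
  have h2 : 1 < cosh s := by simpa using hs.ne'
  exact div_pos (by linarith) h1

theorem one_sub_halfTanh_sq (hs : 0 < s) : 1 - halfTanh s ^ 2 = 2 / (cosh s + 1) := by
  have h1 : 0 < sinh s := Real.sinh_pos_iff.2 hs
  have h2 := cosh_pos s
  have h3 := cosh_sq_sub_sinh_sq s
  rw [halfTanh, div_pow, show sinh s ^ 2 = (cosh s - 1) * (cosh s + 1) by linarith]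
  have h4 : cosh s - 1 ≠ 0 := by
    have : 1 < cosh s := by simpa using hs.ne'
    linarith
  field_simp
  ring

theorem halfTanh_lt_one (hs : 0 < s) : halfTanh s < 1 := by
  have h1 := one_sub_halfTanh_sq hs
  have h2 : 0 < 2 / (cosh s + 1) := by
    have := cosh_pos s
    positivity
  have h3 := halfTanh_pos hs
  nlinarith

theorem sinh_eq_halfTanh (hs : 0 < s) : sinh s = 2 * halfTanh s / (1 - halfTanh s ^ 2) := by
  have h1 : 0 < sinh s := Real.sinh_pos_iff.2 hs
  have h2 := cosh_pos s
  have h3 := cosh_sq_sub_sinh_sq s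
  rw [one_sub_halfTanh_sq hs, halfTanh]
  field_simp
  linear_combination -h3

theorem cosh_eq_halfTanh (hs : 0 < s) :
    cosh s = (1 + halfTanh s ^ 2) / (1 - halfTanh s ^ 2) := by
  have h2 := cosh_pos s
  have h4 := one_sub_halfTanh_sq hs
  rw [show 1 + halfTanh s ^ 2 = 2 - (1 - halfTanh s ^ 2) by ring, h4]
  field_simp
  ring

/-- The logarithmic derivative is `1 / sinh s`, so powers of `halfTanh` integrate every equation `f'
/ f = p / sinh s`. -/
theorem hasDerivAt_halfTanh (hs : 0 < s) : HasDerivAt halfTanh (halfTanh s / sinh s) s := by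
  have h1 : 0 < sinh s := Real.sinh_pos_iff.2 hs
  have h3 := cosh_sq_sub_sinh_sq s
  refine (((hasDerivAt_cosh s).sub_const 1).div (hasDerivAt_sinh s) h1.ne').congr_deriv ?_
  rw [halfTanh]
  field_simp
  linear_combination -h3

theorem exists_halfTanh {T : ℝ} (h0 : 0 < T) (h1 : T < 1) : ∃ s > 0, halfTanh s = T := by
  have h2 : 0 < 1 - T ^ 2 := by nlinarith
  have h3 : sinh (arsinh (2 * T / (1 - T ^ 2))) = 2 * T / (1 - T ^ 2) := sinh_arsinh _
  have h4 : cosh (arsinh (2 * T / (1 - T ^ 2))) = (1 + T ^ 2) / (1 - T ^ 2) := by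
    rw [cosh_arsinh, ← Real.sqrt_sq (show 0 ≤ (1 + T ^ 2) / (1 - T ^ 2) by positivity)]
    congr 1
    field_simp
    ring
  refine ⟨arsinh (2 * T / (1 - T ^ 2)), arsinh_pos_iff.2 (by positivity), ?_⟩
  rw [halfTanh, h3, h4]
  field_simp
  ring

end HalfTanh

/-- The area radius along `orbit c`, as a function of `tanh (s / 2)`. -/
def areaRadius (k c T : ℝ) : ℝ := k * T ^ (1 - c) / (1 - T ^ 2)

theorem areaRadius_pos {k c T : ℝ} (hk : 0 < k) (h0 : 0 < T) (h1 : T < 1) :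
    0 < areaRadius k c T := by
  have h2 : 0 < 1 - T ^ 2 := by nlinarith
  have := rpow_pos_of_pos h0 (1 - c)
  unfold areaRadius
  positivity

/-- `x₂ = coth s - c / sinh s` integrates to `log (sinh s) - c log T`. With `sinh s = 2 T / (1 -
T²)` this gives `T ^ (1 - c) / (1 - T²)` up to a constant. -/
theorem hasDerivAt_areaRadius (k c : ℝ) {s : ℝ} (hs : 0 < s) :
    HasDerivAt (fun s => areaRadius k c (halfTanh s))
      ((orbit c s).1 * areaRadius k c (halfTanh s)) s := by
  have h0 := halfTanh_pos hs
  have h1 := halfTanh_lt_one hs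
  have h2 : 0 < 1 - halfTanh s ^ 2 := by nlinarith
  have hd := hasDerivAt_halfTanh hs
  have hp : HasDerivAt (fun s => halfTanh s ^ (1 - c))
      ((1 - c) / sinh s * halfTanh s ^ (1 - c)) s := by
    refine (hd.rpow_const (p := 1 - c) (Or.inl h0.ne')).congr_deriv ?_
    have h3 : 0 < sinh s := Real.sinh_pos_iff.2 hs
    rw [rpow_sub_one h0.ne']
    field_simp
  refine (((hp.const_mul k).div ((hd.pow 2).const_sub 1) h2.ne')).congr_deriv ?_
  simp only [orbit, areaRadius, Pi.pow_apply]
  rw [sinh_eq_halfTanh hs, cosh_eq_halfTanh hs]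
  generalize halfTanh s ^ (1 - c) = u
  field_simp
  ring

theorem hasDerivAt_rpow_halfTanh (c : ℝ) {s : ℝ} (hs : 0 < s) :
    HasDerivAt (fun s => halfTanh s ^ (2 * c)) (2 * (orbit c s).2 * halfTanh s ^ (2 * c)) s := by
  have h0 := halfTanh_pos hs
  have h3 : 0 < sinh s := Real.sinh_pos_iff.2 hs
  refine ((hasDerivAt_halfTanh hs).rpow_const (p := 2 * c) (Or.inl h0.ne')).congr_deriv ?_
  rw [rpow_sub_one h0.ne', orbit]
  field_simp

/-- Two positive solutions of one linear equation have a constant quotient; this fixes `r` and `A`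
up to the scales `k` and `A₀`. -/
theorem exists_eq_const_mul {J : Set ℝ} (hJ : J.OrdConnected) (hJn : J.Nonempty) {f g l : ℝ → ℝ}
    (hf : ∀ x ∈ J, HasDerivAt f (l x * f x) x) (hg : ∀ x ∈ J, HasDerivAt g (l x * g x) x)
    (hfpos : ∀ x ∈ J, 0 < f x) (hgpos : ∀ x ∈ J, 0 < g x) :
    ∃ k > 0, ∀ x ∈ J, f x = k * g x := by
  obtain ⟨x₀, hx₀⟩ := hJn
  refine ⟨f x₀ / g x₀, div_pos (hfpos _ hx₀) (hgpos _ hx₀), fun x hx => ?_⟩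
  have hsub : uIcc x₀ x ⊆ J := hJ.uIcc_subset hx₀ hx
  have := eq_of_hasDerivWithinAt_zero (f := fun x => f x / g x) (fun y hy =>
    (((hf y (hsub hy)).div (hg y (hsub hy)) (hgpos y (hsub hy)).ne').congr_deriv
      (by ring_nf)).hasDerivWithinAt) right_mem_uIcc left_mem_uIcc
  rw [← this]
  have := (hgpos x hx).ne'
  field_simp

/-- The metric described by `orbit c`. -/
theorem Describes.explicit {γ : ℝ → ℝ × ℝ} {I : Set ℝ} {A B : ℝ → ℝ} {a c : ℝ}
    (h : Describes γ (Ioi a) I A B) (hγ : ∀ ξ ∈ Ioi a, γ ξ = orbit c (ξ - a)) (hc : |c| ≤ 1) :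
    ∃ k > 0, ∃ A₀ > 0, I = areaRadius k c '' Ioo 0 1 ∧ ∀ T ∈ Ioo (0 : ℝ) 1,
      A (areaRadius k c T) = A₀ * T ^ (2 * c) ∧
      B (areaRadius k c T) = (((1 + T ^ 2) - c * (1 - T ^ 2)) / (2 * T)) ^ 2 := by
  obtain ⟨r, hbij, hr⟩ := h
  have hsub : ∀ ξ ∈ Ioi a, 0 < ξ - a := fun ξ hξ => sub_pos.2 (mem_Ioi.1 hξ)
  obtain ⟨k, hk, hk'⟩ := exists_eq_const_mul ordConnected_Ioi nonempty_Ioi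
    (fun ξ hξ => (hr ξ hξ).2.1)
    (g := fun ξ => areaRadius 1 c (halfTanh (ξ - a))) (fun ξ hξ => by
      rw [hγ ξ hξ]
      exact (hasDerivAt_areaRadius 1 c (hsub ξ hξ)).comp_sub_const ξ a) (fun ξ hξ => (hr ξ hξ).1)
    (fun ξ hξ => areaRadius_pos one_pos (halfTanh_pos (hsub ξ hξ)) (halfTanh_lt_one (hsub ξ hξ)))
  have hk'' : ∀ ξ ∈ Ioi a, r ξ = areaRadius k c (halfTanh (ξ - a)) := fun ξ hξ => by
    rw [hk' ξ hξ]
    simp only [areaRadius]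
    ring
  -- Along the solution `d ln A / dξ = (2 x₃ / x₂) x₂ = 2 x₃`; the factor `x₂` of `r'` cancels.
  obtain ⟨A₀, hA₀, hA₀'⟩ := exists_eq_const_mul ordConnected_Ioi nonempty_Ioi
    (f := fun ξ => A (r ξ)) (l := fun ξ => 2 * (γ ξ).2)
    (fun ξ hξ => by
      obtain ⟨h1, h2, h3, h4, h5⟩ := hr ξ hξ
      refine (h5.comp ξ h2).congr_deriv ?_
      have : (γ ξ).1 ≠ 0 := by
        rw [hγ ξ hξ]
        exact (orbit_fst_pos hc (hsub ξ hξ)).ne'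
      field_simp)
    (g := fun ξ => halfTanh (ξ - a) ^ (2 * c)) (fun ξ hξ => by
      rw [hγ ξ hξ]
      exact (hasDerivAt_rpow_halfTanh c (hsub ξ hξ)).comp_sub_const ξ a)
    (fun ξ hξ => (hr ξ hξ).2.2.2.1) (fun ξ hξ => rpow_pos_of_pos (halfTanh_pos (hsub ξ hξ)) _)
  have hsurj : ∀ T ∈ Ioo (0 : ℝ) 1, ∃ ξ ∈ Ioi a, halfTanh (ξ - a) = T := by
    intro T hT
    obtain ⟨s, hs, rfl⟩ := exists_halfTanh hT.1 hT.2
    exact ⟨s + a, by simpa using hs, by simp⟩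
  refine ⟨k, hk, A₀, hA₀, ?_, fun T hT => ?_⟩
  · rw [← hbij.image_eq]
    ext ρ
    constructor
    · rintro ⟨ξ, hξ, rfl⟩
      exact ⟨_, ⟨halfTanh_pos (hsub ξ hξ), halfTanh_lt_one (hsub ξ hξ)⟩, (hk'' ξ hξ).symm⟩
    · rintro ⟨T, hT, rfl⟩
      obtain ⟨ξ, hξ, rfl⟩ := hsurj T hT
      exact ⟨ξ, hξ, hk'' ξ hξ⟩
  · obtain ⟨ξ, hξ, rfl⟩ := hsurj T hT
    have h2 : 0 < 1 - halfTanh (ξ - a) ^ 2 := by nlinarith [hT.1, hT.2]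
    have h3 := hT.1
    rw [← hk'' ξ hξ, hA₀' ξ hξ, (hr ξ hξ).2.2.1, hγ ξ hξ, orbit, sinh_eq_halfTanh (hsub ξ hξ),
      cosh_eq_halfTanh (hsub ξ hξ)]
    refine ⟨rfl, ?_⟩
    simp only
    congr 1
    field_simp

theorem exists_describes_orbit {γ : ℝ → ℝ × ℝ} {a c : ℝ}
    (hγ : ∀ ξ ∈ Ioi a, γ ξ = orbit c (ξ - a)) (hc : |c| ≤ 1) :
    ∃ I A B, Describes γ (Ioi a) I A B := by
  have hsub : ∀ ξ ∈ Ioi a, 0 < ξ - a := fun ξ hξ => sub_pos.2 (mem_Ioi.1 hξ)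
  set r : ℝ → ℝ := fun ξ => areaRadius 1 c (halfTanh (ξ - a)) with hr
  have hrpos : ∀ ξ ∈ Ioi a, 0 < r ξ := fun ξ hξ =>
    areaRadius_pos one_pos (halfTanh_pos (hsub ξ hξ)) (halfTanh_lt_one (hsub ξ hξ))
  have hrd : ∀ ξ ∈ Ioi a, HasDerivAt r ((orbit c (ξ - a)).1 * r ξ) ξ := fun ξ hξ =>
    (hasDerivAt_areaRadius 1 c (hsub ξ hξ)).comp_sub_const ξ a
  have hpos : ∀ ξ ∈ Ioi a, 0 < (orbit c (ξ - a)).1 := fun ξ hξ => orbit_fst_pos hc (hsub ξ hξ)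
  obtain ⟨hmono, -, g, hg⟩ := exists_inverse isOpen_Ioi ordConnected_Ioi hrd
    ((isSolution_orbit hc a).continuousOn.fst.mul fun ξ hξ =>
      (hrd ξ hξ).continuousAt.continuousWithinAt) (fun ξ hξ => mul_pos (hpos ξ hξ) (hrpos ξ hξ))
  refine ⟨r '' Ioi a, fun ρ => halfTanh (g ρ - a) ^ (2 * c), fun ρ => (orbit c (g ρ - a)).1 ^ 2, r,
    hmono.injOn.bijOn_image, fun ξ hξ => ⟨hrpos ξ hξ, ?_, ?_, ?_, ?_⟩⟩
  · rw [hγ ξ hξ]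
    exact hrd ξ hξ
  · simp only [hγ ξ hξ, (hg ξ hξ).1]
  · simp only [(hg ξ hξ).1]
    exact rpow_pos_of_pos (halfTanh_pos (hsub ξ hξ)) _
  · have h1 := (hasDerivAt_rpow_halfTanh c (hsub ξ hξ)).comp_sub_const ξ a
    have h2 := (hg ξ hξ).2
    have h3 := hpos ξ hξ
    have h4 := hrpos ξ hξ
    rw [← (hg ξ hξ).1] at h1
    refine (HasDerivAt.comp (r ξ) (h₂ := fun ξ => halfTanh (ξ - a) ^ (2 * c)) h1 h2).congr_deriv ?_
    rw [hγ ξ hξ]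
    simp only [(hg ξ hξ).1]
    field_simp

/-- Solutions that run to `P_M`: the constant one and the orbits. -/
def IsRightSolution (γ : ℝ → ℝ × ℝ) (J : Set ℝ) : Prop :=
  (J = univ ∧ ∀ ξ, γ ξ = PM) ∨
    ∃ a c, |c| ≤ 1 ∧ J = Ioi a ∧ ∀ ξ ∈ Ioi a, γ ξ = orbit c (ξ - a)

theorem IsMaximalSolution.isRightSolution_or_reflect {γ : ℝ → ℝ × ℝ} {J : Set ℝ}
    (h : IsMaximalSolution γ J) :
    IsRightSolution γ J ∨ IsRightSolution (reflection γ) (-J) := by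
  rcases h.trichotomy with ⟨h1, h2⟩ | ⟨h1, h2⟩ | ⟨Q, -, h1⟩ | ⟨Q, -, h1⟩
  · exact Or.inl (Or.inl ⟨h1, h2⟩)
  · exact Or.inr (Or.inl ⟨by simp [h1], fun ξ => by simp [reflection, h2, neg_PMbar]⟩)
  · obtain ⟨a, c, hc, h2, h3, -⟩ := h.exists_orbit_of_goesToPM h1
    exact Or.inl (Or.inr ⟨a, c, hc, h2, h3⟩)
  · obtain ⟨a, c, hc, h2, h3, -⟩ := h.reflect.exists_orbit_of_goesToPM h1.reflect
    exact Or.inr (Or.inr ⟨a, c, hc, h2, h3⟩)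

theorem exists_describes_PM {γ : ℝ → ℝ × ℝ} (hγ : ∀ ξ, γ ξ = PM) :
    ∃ I A B, Describes γ univ I A B := by
  refine ⟨exp '' univ, fun _ => 1, fun _ => 1, exp, exp_injective.injOn.bijOn_image,
    fun ξ _ => ⟨exp_pos ξ, ?_, ?_, one_pos, ?_⟩⟩
  · simpa [hγ, PM] using Real.hasDerivAt_exp ξ
  · simp [hγ, PM]
  · simpa [hγ, PM] using hasDerivAt_const (exp ξ) (1 : ℝ)

theorem IsRightSolution.exists_describes {γ : ℝ → ℝ × ℝ} {J : Set ℝ} (h : IsRightSolution γ J) :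
    ∃ I A B, Describes γ J I A B := by
  rcases h with ⟨rfl, h⟩ | ⟨a, c, hc, rfl, h⟩
  · exact exists_describes_PM h
  · exact exists_describes_orbit h hc

theorem IsMaximalSolution.exists_describes {γ : ℝ → ℝ × ℝ} {J : Set ℝ}
    (h : IsMaximalSolution γ J) : ∃ I A B, Describes γ J I A B := by
  rcases h.isRightSolution_or_reflect with h | h
  · exact h.exists_describes
  · obtain ⟨I, A, B, h⟩ := h.exists_describes
    have := h.reflect
    rw [reflection_reflection, neg_neg] at this
    exact ⟨I, A, B, this⟩

theorem IsRightSolution.exists_isScalarSpacetime {γ : ℝ → ℝ × ℝ} {J I : Set ℝ} {A B : ℝ → ℝ}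
    (h : IsRightSolution γ J) (hγ : IsSolution γ J) (hd : Describes γ J I A B) :
    ∃ ψ, IsScalarSpacetime I A (fun r => 1 / B r) id ψ := by
  rcases h with ⟨rfl, h⟩ | ⟨a, c, hc, rfl, h⟩
  · refine hd.exists_isScalarSpacetime (V := fun _ => 0) (Ψ := fun _ => 0) hγ ?_ ?_ ?_ ?_ <;>
      intro ξ _ <;> simp [h, PM, hasDerivAt_const]
  · have hsub : ∀ ξ ∈ Ioi a, 0 < ξ - a := fun ξ hξ => sub_pos.2 (mem_Ioi.1 hξ)
    have hc' : 0 ≤ 1 - c ^ 2 := by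
      have := (sq_le_one_iff_abs_le_one c).2 hc
      linarith
    -- `V` is the nonnegative root given by the constraint, and its integral comes from `(log T)' =
    -- 1 / sinh s`.
    refine hd.exists_isScalarSpacetime (V := fun ξ => √(1 - c ^ 2) / sinh (ξ - a))
      (Ψ := fun ξ => √2 * √(1 - c ^ 2) * log (halfTanh (ξ - a))) hγ ?_ ?_ ?_ ?_ <;>
      intro ξ hξ <;> have hs := hsub ξ hξ <;> have hsh : 0 < sinh (ξ - a) := Real.sinh_pos_iff.2 hs <;>
      try rw [h ξ hξ]
    · exact orbit_fst_pos hc hs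
    · have h1 : HasDerivAt (fun s => √(1 - c ^ 2) / sinh s) _ (ξ - a) :=
        (hasDerivAt_const (ξ - a) √(1 - c ^ 2)).div (hasDerivAt_sinh (ξ - a)) hsh.ne'
      refine (h1.comp_sub_const ξ a).congr_deriv ?_
      simp only [orbit]
      field_simp
      ring
    · rw [orbit_constraint c hs.ne', div_pow, Real.sq_sqrt hc']
      ring
    · have h1 := (((hasDerivAt_halfTanh hs).log (halfTanh_pos hs).ne').const_mul
        (√2 * √(1 - c ^ 2))).comp_sub_const ξ a
      refine h1.congr_deriv ?_
      have := halfTanh_pos hs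
      field_simp

theorem IsMaximalSolution.exists_isScalarSpacetime {γ : ℝ → ℝ × ℝ} {J I : Set ℝ} {A B : ℝ → ℝ}
    (h : IsMaximalSolution γ J) (hd : Describes γ J I A B) :
    ∃ ψ, IsScalarSpacetime I A (fun r => 1 / B r) id ψ := by
  rcases h.isRightSolution_or_reflect with h' | h'
  · exact h'.exists_isScalarSpacetime h.1 hd
  · exact h'.exists_isScalarSpacetime h.1.reflect hd.reflect

/-! ### The Minkowski metric of the fixed points. -/

theorem isMinkowski_of_eq_PM {γ : ℝ → ℝ × ℝ} {J I : Set ℝ} {A B : ℝ → ℝ}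
    (h : IsMaximalSolution γ J) (hd : Describes γ J I A B) (hγ : ∀ ξ ∈ J, γ ξ = PM) :
    IsMinkowski I A B := by
  have hJ : J = univ := (h.2 _ _ isSolution_PM (subset_univ _) fun ξ hξ => (hγ ξ hξ).symm).symm
  subst hJ
  obtain ⟨r, hbij, hr⟩ := hd
  obtain ⟨k, hk, hk'⟩ := exists_eq_const_mul ordConnected_univ univ_nonempty
    (fun ξ hξ => (hr ξ hξ).2.1) (g := exp) (fun ξ hξ => by
      simpa [hγ ξ hξ, PM] using Real.hasDerivAt_exp ξ) (fun ξ hξ => (hr ξ hξ).1)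
    (fun ξ _ => exp_pos ξ)
  have hI : I = Ioi 0 := by
    rw [← hbij.image_eq]
    ext ρ
    constructor
    · rintro ⟨ξ, hξ, rfl⟩
      exact (hr ξ hξ).1
    · intro hρ
      have hρ' : 0 < ρ := hρ
      refine ⟨log (ρ / k), mem_univ _, ?_⟩
      rw [hk' _ (mem_univ _), exp_log (by positivity)]
      field_simp
  have hsurj : ∀ ρ ∈ Ioi (0 : ℝ), ∃ ξ, r ξ = ρ := by
    intro ρ hρ
    rw [← hI] at hρ
    obtain ⟨ξ, -, h⟩ := hbij.surjOn hρ
    exact ⟨ξ, h⟩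
  have hA : ∀ ρ ∈ Ioi (0 : ℝ), HasDerivAt A 0 ρ := by
    intro ρ hρ
    obtain ⟨ξ, rfl⟩ := hsurj ρ hρ
    simpa [hγ ξ (mem_univ ξ), PM] using (hr ξ (mem_univ ξ)).2.2.2.2
  have hA1 : ∀ ρ ∈ Ioi (0 : ℝ), 0 < A ρ := by
    intro ρ hρ
    obtain ⟨ξ, rfl⟩ := hsurj ρ hρ
    exact (hr ξ (mem_univ ξ)).2.2.2.1
  refine ⟨hI, A 1, hA1 1 (mem_Ioi.2 one_pos), fun ρ hρ => ⟨?_, ?_⟩⟩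
  · rw [hI] at hρ
    have hsub : uIcc 1 ρ ⊆ Ioi 0 := ordConnected_Ioi.uIcc_subset (mem_Ioi.2 one_pos) hρ
    exact eq_of_hasDerivWithinAt_zero (fun y hy => (hA y (hsub hy)).hasDerivWithinAt)
      right_mem_uIcc left_mem_uIcc
  · rw [hI] at hρ
    obtain ⟨ξ, rfl⟩ := hsurj ρ hρ
    simpa [hγ ξ (mem_univ ξ), PM] using (hr ξ (mem_univ ξ)).2.2.1

theorem isMinkowski_of_fixedPoint {γ : ℝ → ℝ × ℝ} {J I : Set ℝ} {A B : ℝ → ℝ}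
    (h : IsMaximalSolution γ J) (hd : Describes γ J I A B)
    (hγ : (∀ ξ ∈ J, γ ξ = PM) ∨ (∀ ξ ∈ J, γ ξ = PMbar)) : IsMinkowski I A B := by
  rcases hγ with hγ | hγ
  · exact isMinkowski_of_eq_PM h hd hγ
  · exact isMinkowski_of_eq_PM h.reflect hd.reflect fun ξ hξ => by
      rw [reflection, hγ _ hξ, neg_PMbar]

/-! ### Global properties of the spacetimes -/

/-- The metric described by `orbit c`, parametrized by `T = tanh (s / 2)`. -/
structure IsOrbitMetric (k A₀ c : ℝ) (I : Set ℝ) (A B : ℝ → ℝ) : Prop where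
  pos_k : 0 < k
  pos_A₀ : 0 < A₀
  abs_le : |c| ≤ 1
  range : I = areaRadius k c '' Ioo 0 1
  A_eq : ∀ T ∈ Ioo (0 : ℝ) 1, A (areaRadius k c T) = A₀ * T ^ (2 * c)
  B_eq : ∀ T ∈ Ioo (0 : ℝ) 1,
    B (areaRadius k c T) = (((1 + T ^ 2) - c * (1 - T ^ 2)) / (2 * T)) ^ 2

theorem exists_isOrbitMetric {γ : ℝ → ℝ × ℝ} {J I : Set ℝ} {A B : ℝ → ℝ} {Q : ℝ × ℝ}
    (h : IsMaximalSolution γ J) (hd : Describes γ J I A B) (hQ : GoesToPM γ J Q) :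
    ∃ k A₀ c, Q = endpoint c ∧ IsOrbitMetric k A₀ c I A B := by
  obtain ⟨a, c, hc, rfl, h1, h2⟩ := h.exists_orbit_of_goesToPM hQ
  obtain ⟨k, hk, A₀, hA₀, hI, h3⟩ := hd.explicit h1 hc
  exact ⟨k, A₀, c, h2, hk, hA₀, hc, hI, fun T hT => (h3 T hT).1, fun T hT => (h3 T hT).2⟩

theorem IsScalarSpacetime.regularAt {I : Set ℝ} {A H r ψ : ℝ → ℝ}
    (h : IsScalarSpacetime I A H r ψ) {p : Fin 4 → ℝ} (hp : p 1 ∈ I) (hs : sin (p 2) ≠ 0) :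
    RegularAt A H r p :=
  ⟨h.contDiff_A.contDiffAt (h.isOpen.mem_nhds hp), h.contDiff_H.contDiffAt (h.isOpen.mem_nhds hp),
    h.contDiff_r.contDiffAt (h.isOpen.mem_nhds hp), (h.pos _ hp).1, (h.pos _ hp).2.1,
    (h.pos _ hp).2.2, hs⟩

theorem reduction {I : Set ℝ} {A H r ψ : ℝ → ℝ} (h : IsScalarSpacetime I A H r ψ) {ρ : ℝ}
    (hρ : ρ ∈ I) :
    DifferentiableAt ℝ (x₂ H r) ρ ∧ DifferentiableAt ℝ (x₃ A H r) ρ ∧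
      (normDeriv H r (x₂ H r) ρ, normDeriv H r (x₃ A H r) ρ) = field (x₂ H r ρ, x₃ A H r ρ) ∧
      y₁ H r ψ ρ ^ 2 = x₂ H r ρ ^ 2 + 2 * x₂ H r ρ * x₃ A H r ρ - 1 ∧
      (x₂ H r ρ, x₃ A H r ρ) ∈ phaseSpace := by
  -- The field equations are evaluated on the equator, where the angular coordinates are regular.
  -- Membership in the region is `y₁² ≥ 0`.
  set p : Fin 4 → ℝ := ![0, ρ, π / 2, 0] with hp
  have hp1 : p 1 = ρ := rfl
  have hp2 : sin (p 2) ≠ 0 := by simp [hp]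
  have hreg := h.regularAt (p := p) hρ hp2
  have h1 := (einstein_eq_iff hreg ψ).1 (h.einstein_eq p hρ hp2)
  refine ⟨hreg.hasDerivAt_x₂.differentiableAt, hreg.hasDerivAt_x₃.differentiableAt, h1.1, h1.2, ?_⟩
  have h2 := h1.2
  rw [hp1] at h2
  change (1 : ℝ) ≤ x₂ H r ρ ^ 2 + 2 * x₂ H r ρ * x₃ A H r ρ
  nlinarith [sq_nonneg (y₁ H r ψ ρ)]

namespace IsOrbitMetric

variable {k A₀ c : ℝ} {I : Set ℝ} {A B : ℝ → ℝ}

/-- Since `1 - T² = k T ^ (1 - c) / r`, the quantity `1 - T²` is the small parameter of order `1 /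
r` at the flat end. -/
theorem one_sub_sq_le (h : IsOrbitMetric k A₀ c I A B) {T : ℝ} (hT : T ∈ Ioo (0 : ℝ) 1) :
    1 - T ^ 2 ≤ k / areaRadius k c T := by
  have h1 : 0 < 1 - T ^ 2 := by nlinarith [hT.1, hT.2]
  have h2 : T ^ (1 - c) ≤ 1 :=
    rpow_le_one hT.1.le hT.2.le (by have := (_root_.abs_le.1 h.abs_le).2; linarith)
  have h3 := rpow_pos_of_pos hT.1 (1 - c)
  have hk := h.pos_k
  rw [le_div_iff₀ (areaRadius_pos hk hT.1 hT.2), areaRadius]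
  field_simp
  exact h2

/-- `T² ≤ T ^ (2c) ≤ T⁻²` bounds `A - A₀` by a multiple of `1 - T²`, and `B - 1` contains this
factor because `(1 + T²)² - 4 T² = (1 - T²)²`. -/
theorem isAsymptoticallyFlat (h : IsOrbitMetric k A₀ c I A B)
    (hI : ∃ r₁, ∀ r, r₁ < r → r ∈ I) : IsAsymptoticallyFlat A B := by
  obtain ⟨r₁, hr₁⟩ := hI
  have hk := h.pos_k
  have hA₀ := h.pos_A₀
  have hc := _root_.abs_le.1 h.abs_le
  -- Beyond `r = 4 k` one has `1 - T² ≤ 1/4`, which keeps `T` away from 0 in the denominators.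
  have key : ∀ᶠ r in atTop, 0 < r ∧ ∃ T ∈ Ioo (0 : ℝ) 1, r = areaRadius k c T ∧ 1 - T ^ 2 ≤ k / r ∧
      3 / 4 ≤ T ^ 2 := by
    filter_upwards [eventually_gt_atTop r₁, eventually_gt_atTop (4 * k)] with r h1 h2
    have h3 := hr₁ r h1
    rw [h.range] at h3
    obtain ⟨T, hT, rfl⟩ := h3
    have h4 := h.one_sub_sq_le hT
    have h5 : k / areaRadius k c T ≤ 1 / 4 := by
      rw [div_le_iff₀ (by linarith)]
      linarith
    exact ⟨by linarith, T, hT, rfl, h4, by linarith⟩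
  refine ⟨⟨A₀, hA₀, Asymptotics.IsBigO.of_bound (2 * A₀ * k) ?_⟩,
    Asymptotics.IsBigO.of_bound (2 * k) ?_⟩
  · filter_upwards [key] with r hr
    obtain ⟨h0, T, hT, hrT, h1, h2⟩ := hr
    have hAr := h.A_eq T hT
    rw [← hrT] at hAr
    have e1 : T ^ (2 : ℝ) ≤ T ^ (2 * c) :=
      rpow_le_rpow_of_exponent_ge hT.1 hT.2.le (by linarith)
    have e2 : T ^ (2 * c) ≤ T ^ (-2 : ℝ) :=
      rpow_le_rpow_of_exponent_ge hT.1 hT.2.le (by linarith)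
    rw [rpow_two] at e1
    rw [rpow_neg hT.1.le, rpow_two] at e2
    have e3 : (T ^ 2)⁻¹ - 1 ≤ 2 * (1 - T ^ 2) := by
      have hT0 := hT.1.ne'
      have : 0 < T ^ 2 := by positivity
      rw [← sub_nonneg, show 2 * (1 - T ^ 2) - ((T ^ 2)⁻¹ - 1) =
        (1 - T ^ 2) * (2 * T ^ 2 - 1) / T ^ 2 by rw [eq_div_iff this.ne', sub_mul, sub_mul, inv_mul_cancel₀ this.ne']; ring]
      have := hT.1
      have := hT.2
      apply div_nonneg _ (by positivity)
      apply mul_nonneg <;> nlinarith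
    have e4 : |T ^ (2 * c) - 1| ≤ 2 * (k / r) := by
      rw [_root_.abs_le]
      constructor <;> linarith
    rw [hAr, Real.norm_eq_abs, Real.norm_eq_abs, abs_of_pos (show 0 < 1 / r by positivity),
      show A₀ * T ^ (2 * c) - A₀ = A₀ * (T ^ (2 * c) - 1) by ring, abs_mul, abs_of_pos hA₀]
    calc A₀ * |T ^ (2 * c) - 1| ≤ A₀ * (2 * (k / r)) := mul_le_mul_of_nonneg_left e4 hA₀.le
      _ = 2 * A₀ * k * (1 / r) := by ring
  · filter_upwards [key] with r hr
    obtain ⟨h0, T, hT, hrT, h1, h2⟩ := hr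
    have hBr := h.B_eq T hT
    rw [← hrT] at hBr
    have hT0 := hT.1
    have hu : 0 ≤ 1 - T ^ 2 := by nlinarith [hT.1, hT.2]
    have e : B r - 1 = (1 - T ^ 2) * (((1 + c ^ 2) * (1 - T ^ 2) - 2 * c * (1 + T ^ 2))
        / (4 * T ^ 2)) := by
      rw [hBr]
      field_simp
      ring
    have e2 : |((1 + c ^ 2) * (1 - T ^ 2) - 2 * c * (1 + T ^ 2)) / (4 * T ^ 2)| ≤ 2 := by
      have hc2 : c ^ 2 ≤ 1 := (sq_le_one_iff_abs_le_one c).2 h.abs_le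
      rw [abs_div, abs_of_pos (show 0 < 4 * T ^ 2 by positivity), div_le_iff₀ (by positivity),
        _root_.abs_le]
      constructor <;> nlinarith [mul_nonneg hu (sub_nonneg.2 hc2), mul_nonneg hu (sq_nonneg c)]
    rw [e, Real.norm_eq_abs, Real.norm_eq_abs, abs_of_pos (show 0 < 1 / r by positivity), abs_mul,
      abs_of_nonneg hu]
    calc (1 - T ^ 2) * _ ≤ k / r * 2 := mul_le_mul h1 e2 (abs_nonneg _) (by positivity)
      _ = 2 * k * (1 / r) := by ring

/-- The exponent of `T` in the radius vanishes, so `r = k / (1 - T²)` and `T² = 1 - k / r`. -/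
theorem isSchwarzschild_of_one (h : IsOrbitMetric k A₀ 1 I A B) :
    IsSchwarzschild (k / 2) I A B := by
  have hk := h.pos_k
  have e : ∀ T, areaRadius k 1 T = k / (1 - T ^ 2) := fun T => by simp [areaRadius]
  have key : ∀ T ∈ Ioo (0 : ℝ) 1, 1 - 2 * (k / 2) / areaRadius k 1 T = T ^ 2 := by
    intro T hT
    have h1 : 0 < 1 - T ^ 2 := by nlinarith [hT.1, hT.2]
    rw [e]
    field_simp
    ring
  refine ⟨?_, A₀, h.pos_A₀, fun r hr => ?_⟩
  · rw [h.range]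
    ext r
    constructor
    · rintro ⟨T, hT, rfl⟩
      refine ⟨areaRadius_pos hk hT.1 hT.2, ?_⟩
      rw [key T hT]
      have := hT.1
      positivity
    · rintro ⟨h1, h2⟩
      have h3 : 0 < k / r := by positivity
      have h4 : 2 * (k / 2) / r = k / r := by ring
      rw [h4] at h2
      refine ⟨√(1 - k / r), ⟨Real.sqrt_pos.2 h2, ?_⟩, ?_⟩
      · rw [Real.sqrt_lt' one_pos]
        linarith
      · rw [e, Real.sq_sqrt h2.le]
        field_simp
        simp [hk.ne']
  · rw [h.range] at hr
    obtain ⟨T, hT, rfl⟩ := hr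
    have hT0 := hT.1
    rw [h.A_eq T hT, h.B_eq T hT, key T hT]
    constructor
    · rw [mul_one, rpow_two]
    · field_simp
      ring

/-- Here `r = k T² / (1 - T²)`, so `T⁻² = 1 + k / r`. -/
theorem isSchwarzschild_of_neg_one (h : IsOrbitMetric k A₀ (-1) I A B) :
    IsSchwarzschild (-(k / 2)) I A B := by
  have hk := h.pos_k
  have e : ∀ T, areaRadius k (-1) T = k * T ^ 2 / (1 - T ^ 2) := fun T => by
    rw [areaRadius, show (1 : ℝ) - -1 = 2 by norm_num, rpow_two]
  have key : ∀ T ∈ Ioo (0 : ℝ) 1, 1 - 2 * -(k / 2) / areaRadius k (-1) T = (T ^ 2)⁻¹ := by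
    intro T hT
    have h1 : 0 < 1 - T ^ 2 := by nlinarith [hT.1, hT.2]
    have hT0 := hT.1
    rw [e]
    field_simp
    ring
  refine ⟨?_, A₀, h.pos_A₀, fun r hr => ?_⟩
  · rw [h.range]
    ext r
    constructor
    · rintro ⟨T, hT, rfl⟩
      refine ⟨areaRadius_pos hk hT.1 hT.2, ?_⟩
      rw [key T hT]
      have := hT.1
      positivity
    · rintro ⟨h1, h2⟩
      have h3 : 0 < k / r := by positivity
      have h5 : 0 < 1 + k / r := by linarith
      have h6 : √(1 / (1 + k / r)) ^ 2 = 1 / (1 + k / r) := Real.sq_sqrt (by positivity)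
      refine ⟨√(1 / (1 + k / r)), ⟨Real.sqrt_pos.2 (by positivity), ?_⟩, ?_⟩
      · rw [Real.sqrt_lt' one_pos, one_pow, div_lt_one h5]
        linarith
      · rw [e, h6, show 1 - 1 / (1 + k / r) = (k / r) * (1 / (1 + k / r)) by field_simp; ring]
        field_simp
  · rw [h.range] at hr
    obtain ⟨T, hT, rfl⟩ := hr
    have hT0 := hT.1
    rw [h.A_eq T hT, h.B_eq T hT, key T hT]
    constructor
    · rw [mul_neg_one, rpow_neg hT0.le, rpow_two]
    · field_simp
      ring

end IsOrbitMetric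

theorem IsSchwarzschild.range_eq {M : ℝ} (hM : 0 < M) {I : Set ℝ} {A B : ℝ → ℝ}
    (h : IsSchwarzschild M I A B) : I = Ioi (2 * M) := by
  rw [h.1]
  ext r
  constructor
  · rintro ⟨h1, h2⟩
    have : 2 * M / r < 1 := by linarith
    rwa [div_lt_one h1] at this
  · intro h1
    have h1' : 2 * M < r := h1
    have h2 : 0 < r := by linarith
    refine ⟨h2, ?_⟩
    have : 2 * M / r < 1 := by rwa [div_lt_one h2]
    linarith

theorem hasDerivAt_one_sub_div (m : ℝ) {r : ℝ} (hr : r ≠ 0) :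
    HasDerivAt (fun r => 1 - m / r) (m / r ^ 2) r := by
  refine (((hasDerivAt_const r m).div (hasDerivAt_id r) hr).const_sub 1).congr_deriv ?_
  simp
  field_simp

theorem IsSchwarzschild.kretschmann_eq {M : ℝ} {I : Set ℝ} {A B ψ : ℝ → ℝ}
    (h : IsSchwarzschild M I A B) (hs : IsScalarSpacetime I A (fun r => 1 / B r) id ψ)
    {p : Fin 4 → ℝ} (hp : p 1 ∈ I) (hsin : sin (p 2) ≠ 0) :
    kretschmann (schwarzschildForm A B) p = 48 * M ^ 2 / p 1 ^ 6 := by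
  obtain ⟨hI, c, hc, hAB⟩ := h
  rw [schwarzschildForm, kretschmann_staticMetric (hs.regularAt hp hsin)]
  have hmem : ∀ r ∈ I, r ≠ 0 ∧ 1 - 2 * M / r ≠ 0 := fun r hr => by
    rw [hI] at hr
    exact ⟨hr.1.ne', hr.2.ne'⟩
  have hev : ∀ {f g : ℝ → ℝ}, (∀ ρ ∈ I, f ρ = g ρ) → ∀ ρ ∈ I, f =ᶠ[𝓝 ρ] g := fun h ρ hρ => by
    filter_upwards [hs.isOpen.mem_nhds hρ] with x hx
    exact h x hx
  have dA : ∀ r ∈ I, deriv A r = c * (2 * M / r ^ 2) := fun r hr =>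
    (((hasDerivAt_one_sub_div (2 * M) (hmem r hr).1).const_mul c).congr_of_eventuallyEq
      (hev (fun x hx => (hAB x hx).1) r hr)).deriv
  have dH : deriv (fun r => 1 / B r) (p 1) =
      -(2 * M / p 1 ^ 2) / (1 - 2 * M / p 1) ^ 2 := by
    refine HasDerivAt.deriv ?_
    refine ((((hasDerivAt_const (p 1) (1 : ℝ)).div (hasDerivAt_one_sub_div (2 * M) (hmem _ hp).1)
      (hmem _ hp).2).congr_deriv (by ring)).congr_of_eventuallyEq
      (hev (fun x hx => by simp only [(hAB x hx).2, Pi.div_apply]) _ hp))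
  have ddA : deriv (deriv A) (p 1) = -(4 * c * M / p 1 ^ 3) := by
    refine HasDerivAt.deriv ?_
    have h0 := (hmem _ hp).1
    refine ((((hasDerivAt_const (p 1) (2 * M)).div (hasDerivAt_pow 2 (p 1))
      (pow_ne_zero 2 h0)).const_mul c).congr_deriv ?_).congr_of_eventuallyEq (hev dA _ hp)
    field_simp
    ring
  have h0 := (hmem _ hp).1
  have h1 := (hmem _ hp).2
  have h2 : p 1 - 2 * M ≠ 0 := by
    intro h
    apply h1
    field_simp
    linarith
  simp only [sectional, dA _ hp, ddA, dH, (hAB _ hp).1, (hAB _ hp).2, deriv_id', deriv_const, id]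
  have e : 1 - 2 * M / p 1 = (p 1 - 2 * M) / p 1 := by field_simp
  rw [e]
  -- Writing `M` through `d = r - 2 M` turns all denominators into monomials in `r` and `d`.
  obtain ⟨d, hd⟩ : ∃ d, d = p 1 - 2 * M := ⟨_, rfl⟩
  rw [← hd] at h2 ⊢
  rw [show M = (p 1 - d) / 2 by linarith]
  field_simp
  ring

theorem IsSchwarzschild.isHorizonExterior {M : ℝ} (hM : 0 < M) {I : Set ℝ} {A B ψ : ℝ → ℝ}
    (h : IsSchwarzschild M I A B) (hs : IsScalarSpacetime I A (fun r => 1 / B r) id ψ) :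
    IsHorizonExterior I A B := by
  have hI := h.range_eq hM
  have hk := fun p => h.kretschmann_eq hs (p := p)
  obtain ⟨hI', c, hc, hAB⟩ := h
  have hlim : Tendsto (fun r => 1 - 2 * M / r) (𝓝[>] (2 * M)) (𝓝 0) := by
    have h1 := (hasDerivAt_one_sub_div (2 * M) (r := 2 * M) (by positivity)).continuousAt.tendsto
    rw [div_self (by positivity), sub_self] at h1
    exact h1.mono_left nhdsWithin_le_nhds
  refine ⟨2 * M, by positivity, hI, fun r hr => ?_, ?_, ?_, 48 * M ^ 2 / (2 * M) ^ 6,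
    fun p hp hsin => ?_⟩
  · have h1 := hAB r hr
    rw [hI'] at hr
    rw [h1.1, h1.2]
    exact ⟨mul_pos hc hr.2, hr.2⟩
  · have h1 := hlim.const_mul c
    rw [mul_zero] at h1
    refine h1.congr' ?_
    filter_upwards [self_mem_nhdsWithin] with r hr
    exact ((hAB r (hI ▸ hr)).1).symm
  · refine hlim.congr' ?_
    filter_upwards [self_mem_nhdsWithin] with r hr
    exact ((hAB r (hI ▸ hr)).2).symm
  · rw [hk p hp hsin]
    rw [hI] at hp
    have hp' : 2 * M < p 1 := hp
    have h2 : 0 < p 1 := by linarith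
    rw [abs_of_nonneg (by positivity)]
    gcongr

/-! ### Orbits that reach r = 0: power laws and naked singularities. -/

namespace IsOrbitMetric

variable {k A₀ c : ℝ} {I : Set ℝ} {A B : ℝ → ℝ}

/-- For `c < 1` the radius tends to 0 as `T → 0` and to ∞ as `T → 1`; the intermediate value theorem
fills the gap. -/
theorem range_eq (h : IsOrbitMetric k A₀ c I A B) (hc : c < 1) : I = Ioi 0 := by
  have hk := h.pos_k
  rw [h.range]
  refine Subset.antisymm ?_ ?_
  · rintro _ ⟨T, hT, rfl⟩
    exact areaRadius_pos hk hT.1 hT.2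
  · have hcont : ContinuousOn (areaRadius k c) (Ioo 0 1) := by
      intro T hT
      have h1 : 1 - T ^ 2 ≠ 0 := by nlinarith [hT.1, hT.2]
      have h2 : ContinuousAt (fun T : ℝ => T ^ (1 - c)) T :=
        continuousAt_rpow_const T _ (Or.inl hT.1.ne')
      exact ((continuousAt_const.mul h2).div (by fun_prop) h1).continuousWithinAt
    have l0 : Tendsto (areaRadius k c) (𝓝[>] 0) (𝓝 0) := by
      have h2 : ContinuousAt (fun T : ℝ => T ^ (1 - c)) 0 :=
        continuousAt_rpow_const 0 _ (Or.inr (by linarith))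
      have h3 : ContinuousAt (areaRadius k c) 0 :=
        (continuousAt_const.mul h2).div (by fun_prop) (by norm_num)
      have h4 := h3.tendsto
      rw [show areaRadius k c 0 = 0 by
        rw [areaRadius, zero_rpow (by linarith)]; simp] at h4
      exact h4.mono_left nhdsWithin_le_nhds
    have l1 : Tendsto (areaRadius k c) (𝓝[<] 1) atTop := by
      have h2 : ContinuousAt (fun T : ℝ => T ^ (1 - c)) 1 :=
        continuousAt_rpow_const 1 _ (Or.inl one_ne_zero)
      have h3 : Tendsto (fun T : ℝ => k * T ^ (1 - c)) (𝓝[<] 1) (𝓝 k) := by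
        have h4 : Tendsto (fun T : ℝ => k * T ^ (1 - c)) (𝓝 1) (𝓝 (k * 1 ^ (1 - c))) :=
          (continuousAt_const.mul h2).tendsto
        rw [one_rpow, mul_one] at h4
        exact h4.mono_left nhdsWithin_le_nhds
      have h5 : Tendsto (fun T : ℝ => 1 - T ^ 2) (𝓝[<] 1) (𝓝[>] 0) := by
        refine tendsto_nhdsWithin_iff.2 ⟨?_, ?_⟩
        · have : Tendsto (fun T : ℝ => 1 - T ^ 2) (𝓝 1) (𝓝 (1 - 1 ^ 2)) :=
            Continuous.tendsto (by fun_prop) 1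
          norm_num at this
          exact this.mono_left nhdsWithin_le_nhds
        · filter_upwards [Ioo_mem_nhdsLT (zero_lt_one' ℝ)] with T hT
          exact mem_Ioi.2 (by nlinarith [hT.1, hT.2])
      exact (h3.pos_mul_atTop hk (tendsto_inv_nhdsGT_zero.comp h5)).congr fun T => by
        simp [areaRadius, div_eq_mul_inv]
    have n0 : (𝓝[>] (0 : ℝ)).NeBot := inferInstance
    refine isPreconnected_Ioo.intermediate_value_Ioi (l₁ := 𝓝[>] 0) (l₂ := 𝓝[<] 1) ?_ ?_ hcont l0 l1
    · exact le_principal_iff.2 (Ioo_mem_nhdsGT one_pos)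
    · exact le_principal_iff.2 (Ioo_mem_nhdsLT one_pos)

theorem exists_parameter (h : IsOrbitMetric k A₀ c I A B) (hc : c < 1) :
    ∃ τ : ℝ → ℝ, (∀ r > 0, τ r ∈ Ioo (0 : ℝ) 1 ∧ areaRadius k c (τ r) = r) ∧
      Tendsto τ (𝓝[>] 0) (𝓝[>] 0) := by
  have hk := h.pos_k
  have hI := h.range_eq hc
  have : ∀ r : ℝ, r > 0 → ∃ T, T ∈ Ioo (0 : ℝ) 1 ∧ areaRadius k c T = r := by
    intro r hr
    have hr' : r ∈ I := by rw [hI]; exact hr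
    rw [h.range] at hr'
    exact hr'
  choose! τ hτ using this
  refine ⟨τ, hτ, tendsto_nhdsWithin_iff.2 ⟨?_, ?_⟩⟩
  · rw [Metric.tendsto_nhdsWithin_nhds]
    intro ε hε
    -- Since `1 - T² ≤ 1`, one has `k T ^ (1 - c) ≤ r`; hence `T ≥ ε` would force `r ≥ k ε ^ (1 -
    -- c)`.
    refine ⟨k * ε ^ (1 - c), mul_pos hk (rpow_pos_of_pos hε _), fun r hr hd => ?_⟩
    obtain ⟨hT, hr'⟩ := hτ r hr
    rw [Real.dist_eq, sub_zero, abs_of_pos hr] at hd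
    rw [Real.dist_eq, sub_zero, abs_of_pos hT.1]
    by_contra! hle
    have h1 : ε ^ (1 - c) ≤ τ r ^ (1 - c) := rpow_le_rpow hε.le hle (by linarith)
    have h2 : 0 < 1 - τ r ^ 2 := by nlinarith [hT.1, hT.2]
    have h3 : 1 - τ r ^ 2 ≤ 1 := by nlinarith [hT.1]
    have h4 : k * τ r ^ (1 - c) ≤ r := by
      calc k * τ r ^ (1 - c) ≤ k * τ r ^ (1 - c) / (1 - τ r ^ 2) :=
            le_div_self (mul_nonneg hk.le (rpow_nonneg hT.1.le _)) h2 h3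
        _ = r := hr'
    have := mul_le_mul_of_nonneg_left h1 hk.le
    linarith
  · filter_upwards [self_mem_nhdsWithin] with r hr
    exact (hτ r hr).1.1

/-- The right side equals `(1 - c) + (1 + c) T²`. -/
theorem one_sub_le (h : IsOrbitMetric k A₀ c I A B) {T : ℝ} :
    1 - c ≤ (1 + T ^ 2) - c * (1 - T ^ 2) := by
  have := (_root_.abs_le.1 h.abs_le).1
  nlinarith [mul_nonneg (show 0 ≤ 1 + c by linarith) (sq_nonneg T)]

/-- To leading order `r ≃ k T ^ (1 - c)`, `A = A₀ T ^ (2c)` and `B ≃ ((1 - c) / 2)² T⁻²`.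
Eliminating `T` gives the exponents `2c / (1 - c)` and `-2 / (1 - c)`, and `c / (1 - c)` is the
slope of the end point. -/
theorem hasPowerLaw (h : IsOrbitMetric k A₀ c I A B) (hc : c < 1) :
    HasPowerLaw A B (-2 * (1 + (endpoint c).2 / (endpoint c).1))
      (2 * (endpoint c).2 / (endpoint c).1) := by
  have hk := h.pos_k
  have hA₀ := h.pos_A₀
  have hc1 : 0 < 1 - c := by linarith
  have hn := Real.sqrt_pos.2 (endpoint_normSq_pos c)
  have eα : -2 * (1 + (endpoint c).2 / (endpoint c).1) = -2 / (1 - c) := by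
    rw [endpoint]
    field_simp
    ring
  have eβ : 2 * (endpoint c).2 / (endpoint c).1 = 2 * c / (1 - c) := by
    rw [endpoint]
    field_simp
  rw [eα, eβ]
  obtain ⟨τ, hτ, hlim⟩ := h.exists_parameter hc
  have hlim0 : Tendsto τ (𝓝[>] 0) (𝓝 0) := tendsto_nhdsWithin_iff.1 hlim |>.1
  have hpow : ∀ T ∈ Ioo (0 : ℝ) 1, ∀ b, areaRadius k c T ^ (b / (1 - c)) =
      (k / (1 - T ^ 2)) ^ (b / (1 - c)) * T ^ b := by
    intro T hT b
    have h2 : 0 < 1 - T ^ 2 := by nlinarith [hT.1, hT.2]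
    rw [areaRadius, show k * T ^ (1 - c) / (1 - T ^ 2) = k / (1 - T ^ 2) * T ^ (1 - c) by ring,
      mul_rpow (by positivity) (rpow_nonneg hT.1.le _), ← rpow_mul hT.1.le]
    congr 2
    field_simp
  have hku : ∀ b : ℝ, Tendsto (fun r => (k / (1 - τ r ^ 2)) ^ b) (𝓝[>] 0) (𝓝 (k ^ b)) := by
    intro b
    have h1 : ContinuousAt (fun T : ℝ => (k / (1 - T ^ 2)) ^ b) 0 := by
      refine ContinuousAt.rpow_const ?_ (Or.inl (by simp [hk.ne']))
      exact continuousAt_const.div (by fun_prop) (by norm_num)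
    have h2 := h1.tendsto
    simp only [ne_eq, OfNat.ofNat_ne_zero, not_false_eq_true, zero_pow, sub_zero, div_one] at h2
    exact h2.comp hlim0
  refine ⟨⟨A₀ / k ^ (2 * c / (1 - c)), by positivity, ?_⟩,
    ⟨((1 - c) / 2) ^ 2 / k ^ (-2 / (1 - c)), by positivity, ?_⟩⟩
  · refine ((tendsto_const_nhds (x := A₀)).div (hku _) (by positivity)).congr' ?_
    filter_upwards [self_mem_nhdsWithin] with r hr
    obtain ⟨hT, hr'⟩ := hτ r hr
    have h2 : 0 < 1 - τ r ^ 2 := by nlinarith [hT.1, hT.2]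
    have e1 := h.A_eq _ hT
    have e2 := hpow _ hT (2 * c)
    rw [hr'] at e1 e2
    rw [e1, e2]
    have := rpow_pos_of_pos hT.1 (2 * c)
    simp only [Pi.div_apply]
    field_simp
  · have h1 : Tendsto (fun r => (((1 + τ r ^ 2) - c * (1 - τ r ^ 2)) / 2) ^ 2) (𝓝[>] 0)
        (𝓝 (((1 - c) / 2) ^ 2)) := by
      have h2 : Tendsto (fun T : ℝ => (((1 + T ^ 2) - c * (1 - T ^ 2)) / 2) ^ 2) (𝓝 0)
          (𝓝 ((((1 + 0 ^ 2) - c * (1 - 0 ^ 2)) / 2) ^ 2)) := Continuous.tendsto (by fun_prop) 0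
      simp only [ne_eq, OfNat.ofNat_ne_zero, not_false_eq_true, zero_pow, sub_zero, add_zero,
        mul_one] at h2
      exact h2.comp hlim0
    refine (h1.div (hku _) (by positivity)).congr' ?_
    filter_upwards [self_mem_nhdsWithin] with r hr
    obtain ⟨hT, hr'⟩ := hτ r hr
    have h2 : 0 < 1 - τ r ^ 2 := by nlinarith [hT.1, hT.2]
    have e1 := h.B_eq _ hT
    have e2 := hpow _ hT (-2)
    rw [hr'] at e1 e2
    rw [e1, e2, rpow_neg hT.1.le, rpow_two]
    have h3 := hT.1
    have h4 : 0 < (k / (1 - τ r ^ 2)) ^ (-2 / (1 - c)) := by positivity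
    simp only [Pi.div_apply]
    field_simp

theorem isNakedSingularity {ψ : ℝ → ℝ} (h : IsOrbitMetric k A₀ c I A B) (hc : c < 1)
    (hs : IsScalarSpacetime I A (fun r => 1 / B r) id ψ) : IsNakedSingularity I A B := by
  have hk := h.pos_k
  have hA₀ := h.pos_A₀
  have hc1 : 0 < 1 - c := by linarith
  have hI := h.range_eq hc
  obtain ⟨τ, hτ, hlim⟩ := h.exists_parameter hc
  have hpos : ∀ r > 0, 0 < A r ∧ 0 < B r := fun r hr => by
    have := hs.pos r (by rw [hI]; exact hr)
    exact ⟨this.1, one_div_pos.1 this.2.1⟩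
  have hBlow : ∀ r > 0, ((1 - c) / (2 * τ r)) ^ 2 ≤ B r := by
    intro r hr
    obtain ⟨hT, hr'⟩ := hτ r hr
    have e := h.B_eq _ hT
    rw [hr'] at e
    have := hT.1
    rw [e]
    exact pow_le_pow_left₀ (by positivity)
      (div_le_div_of_nonneg_right h.one_sub_le (by positivity)) 2
  refine ⟨hI, hpos, fun t θ φ hθ => ?_, h.isAsymptoticallyFlat ⟨0, fun r hr => by
    rw [hI]; exact hr⟩, fun R hR => ?_⟩
  · have hBt : Tendsto B (𝓝[>] 0) atTop := by
      have h1 : Tendsto (fun r => ((1 - c) / 2 * (τ r)⁻¹) ^ 2) (𝓝[>] 0) atTop :=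
        (tendsto_pow_atTop two_ne_zero).comp
          ((tendsto_inv_nhdsGT_zero.comp hlim).const_mul_atTop (by positivity))
      refine tendsto_atTop_mono' _ ?_ h1
      filter_upwards [self_mem_nhdsWithin] with r hr
      refine le_trans (le_of_eq ?_) (hBlow r hr)
      have := (hτ r hr).1.1
      field_simp
    -- The curvature of the spheres' tangent planes alone suffices: for `r < 1` and `B ≥ 2` its
    -- square `((1 - B) / r²)²` is at least `B - 1`.
    refine tendsto_atTop_mono' _ ?_ (tendsto_atTop_add_const_right _ (-1) hBt)
    filter_upwards [Ioo_mem_nhdsGT (zero_lt_one' ℝ), hBt.eventually_ge_atTop 2] with r hr hB2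
    have hp : (![t, r, θ, φ] : Fin 4 → ℝ) 1 ∈ I := by
      rw [hI]
      exact hr.1
    rw [schwarzschildForm, kretschmann_staticMetric (hs.regularAt hp hθ)]
    have e : sectional A (fun r => 1 / B r) id ((![t, r, θ, φ] : Fin 4 → ℝ) 1) 2 3 =
        (1 - B r) / r ^ 2 := by
      simp [sectional]
    rw [e]
    have h1 : (B r - 1) ^ 2 ≤ ((1 - B r) / r ^ 2) ^ 2 := by
      rw [div_pow, le_div_iff₀ (by have := hr.1; positivity)]
      have h2 : (r ^ 2) ^ 2 ≤ 1 := by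
        have := hr.1
        have := hr.2
        have h3 : r ^ 2 ≤ 1 := by nlinarith
        nlinarith [sq_nonneg r]
      nlinarith [sq_nonneg (B r - 1)]
    have h2 : B r - 1 ≤ (B r - 1) ^ 2 := by nlinarith
    have h3 := sq_nonneg (sectional A (fun r => 1 / B r) id ((![t, r, θ, φ] : Fin 4 → ℝ) 1) 0 1)
    have h4 := sq_nonneg (sectional A (fun r => 1 / B r) id ((![t, r, θ, φ] : Fin 4 → ℝ) 1) 0 2)
    have h5 := sq_nonneg (sectional A (fun r => 1 / B r) id ((![t, r, θ, φ] : Fin 4 → ℝ) 1) 1 2)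
    have h6 := sq_nonneg ((1 - B r) / r ^ 2)
    linarith
  · have hsub : Ioc 0 R ⊆ I := fun r hr => by
      rw [hI]
      exact hr.1
    have cA : ContinuousOn A (Ioc 0 R) := hs.contDiff_A.continuousOn.mono hsub
    have cH : ContinuousOn (fun r => 1 / B r) (Ioc 0 R) := hs.contDiff_H.continuousOn.mono hsub
    have cB : ContinuousOn B (Ioc 0 R) :=
      ((continuousOn_const (c := (1 : ℝ))).div cH fun r hr => (hs.pos r (hsub hr)).2.1.ne').congr fun r hr => by
        simp
    have cAB : ContinuousOn (fun r => 1 / √(A r * B r)) (Ioc 0 R) :=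
      continuousOn_const.div (cA.mul cB).sqrt fun r hr =>
        (Real.sqrt_pos.2 (mul_pos (hpos r hr.1).1 (hpos r hr.1).2)).ne'
    -- The integrand is even bounded: `A B ≥ A₀ ((1 - c) / 2)² T ^ (2c - 2)`, and the exponent is
    -- negative while `T < 1`.
    refine MeasureTheory.Integrable.of_bound (cAB.aestronglyMeasurable measurableSet_Ioc)
      (1 / √(A₀ * ((1 - c) / 2) ^ 2)) ?_
    refine (MeasureTheory.ae_restrict_iff' measurableSet_Ioc).2 (Eventually.of_forall fun r hr => ?_)
    obtain ⟨hT, hr'⟩ := hτ r hr.1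
    have hA := h.A_eq _ hT
    rw [hr'] at hA
    have h1 : A₀ * ((1 - c) / 2) ^ 2 ≤ A r * B r := by
      have h3 := hT.1
      have h4 : 1 ≤ τ r ^ (2 * c - 2) :=
        one_le_rpow_of_pos_of_le_one_of_nonpos hT.1 hT.2.le (by linarith)
      calc A₀ * ((1 - c) / 2) ^ 2 ≤ A₀ * ((1 - c) / 2) ^ 2 * τ r ^ (2 * c - 2) :=
            le_mul_of_one_le_right (by positivity) h4
        _ = A r * ((1 - c) / (2 * τ r)) ^ 2 := by
            rw [hA, rpow_sub h3, rpow_two]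
            field_simp
        _ ≤ A r * B r := mul_le_mul_of_nonneg_left (hBlow r hr.1) (hpos r hr.1).1.le
    rw [Real.norm_eq_abs, abs_of_nonneg (by positivity)]
    gcongr

end IsOrbitMetric

/-- Every solution going to or coming from infinity describes an `IsOrbitMetric`. -/
theorem exists_isOrbitMetric_of_either {γ : ℝ → ℝ × ℝ} {J I : Set ℝ} {A B : ℝ → ℝ} {Q Q' : ℝ × ℝ}
    (h : IsMaximalSolution γ J) (hd : Describes γ J I A B)
    (hQ : GoesToPM γ J Q ∨ ComesFromPMbar γ J Q') (hQQ : Q' = -Q) :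
    ∃ k A₀ c, Q = endpoint c ∧ IsOrbitMetric k A₀ c I A B := by
  subst hQQ
  rcases hQ with hQ | hQ
  · exact exists_isOrbitMetric h hd hQ
  · have := hQ.reflect
    rw [neg_neg] at this
    exact exists_isOrbitMetric h.reflect hd.reflect this

theorem constraint_eq {γ : ℝ → ℝ × ℝ} {J : Set ℝ} {c : ℝ} {Q' : ℝ × ℝ}
    (h : IsMaximalSolution γ J) (hQ : GoesToPM γ J (endpoint c) ∨ ComesFromPMbar γ J Q')
    (hQQ : Q' = -endpoint c) :
    |c| ≤ 1 ∧ ∀ ξ ∈ J, ∃ s ≠ 0, (γ ξ).1 ^ 2 + 2 * (γ ξ).1 * (γ ξ).2 =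
      1 + (1 - c ^ 2) / sinh s ^ 2 := by
  have key : ∀ {γ : ℝ → ℝ × ℝ} {J : Set ℝ}, IsMaximalSolution γ J → GoesToPM γ J (endpoint c) →
      |c| ≤ 1 ∧ ∀ ξ ∈ J, ∃ s ≠ 0, (γ ξ).1 ^ 2 + 2 * (γ ξ).1 * (γ ξ).2 =
      1 + (1 - c ^ 2) / sinh s ^ 2 := by
    intro γ J h hQ
    obtain ⟨a, c', hc', rfl, h1, h2⟩ := h.exists_orbit_of_goesToPM hQ
    rw [endpoint_injective h2]
    refine ⟨hc', fun ξ hξ => ?_⟩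
    have hs : ξ - a ≠ 0 := sub_ne_zero.2 (ne_of_gt hξ)
    exact ⟨ξ - a, hs, by rw [h1 ξ hξ, orbit_constraint c' hs]⟩
  subst hQQ
  rcases hQ with hQ | hQ
  · exact key h hQ
  · have h1 := hQ.reflect
    rw [neg_neg] at h1
    obtain ⟨h2, h3⟩ := key h.reflect h1
    refine ⟨h2, fun ξ hξ => ?_⟩
    obtain ⟨s, hs, h4⟩ := h3 (-ξ) (by simpa using hξ)
    refine ⟨s, hs, ?_⟩
    rw [← h4]
    simp [reflection]

/-! ### The spacetimes belonging to the individual points at infinity. -/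

theorem horizon {γ : ℝ → ℝ × ℝ} {J I : Set ℝ} {A B : ℝ → ℝ}
    (h : IsMaximalSolution γ J) (hd : Describes γ J I A B)
    (hQ : GoesToPM γ J PH ∨ ComesFromPMbar γ J PHbar) :
    (∀ ξ ∈ J, (γ ξ).1 ^ 2 + 2 * (γ ξ).1 * (γ ξ).2 = 1) ∧
      (∃ M > 0, IsSchwarzschild M I A B) ∧ IsHorizonExterior I A B ∧ IsAsymptoticallyFlat A B := by
  obtain ⟨ψ, hs⟩ := h.exists_isScalarSpacetime hd
  obtain ⟨k, A₀, c, h1, h2⟩ := exists_isOrbitMetric_of_either h hd hQ neg_PH.symm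
  rw [← endpoint_one] at h1
  obtain rfl := endpoint_injective h1
  have hM : 0 < k / 2 := half_pos h2.pos_k
  have hS := h2.isSchwarzschild_of_one
  refine ⟨fun ξ hξ => ?_, ⟨_, hM, hS⟩, hS.isHorizonExterior hM hs,
    h2.isAsymptoticallyFlat ⟨2 * (k / 2), fun r hr => by rw [hS.range_eq hM]; exact hr⟩⟩
  rw [← endpoint_one] at hQ
  obtain ⟨s, -, h3⟩ := (constraint_eq h hQ (by rw [endpoint_one, neg_PH])).2 ξ hξ
  rw [h3]
  simp

theorem nakedSingularity {γ : ℝ → ℝ × ℝ} {J I : Set ℝ} {A B : ℝ → ℝ} {Q : ℝ × ℝ}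
    (h : IsMaximalSolution γ J) (hd : Describes γ J I A B)
    (hQ : (GoesToPM γ J Q ∧ Q ≠ PH) ∨ (ComesFromPMbar γ J Q ∧ Q ≠ PHbar)) :
    IsNakedSingularity I A B ∧ HasPowerLaw A B (-2 * (1 + Q.2 / Q.1)) (2 * Q.2 / Q.1) := by
  obtain ⟨ψ, hs⟩ := h.exists_isScalarSpacetime hd
  have key : ∀ {k A₀ c}, IsOrbitMetric k A₀ c I A B → endpoint c ≠ PH → c < 1 := by
    intro k A₀ c h hne
    refine lt_of_le_of_ne (abs_le.1 h.abs_le).2 fun h => hne ?_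
    rw [h, endpoint_one]
  rcases hQ with ⟨hQ, hne⟩ | ⟨hQ, hne⟩
  · obtain ⟨k, A₀, c, rfl, h2⟩ := exists_isOrbitMetric h hd hQ
    exact ⟨h2.isNakedSingularity (key h2 hne) hs, h2.hasPowerLaw (key h2 hne)⟩
  · obtain ⟨k, A₀, c, h1, h2⟩ := exists_isOrbitMetric h.reflect hd.reflect hQ.reflect
    have hne' : endpoint c ≠ PH := fun h => hne (by rw [← neg_neg Q, h1, h, neg_PH])
    -- The exponents depend only on the ratio of the components, which `Q` and `-Q` share.
    have h3 := h2.hasPowerLaw (key h2 hne')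
    rw [← h1] at h3
    rw [Prod.fst_neg, Prod.snd_neg, mul_neg, neg_div_neg_eq, neg_div_neg_eq] at h3
    exact ⟨h2.isNakedSingularity (key h2 hne') hs, h3⟩

theorem negativeMass {γ : ℝ → ℝ × ℝ} {J I : Set ℝ} {A B : ℝ → ℝ}
    (h : IsMaximalSolution γ J) (hd : Describes γ J I A B)
    (hQ : GoesToPM γ J PS ∨ ComesFromPMbar γ J PSbar) :
    (∀ ξ ∈ J, (γ ξ).1 ^ 2 + 2 * (γ ξ).1 * (γ ξ).2 = 1) ∧ ∃ M < 0, IsSchwarzschild M I A B := by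
  obtain ⟨k, A₀, c, h1, h2⟩ := exists_isOrbitMetric_of_either h hd hQ neg_PS.symm
  rw [← endpoint_neg_one] at h1
  obtain rfl := endpoint_injective h1
  refine ⟨fun ξ hξ => ?_, _, neg_lt_zero.2 (half_pos h2.pos_k), h2.isSchwarzschild_of_neg_one⟩
  rw [← endpoint_neg_one] at hQ
  obtain ⟨s, -, h3⟩ := (constraint_eq h hQ (by rw [endpoint_neg_one, neg_PS])).2 ξ hξ
  rw [h3]
  simp

theorem one_lt_constraint {γ : ℝ → ℝ × ℝ} {J : Set ℝ} {Q : ℝ × ℝ} (h : IsMaximalSolution γ J)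
    (hQ : (GoesToPM γ J Q ∧ Q ≠ PH ∧ Q ≠ PS) ∨ (ComesFromPMbar γ J Q ∧ Q ≠ PHbar ∧ Q ≠ PSbar))
    {ξ : ℝ} (hξ : ξ ∈ J) : 1 < (γ ξ).1 ^ 2 + 2 * (γ ξ).1 * (γ ξ).2 := by
  have key : ∀ {Q}, (GoesToPM γ J Q ∨ ComesFromPMbar γ J (-Q)) → (∃ c, Q = endpoint c) →
      Q ≠ PH → Q ≠ PS → 1 < (γ ξ).1 ^ 2 + 2 * (γ ξ).1 * (γ ξ).2 := by
    rintro _ hQ ⟨c, rfl⟩ h1 h2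
    obtain ⟨hc, h3⟩ := constraint_eq h hQ rfl
    obtain ⟨s, hs, h4⟩ := h3 ξ hξ
    rw [h4]
    -- The values `c = 1` and `c = -1` are the excluded end points P_H and P_S of the arc.
    have h5 : c ^ 2 < 1 := by
      refine lt_of_le_of_ne ((sq_le_one_iff_abs_le_one c).2 hc) fun h5 => ?_
      rcases sq_eq_sq_iff_eq_or_eq_neg.1 (h5.trans (one_pow 2).symm) with h6 | h6
      · exact h1 (by rw [h6, endpoint_one])
      · exact h2 (by rw [h6, endpoint_neg_one])
    have h6 : sinh s ≠ 0 := by simpa using hs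
    have : 0 < (1 - c ^ 2) / sinh s ^ 2 := div_pos (by linarith) (by positivity)
    linarith
  rcases hQ with ⟨hQ, h1, h2⟩ | ⟨hQ, h1, h2⟩
  · obtain ⟨a, c, -, -, -, h3⟩ := h.exists_orbit_of_goesToPM hQ
    exact key (Or.inl hQ) ⟨c, h3⟩ h1 h2
  · obtain ⟨a, c, -, -, -, h3⟩ := h.reflect.exists_orbit_of_goesToPM hQ.reflect
    exact key (Q := -Q) (Or.inr (by rwa [neg_neg])) ⟨c, h3⟩
      (fun h => h1 (by rw [← neg_neg Q, h, neg_PH]))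
      (fun h => h2 (by rw [← neg_neg Q, h, neg_PS]))

end StaticScalar

end

/-! ### The main theorem. -/

open StaticScalar in
theorem mainTheorem3 :
    -- reduction of the field equations to the planar system
    (∀ (I : Set ℝ) (A H r ψ : ℝ → ℝ), IsScalarSpacetime I A H r ψ → ∀ ρ ∈ I,
      DifferentiableAt ℝ (x₂ H r) ρ ∧ DifferentiableAt ℝ (x₃ A H r) ρ ∧
      (normDeriv H r (x₂ H r) ρ, normDeriv H r (x₃ A H r) ρ) = field (x₂ H r ρ, x₃ A H r ρ) ∧
      y₁ H r ψ ρ ^ 2 = x₂ H r ρ ^ 2 + 2 * x₂ H r ρ * x₃ A H r ρ - 1 ∧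
      (x₂ H r ρ, x₃ A H r ρ) ∈ phaseSpace) ∧
    -- every point of the phase space lies on a maximal solution, every solution describes a
    -- spacetime, and every such spacetime solves the field equations
    (∀ x ∈ phaseSpace, ∃ γ J, IsMaximalSolution γ J ∧ (0 : ℝ) ∈ J ∧ γ 0 = x) ∧
    (∀ γ J, IsMaximalSolution γ J → ∃ I A B, Describes γ J I A B) ∧
    (∀ γ J I A B, IsMaximalSolution γ J → Describes γ J I A B →
      ∃ ψ, IsScalarSpacetime I A (fun r => 1 / B r) id ψ) ∧
    -- the fixed points: a sink and a source, both Minkowski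
    {x | x ∈ phaseSpace ∧ field x = 0} = {PM, PMbar} ∧
    (∀ μ : ℝ, Module.End.HasEigenvalue
      ((fderiv ℝ field PM : ℝ × ℝ →L[ℝ] ℝ × ℝ) : Module.End ℝ (ℝ × ℝ)) μ ↔ μ = -2 ∨ μ = -1) ∧
    (∀ μ : ℝ, Module.End.HasEigenvalue
      ((fderiv ℝ field PMbar : ℝ × ℝ →L[ℝ] ℝ × ℝ) : Module.End ℝ (ℝ × ℝ)) μ ↔ μ = 2 ∨ μ = 1) ∧
    IsAsymptoticallyStable field univ PM ∧
    IsAsymptoticallyStable (fun x => -field x) univ PMbar ∧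
    (∀ γ J I A B, IsMaximalSolution γ J → Describes γ J I A B →
      (∀ ξ ∈ J, γ ξ = PM) ∨ (∀ ξ ∈ J, γ ξ = PMbar) → IsMinkowski I A B) ∧
    -- the Poincaré compactification
    BijOn toPoincare phaseSpace (poincareSpace \ atInfinity) ∧
    (∀ x, HasFDerivAt toPoincare (fderiv ℝ toPoincare x) x ∧
      √(1 - (toPoincare x).1 ^ 2 - (toPoincare x).2 ^ 2) • fderiv ℝ toPoincare x (field x)
        = poincareField (toPoincare x)) ∧
    -- the points at infinity: two arcs of critical points, and the stability of their end points
    (∀ X ∈ atInfinity, poincareField X = 0) ∧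
    atInfinity = rightArc ∪ leftArc ∧ Disjoint rightArc leftArc ∧
    {X | X ∈ atInfinity ∧ 2 * X.1 ^ 2 + 2 * X.1 * X.2 + X.2 ^ 2 = 1} = {PH, PHbar, PS, PSbar} ∧
    PH ∈ rightArc ∧ PS ∈ rightArc ∧ PHbar ∈ leftArc ∧ PSbar ∈ leftArc ∧
    ¬ IsStable poincareField poincareSpace PH ∧
    IsStable poincareField poincareSpace PHbar ∧
    ¬ IsStable poincareField poincareSpace PS ∧
    IsStable poincareField poincareSpace PSbar ∧
    -- all maximal solutions
    (∀ γ J, IsMaximalSolution γ J →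
      (J = univ ∧ ∀ ξ, γ ξ = PM) ∨ (J = univ ∧ ∀ ξ, γ ξ = PMbar) ∨
      (∃ Q ∈ rightArc, GoesToPM γ J Q) ∨ (∃ Q ∈ leftArc, ComesFromPMbar γ J Q)) ∧
    -- exactly one orbit comes from (goes to) each point at infinity
    (∀ Q ∈ rightArc, ∃! O : Set (ℝ × ℝ), ∃ γ J, IsMaximalSolution γ J ∧ GoesToPM γ J Q ∧
      O = γ '' J) ∧
    (∀ Q ∈ leftArc, ∃! O : Set (ℝ × ℝ), ∃ γ J, IsMaximalSolution γ J ∧ ComesFromPMbar γ J Q ∧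
      O = γ '' J) ∧
    -- the horizons: the Schwarzschild solution
    (∀ γ J I A B, IsMaximalSolution γ J → Describes γ J I A B →
      GoesToPM γ J PH ∨ ComesFromPMbar γ J PHbar →
      (∀ ξ ∈ J, (γ ξ).1 ^ 2 + 2 * (γ ξ).1 * (γ ξ).2 = 1) ∧
      (∃ M > 0, IsSchwarzschild M I A B) ∧ IsHorizonExterior I A B ∧ IsAsymptoticallyFlat A B) ∧
    -- all other points at infinity: naked singularities
    (∀ γ J I A B Q, IsMaximalSolution γ J → Describes γ J I A B →
      (GoesToPM γ J Q ∧ Q ∈ rightArc ∧ Q ≠ PH) ∨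
        (ComesFromPMbar γ J Q ∧ Q ∈ leftArc ∧ Q ≠ PHbar) →
      IsNakedSingularity I A B ∧ HasPowerLaw A B (-2 * (1 + Q.2 / Q.1)) (2 * Q.2 / Q.1)) ∧
    -- the points `P_S`, `P̄_S`: the Schwarzschild solution of negative mass; in all remaining cases
    -- the scalar field is not constant
    (∀ γ J I A B, IsMaximalSolution γ J → Describes γ J I A B →
      GoesToPM γ J PS ∨ ComesFromPMbar γ J PSbar →
      (∀ ξ ∈ J, (γ ξ).1 ^ 2 + 2 * (γ ξ).1 * (γ ξ).2 = 1) ∧ ∃ M < 0, IsSchwarzschild M I A B) ∧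
    (∀ γ J Q, IsMaximalSolution γ J →
      (GoesToPM γ J Q ∧ Q ≠ PH ∧ Q ≠ PS) ∨ (ComesFromPMbar γ J Q ∧ Q ≠ PHbar ∧ Q ≠ PSbar) →
      ∀ ξ ∈ J, 1 < (γ ξ).1 ^ 2 + 2 * (γ ξ).1 * (γ ξ).2) := by
  refine ⟨fun I A H r ψ h ρ hρ => reduction h hρ,
    fun x hx => exists_isMaximalSolution hx,
    fun γ J h => h.exists_describes,
    fun γ J I A B h hd => h.exists_isScalarSpacetime hd,
    fixedPoints_eq, hasEigenvalue_fderiv_field_PM, hasEigenvalue_fderiv_field_PMbar,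
    isAsymptoticallyStable_PM, isAsymptoticallyStable_PMbar,
    fun γ J I A B h hd hγ => isMinkowski_of_fixedPoint h hd hγ,
    bijOn_toPoincare,
    fun x => ⟨(differentiableAt_toPoincare x).hasFDerivAt, fderiv_toPoincare_field x⟩,
    fun X hX => poincareField_eq_zero hX,
    atInfinity_eq, disjoint_rightArc_leftArc, atInfinity_boundary,
    PH_mem_rightArc, PS_mem_rightArc, PHbar_mem_leftArc, PSbar_mem_leftArc,
    not_isStable_PH, isStable_PHbar, not_isStable_PS, isStable_PSbar,
    fun γ J h => h.trichotomy,
    fun Q hQ => existsUnique_orbit_goesToPM hQ,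
    fun Q hQ => existsUnique_orbit_comesFromPMbar hQ,
    fun γ J I A B h hd hQ => horizon h hd hQ,
    fun γ J I A B Q h hd hQ => nakedSingularity h hd
      (hQ.imp (fun h => ⟨h.1, h.2.2⟩) fun h => ⟨h.1, h.2.2⟩),
    fun γ J I A B h hd hQ => negativeMass h hd hQ,
    fun γ J Q h hQ ξ hξ => one_lt_constraint h hQ hξ⟩
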